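/- **Setting.** Let $n\ge 4$, $l\ge 1$, $I=\{0,1,\dots,n\}$, and let $A=(a_{ij})_{i,j\in I}$ be the generalized Cartan matrix of $\mathfrak g=D_n^{(1)}$ (in its Dynkin diagram $0$ and $1$ are joined to $2$, then $2-3-\cdots-(n-2)$, and $n-1$, $n$ are joined to $n-2$). Classical weights are the elements of $\bigoplus_{i\in I}\mathbb Z\Lambda_i$. **The perfect crystal.** $B^{l}$ is the set of $b=(x_1,\dots,x_n|\bar x_n,\dots,\bar x_1)$ with $x_i,\bar x_i\in\mathbb Z_{\ge 0}$, $x_n=0$ or $\bar x_n=0$, and $\sum_{i=1}^n(x_i+\bar x_i)=l$. In the following, a result outside $B^{l}$ means $0$, and unmentioned coordinates do not change. $\tilde f_0$: if $x_2\ge\bar x_2$ then $x_2\mapsto x_2+1$, $\bar x_1\mapsto\bar x_1-1$, otherwise $x_1\mapsto x_1+1$, $\bar x_2\mapsto\bar x_2-1$. $\tilde f_i$ $(1\le i\le n-2)$: if $x_{i+1}\ge\bar x_{i+1}$ then $x_i\mapsto x_i-1$, $x_{i+1}\mapsto x_{i+1}+1$, otherwise $\bar x_{i+1}\mapsto\bar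 x_{i+1}-1$, $\bar x_i\mapsto\bar x_i+1$. $\tilde f_{n-1}$: if $\bar x_n=0$ then $x_{n-1}\mapsto x_{n-1}-1$, $x_n\mapsto x_n+1$, otherwise $\bar x_n\mapsto\bar x_n-1$, $\bar x_{n-1}\mapsto\bar x_{n-1}+1$. $\tilde f_n$: if $x_n\ge1$ then $x_n\mapsto x_n-1$, $\bar x_{n-1}\mapsto\bar x_{n-1}+1$, otherwise $x_{n-1}\mapsto x_{n-1}-1$, $\bar x_n\mapsto\bar x_n+1$. $\tilde e_0$: if $x_2>\bar x_2$ then $x_2\mapsto x_2-1$, $\bar x_1\mapsto\bar x_1+1$, otherwise $x_1\mapsto x_1-1$, $\bar x_2\mapsto\bar x_2+1$. $\tilde e_i$ $(1\le i\le n-2)$: if $x_{i+1}>\bar x_{i+1}$ then $x_i\mapsto x_i+1$, $x_{i+1}\mapsto x_{i+1}-1$, otherwise $\bar x_{i+1}\mapsto\bar x_{i+1}+1$, $\bar x_i\mapsto\bar x_i-1$. $\tilde e_{n-1}$: if $x_n\ge1$ then $x_{n-1}\mapsto x_{n-1}+1$, $x_n\mapsto x_n-1$, otherwise $\bar x_n\mapsto\bar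 x_n+1$, $\bar x_{n-1}\mapsto\bar x_{n-1}-1$. $\tilde e_n$: if $\bar x_n=0$ then $x_n\mapsto x_n+1$, $\bar x_{n-1}\mapsto\bar x_{n-1}-1$, otherwise $x_{n-1}\mapsto x_{n-1}+1$, $\bar x_n\mapsto\bar x_n-1$. With $(t)_+=\max(0,t)$ put $\varphi_0=\bar x_1+(\bar x_2-x_2)_+$, $\varphi_i=x_i+(\bar x_{i+1}-x_{i+1})_+$ $(1\le i\le n-2)$, $\varphi_{n-1}=x_{n-1}+\bar x_n$, $\varphi_n=x_{n-1}+x_n$, $\varepsilon_0=x_1+(x_2-\bar x_2)_+$, $\varepsilon_i=\bar x_i+(x_{i+1}-\bar x_{i+1})_+$ $(1\le i\le n-2)$, $\varepsilon_{n-1}=\bar x_{n-1}+x_n$, $\varepsilon_n=\bar x_{n-1}+\bar x_n$, $\overline{\mathrm{wt}}=\sum_{i\in I}(\varphi_i-\varepsilon_i)\Lambda_i$. **Columns.** Consider a vertical column of unit cubes (cells) at all integer heights. From bottom to top, one cycle of the pattern, of $2n-4$ cells, holds: a $0$- and a $1$-block, each filling half of the cell in depth; unit blocks $2,3,\dots,n-2$;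 an $(n-1)$- and an $n$-block, each filling half of the cell in depth; unit blocks $n-2,n-3,\dots,2$. Of the two patterns (in the first, $0$ and $n-1$ lie in the back halves and $1$ and $n$ in the front halves; in the second, front and back are interchanged) one is chosen once and for all. The whole blocks are the unit blocks $2,\dots,n-2$, the $01$-block ($0$- and $1$-block together) and the $\nu$-block ($(n-1)$- and $n$-block together). The positions of the blocks $2,\dots,n-2$ in the ascending part of the cycle are supporting, those in the descending part are covering; the positions of $0,1,n-1,n$ are both. A level-$1$ slice $c$ is a column, continued indefinitely downwards, in which all cells below some height $h$ are full, the cell of height $h$ is empty or, if the pattern has two half-depth blocks there, contains exactly one of them, and all higher cells are empty. $c\pm\delta$ is $c$ raised or lowered by $2n-4$. A layer may, more generally, have in the cell of height $h$ a broken half (in height) of the whole block of that cell. An $i$-slot of a layer is its top, if an $i$-block can be added there; a whole $i$-slot is an empty top cell that the whole $i$-block would fill, and a layer with a broken half of an $i$-block on top has a half-slot. **Slices.** A level-$l$ pre-slice is an $l$-tuple $C=(c_1,\dots,c_l)$ of level-$1$ slices with $c_1\subset c_2\subset\cdots\subset c_l\subset c_1+\delta$; $c_1$ is the fore-most and $c_l$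 the rear-most layer. To split an $i$-block ($i=01,2,\dots,n-2,\nu$) in a pre-slice, or in a result of such splittings, take the highest height at which a layer has a covering whole $i$-block on top, and the fore-most such layer of that height; take the lowest height at which a layer has a supporting whole $i$-slot, and the rear-most such layer of that height; break off the upper half of that block and place it in that slot. (Both layers must exist. The same with "covering" and "supporting" interchanged is also a splitting.) A level-$l$ slice is a result of finitely many (possibly no) splittings of a level-$l$ pre-slice that admits no further splitting. Set $C+\delta=(c_2,\dots,c_l,c_1+\delta)$, with inverse $C\mapsto C-\delta$, and $C\sim C'$ if $C'=C+m\delta$ for some $m\in\mathbb Z$. Let $\mathcal C^{(l)}$ be the set of $\sim$-classes of level-$l$ slices. **Operators on slices.** Always, a slot or half-slot is chosen rear-most among those of the lowest height, and a block or half-block on top of a layer is chosen fore-most among those of the highest height. For $2\le i\le n-2$, $\tilde f_i C$ is obtained as follows. If $C$ has both covering and supporting whole $i$-slots, place a half $i$-block in the chosen slot of each kind. If it has whole $i$-slots of one kind only, place a half-block in the chosen one, and then another half-block in the chosen half-slot of this kind (the one just created included). If it has half-slots only, place a half-block in the chosen half-slot of each kind. Otherwise $\tilde f_i C=0$. For $\tilde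 e_iC$: if $C$ has both covering and supporting whole $i$-blocks on top of layers, remove the upper half of the chosen one of each kind; if of one kind only, remove the upper half of the chosen one, and then the chosen half-block of this kind (the one just created included); if there are half-blocks only, remove the chosen half-block of each kind; otherwise $\tilde e_iC=0$. For $i\in\{0,1\}$ let $j=01$, for $i\in\{n-1,n\}$ let $j=\nu$. Undo splittings of $j$-blocks as long as the result is still a result of splittings of a pre-slice; then place an $i$-block in the chosen $i$-slot (for $\tilde f_i$), or remove the chosen $i$-block on top of a layer (for $\tilde e_i$), and then split $j$-blocks as long as possible. If there is no $i$-slot (resp. $i$-block), the result is $0$. On $\mathcal C^{(l)}$ put $\varphi_i(C)=\max\{m\mid\tilde f_i^mC\ne0\}$, $\varepsilon_i(C)=\max\{m\mid\tilde e_i^mC\neq0\}$, $\overline{\mathrm{wt}}(C)=\sum_{i\in I}(\varphi_i(C)-\varepsilon_i(C))\Lambda_i$. **The canonical map.** Describe a layer by its top. $s_1$, $\bar s_1$, $s_n$, $\bar s_n$: a single half-depth block of colour $0$, $1$, $n-1$, $n$, respectively. $s_2$: a $01$-block. $s_i$ $(3\le i\le n-1)$: a supporting $(i-1)$-block. $\bar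 s_i$ $(2\le i\le n-2)$: a covering $i$-block. $\bar s_{n-1}$: a $\nu$-block. $t_j$ and $\bar t_j$ $(j=01,2,\dots,n-2,\nu)$: a broken half of a supporting, respectively covering, $j$-block (so $t_{01}=\bar t_{01}$, $t_\nu=\bar t_\nu$). For $b\in B^{l}$, $\psi(b)$ is the class of a level-$l$ slice that consists of $\max(0,x_i-\bar x_i)$ layers $s_i$ and $\max(0,\bar x_i-x_i)$ layers $\bar s_i$ for $1\le i\le n-1$, $x_n$ layers $s_n$, $\bar x_n$ layers $\bar s_n$, $\min(x_i,\bar x_i)$ layers $t_i$ and as many $\bar t_i$ for $2\le i\le n-2$, $2\min(x_1,\bar x_1)$ layers $t_{01}$, and $2\min(x_{n-1},\bar x_{n-1})$ layers $t_\nu$. **Theorem.** A tuple $C$ is a slice if and only if $C+\delta$ is; $\tilde e_i$ and $\tilde f_i$ send slices to slices or to $0$ and induce well-defined maps $\mathcal C^{(l)}\to\mathcal C^{(l)}\sqcup\{0\}$; and the maxima defining $\varphi_i$ and $\varepsilon_i$ exist. With these maps $B^{l}$ and $\mathcal C^{(l)}$ are $U_q'(\mathfrak g)$-crystals. The map $\psi:B^{l}\to\mathcal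 C^{(l)}$ is well defined (for every $b$ a slice as required exists, and all such slices have the same class), and it is an isomorphism of $U_q'(\mathfrak g)$-crystals: it is bijective, preserves $\overline{\mathrm{wt}}$, $\varphi_i$, $\varepsilon_i$, and commutes with $\tilde e_i$ and $\tilde f_i$ for all $i\in I$ (where $\psi(0)=0$). -/

import Mathlib

noncomputable section

namespace DCrystal

/-! ## Crystals of type `D_n^{(1)}`

The index set is `I = {0, 1, …, n} = Fin (n + 1)`.  A classical weight `∑ i, w i • Λ_i` is
the function `w : Fin (n + 1) → ℤ`. -/

/-- Edges (with smaller end first) of the affine Dynkin diagram: `0` and `1` are joined to `2`,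
then `2 - 3 - ⋯ - (n-2)`, and `n-1`, `n` are joined to `n-2`. -/
def edge (n i j : ℕ) : Prop :=
  (i = 0 ∧ j = 2) ∨ (1 ≤ i ∧ j = i + 1 ∧ j ≤ n - 1) ∨ (i = n - 2 ∧ j = n)

open Classical in
/-- The generalized Cartan matrix `a_{ij} = ⟨h_i, α_j⟩`. -/
def cartan (n : ℕ) (i j : Fin (n + 1)) : ℤ :=
  if i = j then 2 else if edge n i j ∨ edge n j i then -1 else 0

/-- The simple root `α_i`, as a classical weight. -/
def simpleRoot (n : ℕ) (i : Fin (n + 1)) : Fin (n + 1) → ℤ := fun j => cartan n j i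

/-- The maps of a crystal; `none` plays the role of `0`, and `⊥` that of `-∞`. -/
structure CrystalData (n : ℕ) (B : Type) where
  wt : B → (Fin (n + 1) → ℤ)
  e : Fin (n + 1) → B → Option B
  f : Fin (n + 1) → B → Option B
  eps : Fin (n + 1) → B → WithBot ℤ
  phi : Fin (n + 1) → B → WithBot ℤ

/-- The axioms of a `U_q'(g)`-crystal. -/
structure IsCrystal {n : ℕ} {B : Type} (D : CrystalData n B) : Prop where
  phi_eq : ∀ i b, D.phi i b = D.eps i b + ((D.wt b i : ℤ) : WithBot ℤ)
  wt_e : ∀ i b b', D.e i b = some b' → D.wt b' = D.wt b + simpleRoot n i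
  wt_f : ∀ i b b', D.f i b = some b' → D.wt b' = D.wt b - simpleRoot n i
  eps_e : ∀ i b b', D.e i b = some b' → D.eps i b' + 1 = D.eps i b
  phi_e : ∀ i b b', D.e i b = some b' → D.phi i b' = D.phi i b + 1
  eps_f : ∀ i b b', D.f i b = some b' → D.eps i b' = D.eps i b + 1
  phi_f : ∀ i b b', D.f i b = some b' → D.phi i b' + 1 = D.phi i b
  f_iff_e : ∀ i b b', D.f i b = some b' ↔ D.e i b' = some b
  bot : ∀ i b, D.phi i b = ⊥ → D.e i b = none ∧ D.f i b = none

/-- An isomorphism of crystals (extended to `0` by `0 ↦ 0`). -/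
structure IsCrystalIso {n : ℕ} {B B' : Type} (D : CrystalData n B) (D' : CrystalData n B')
    (ψ : B → B') : Prop where
  bijective : Function.Bijective ψ
  wt : ∀ b, D'.wt (ψ b) = D.wt b
  eps : ∀ i b, D'.eps i (ψ b) = D.eps i b
  phi : ∀ i b, D'.phi i (ψ b) = D.phi i b
  e : ∀ i b, D'.e i (ψ b) = (D.e i b).map ψ
  f : ∀ i b, D'.f i (ψ b) = (D.f i b).map ψ

/-! ## The perfect crystal -/

/-- `(x, y)` stands for `(x_1, …, x_n | x̄_n, …, x̄_1)` with `x̄ = y`; the entry of index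
`k : Fin n` is the coordinate number `k + 1`. -/
abbrev Coords (n : ℕ) : Type := (Fin n → ℤ) × (Fin n → ℤ)

/-- The coordinate number `i`, for `1 ≤ i ≤ n`. -/
def coord {n : ℕ} (v : Fin n → ℤ) (i : ℕ) : ℤ :=
  if h : 1 ≤ i ∧ i ≤ n then v ⟨i - 1, by omega⟩ else 0

/-- The vector whose coordinate number `i` is `1`, the others being `0`. -/
def unit (n i : ℕ) : Fin n → ℤ := fun k => if k.val + 1 = i then 1 else 0

/-- The tuples that belong to the level-`l` perfect crystal. -/
def IsPerfectElt (n l : ℕ) (b : Coords n) : Prop :=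
  (∀ k, 0 ≤ b.1 k) ∧ (∀ k, 0 ≤ b.2 k) ∧ (coord b.1 n = 0 ∨ coord b.2 n = 0) ∧
    ∑ k, (b.1 k + b.2 k) = (l : ℤ)

/-- The underlying set of the level-`l` perfect crystal of type `D_n^{(1)}`. -/
def Perfect (n l : ℕ) : Type := {b : Coords n // IsPerfectElt n l b}

/-- The formula for `f̃_i`, before one checks that the result lies in the perfect crystal. -/
def fRaw (n i : ℕ) (b : Coords n) : Coords n :=
  let x := coord b.1
  let y := coord b.2
  let u := unit n
  if i = 0 then
    if y 2 ≤ x 2 then (b.1 + u 2, b.2 - u 1) else (b.1 + u 1, b.2 - u 2)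
  else if i ≤ n - 2 then
    if y (i + 1) ≤ x (i + 1) then (b.1 - u i + u (i + 1), b.2)
    else (b.1, b.2 - u (i + 1) + u i)
  else if i = n - 1 then
    if y n = 0 then (b.1 - u (n - 1) + u n, b.2) else (b.1, b.2 - u n + u (n - 1))
  else
    if 1 ≤ x n then (b.1 - u n, b.2 + u (n - 1)) else (b.1 - u (n - 1), b.2 + u n)

/-- The formula for `ẽ_i`, before one checks that the result lies in the perfect crystal. -/
def eRaw (n i : ℕ) (b : Coords n) : Coords n :=
  let x := coord b.1
  let y := coord b.2
  let u := unit n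
  if i = 0 then
    if y 2 < x 2 then (b.1 - u 2, b.2 + u 1) else (b.1 - u 1, b.2 + u 2)
  else if i ≤ n - 2 then
    if y (i + 1) < x (i + 1) then (b.1 + u i - u (i + 1), b.2)
    else (b.1, b.2 + u (i + 1) - u i)
  else if i = n - 1 then
    if 1 ≤ x n then (b.1 + u (n - 1) - u n, b.2) else (b.1, b.2 + u n - u (n - 1))
  else
    if y n = 0 then (b.1 + u n, b.2 - u (n - 1)) else (b.1 + u (n - 1), b.2 - u n)

open Classical in
/-- A tuple outside the perfect crystal is read as `0`. -/
def toPerfect (n l : ℕ) (b : Coords n) : Option (Perfect n l) :=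
  if h : IsPerfectElt n l b then some ⟨b, h⟩ else none

/-- `φ_i` on the perfect crystal; here `(t)_+ = max 0 t`. -/
def phiPerfect (n i : ℕ) (b : Coords n) : ℤ :=
  let x := coord b.1
  let y := coord b.2
  if i = 0 then y 1 + max 0 (y 2 - x 2)
  else if i ≤ n - 2 then x i + max 0 (y (i + 1) - x (i + 1))
  else if i = n - 1 then x (n - 1) + y n
  else x (n - 1) + x n

/-- `ε_i` on the perfect crystal. -/
def epsPerfect (n i : ℕ) (b : Coords n) : ℤ :=
  let x := coord b.1
  let y := coord b.2
  if i = 0 then x 1 + max 0 (x 2 - y 2)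
  else if i ≤ n - 2 then y i + max 0 (x (i + 1) - y (i + 1))
  else if i = n - 1 then y (n - 1) + x n
  else y (n - 1) + y n

/-- The level-`l` perfect crystal `B^{l}` of type `D_n^{(1)}`. -/
def perfectCrystal (n l : ℕ) : CrystalData n (Perfect n l) where
  wt b := fun i => phiPerfect n i b.1 - epsPerfect n i b.1
  e i b := toPerfect n l (eRaw n i b.1)
  f i b := toPerfect n l (fRaw n i b.1)
  eps i b := ((epsPerfect n i b.1 : ℤ) : WithBot ℤ)
  phi i b := ((phiPerfect n i b.1 : ℤ) : WithBot ℤ)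

/-! ## The stacking pattern

Blocks have unit height.  The cell of height `h : ℤ` of a column lies between the levels `h`
and `h + 1`.  From bottom to top the cells of one cycle contain: the `0`- and the `1`-block
(half-unit depth each), the blocks `2, …, n-2`, the `n-1`- and the `n`-block (half-unit depth
each), the blocks `n-2, …, 2`.  The cycle has height `2n - 4`, and height `0` is the bottom
of a cell with the blocks `0` and `1`. -/

/-- The two halves (in depth) of a unit cube. -/
inductive Side
  | front
  | back
deriving DecidableEq

/-- The other half. -/
def Side.other : Side → Side
  | .front => .back
  | .back => .front

/-- The two stacking patterns. -/
inductive Pattern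
  | first
  | second
deriving DecidableEq

/-- The position of a cell within its cycle, between `0` and `2n - 5`. -/
def residue (n : ℕ) (h : ℤ) : ℕ := (h % (2 * (n : ℤ) - 4)).toNat

/-- The name of the whole block filling the cell of height `h`: `1` stands for the whole
`01`-block, `j` for the unit-depth `j`-block (`2 ≤ j ≤ n-2`), and `n-1` for the whole
`(n-1)n`-block. -/
def label (n : ℕ) (h : ℤ) : ℕ := min (residue n h) (2 * n - 4 - residue n h) + 1

/-- The cell of height `h` is filled by two blocks of half-unit depth. -/
def IsDouble (n : ℕ) (h : ℤ) : Prop := label n h = 1 ∨ label n h = n - 1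

/-- The colour of the block at height `h` that occupies the half `s` of the cell. -/
def color (n : ℕ) (pat : Pattern) (h : ℤ) (s : Side) : ℕ :=
  if label n h = 1 then
    match pat, s with
    | .first, .back => 0
    | .first, .front => 1
    | .second, .back => 1
    | .second, .front => 0
  else if label n h = n - 1 then
    match pat, s with
    | .first, .back => n - 1
    | .first, .front => n
    | .second, .back => n
    | .second, .front => n - 1
  else label n h

/-- Covering and supporting positions. -/
inductive Kind
  | covering
  | supporting

/-- The opposite kind. -/
def Kind.swap : Kind → Kind
  | .covering => .supporting
  | .supporting => .covering

/-- The position of height `h` is of kind `k`.  The positions of the `0`, `1`, `n-1` and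
`n`-blocks, which occur once in a cycle, are of both kinds. -/
def Kind.At (n : ℕ) : Kind → ℤ → Prop
  | .covering, h => residue n h = 0 ∨ n - 2 ≤ residue n h
  | .supporting, h => residue n h ≤ n - 2

/-! ## Layers, level-`1` slices and pre-slices -/

/-- What the top cell of a layer contains: nothing (`flat`), one block of half-unit depth
(`single`), or a broken half, of half-unit height, of a whole block (`broken`). -/
inductive Top
  | flat
  | single (s : Side)
  | broken
deriving DecidableEq

/-- A column of unit depth whose cells of height `< height` are all filled by whole blocks,
whose cell of height `height` is occupied according to `top`, and whose higher cells are empty.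
So nothing stands on a block of half-unit depth or on a broken half.  Only the position of the top
within the pattern matters: a column is continued downwards indefinitely, so that a `δ` can
always be removed. -/
@[ext] structure Layer where
  height : ℤ
  top : Top
deriving DecidableEq

/-- The column is a level-`1` slice: no broken halves, and single half-unit depth blocks occur
only where the pattern has blocks of half-unit depth. -/
def Layer.IsLevelOne (n : ℕ) (c : Layer) : Prop :=
  c.top ≠ .broken ∧ ∀ s, c.top = .single s → IsDouble n c.height

/-- The blocks that make up a level-`1` slice, by the half-cells that they fill. -/
def Layer.blocks (c : Layer) : Set (ℤ × Side) :=
  {b | b.1 < c.height ∨ (b.1 = c.height ∧ c.top = .single b.2)}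

/-- `c + δ`. -/
def Layer.addDelta (n : ℕ) (c : Layer) : Layer := ⟨c.height + (2 * (n : ℤ) - 4), c.top⟩

/-- An ordered `l`-tuple of layers; the layer of index `0` is the fore-most one. -/
abbrev Tuple (l : ℕ) : Type := Fin l → Layer

/-- Level-`l` pre-slices: `c_1 ⊂ c_2 ⊂ ⋯ ⊂ c_l ⊂ c_1 + δ`. -/
def IsPreSlice (n : ℕ) {l : ℕ} (C : Tuple l) : Prop :=
  (∀ a, (C a).IsLevelOne n) ∧
  (∀ a b : Fin l, a ≤ b → (C a).blocks ⊆ (C b).blocks) ∧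
  (∀ a b : Fin l, a.val = 0 → b.val = l - 1 →
    (C b).blocks ⊆ ((C a).addDelta n).blocks)

/-! ## Splitting -/

/-- The top of the layer is a whole `j`-block of kind `k`. -/
def HasWholeBlock (n : ℕ) (k : Kind) (j : ℕ) (c : Layer) : Prop :=
  c.top = .flat ∧ label n (c.height - 1) = j ∧ k.At n (c.height - 1)

/-- The top of the layer is a whole `j`-slot of kind `k`. -/
def HasWholeSlot (n : ℕ) (k : Kind) (j : ℕ) (c : Layer) : Prop :=
  c.top = .flat ∧ label n c.height = j ∧ k.At n c.height

/-- The top of the layer is a broken half of a whole `j`-block of kind `k`; it is at the same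
time a half of a `j`-slot. -/
def HasHalf (n : ℕ) (k : Kind) (j : ℕ) (c : Layer) : Prop :=
  c.top = .broken ∧ label n c.height = j ∧ k.At n c.height

/-- The height of the cell containing the topmost block (or half-block). -/
def Layer.blockHeight (c : Layer) : ℤ :=
  match c.top with
  | .flat => c.height - 1
  | _ => c.height

/-- Among the layers with property `P` (having a slot), `a` is the rear-most of those whose slot
has the lowest height. -/
def RearLowest {l : ℕ} (P : Layer → Prop) (C : Tuple l) (a : Fin l) : Prop :=
  P (C a) ∧ ∀ b, P (C b) →
    (C a).height < (C b).height ∨ ((C a).height = (C b).height ∧ b ≤ a)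

/-- Among the layers with property `P` (having a block on top), `a` is the fore-most of those
whose block has the highest height. -/
def ForeHighest {l : ℕ} (P : Layer → Prop) (C : Tuple l) (a : Fin l) : Prop :=
  P (C a) ∧ ∀ b, P (C b) →
    (C b).blockHeight < (C a).blockHeight ∨
      ((C b).blockHeight = (C a).blockHeight ∧ a ≤ b)

/-- Break off the upper half of the whole block at the top. -/
def Layer.removeUpperHalf (c : Layer) : Layer := ⟨c.height - 1, .broken⟩
/-- Remove the broken half at the top. -/
def Layer.removeHalf (c : Layer) : Layer := ⟨c.height, .flat⟩
/-- Place a half-block in the whole slot at the top. -/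
def Layer.addHalf (c : Layer) : Layer := ⟨c.height, .broken⟩
/-- Complete the broken half at the top to a whole block. -/
def Layer.completeHalf (c : Layer) : Layer := ⟨c.height + 1, .flat⟩

/-- `C'` results from `C` by splitting one `j`-block (`1` and `n-1` being the labels of the whole
`01`- and `(n-1)n`-blocks). -/
def SplitStep (n j : ℕ) {l : ℕ} (C C' : Tuple l) : Prop :=
  ∃ (k : Kind) (a b : Fin l),
    ForeHighest (HasWholeBlock n k j) C a ∧ RearLowest (HasWholeSlot n k.swap j) C b ∧
    C' = Function.update (Function.update C a (C a).removeUpperHalf) b (C b).addHalf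

/-- `C` results from a pre-slice by splitting any number of blocks. -/
def IsSplitResult (n : ℕ) {l : ℕ} (C : Tuple l) : Prop :=
  ∃ C₀ : Tuple l, IsPreSlice n C₀ ∧
    Relation.ReflTransGen (fun D D' => ∃ j, SplitStep n j D D') C₀ C

/-- Level-`l` slices: the split forms of the level-`l` pre-slices. -/
def IsSlice (n : ℕ) {l : ℕ} (C : Tuple l) : Prop :=
  IsSplitResult n C ∧ ∀ j C', ¬ SplitStep n j C C'

/-- The set of level-`l` slices. -/
def Slice (n l : ℕ) : Type := {C : Tuple l // IsSlice n C}

/-- `D` results from `C` by splitting every `j`-block possible. -/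
def SplitAll (n j : ℕ) {l : ℕ} (C D : Tuple l) : Prop :=
  Relation.ReflTransGen (SplitStep n j) C D ∧ ∀ D', ¬ SplitStep n j D D'

/-- `D` results from `C` by un-splitting one `j`-block. -/
def UnsplitStep (n j : ℕ) {l : ℕ} (C D : Tuple l) : Prop :=
  IsSplitResult n D ∧ SplitStep n j D C

/-- `D` results from `C` by un-splitting every `j`-block possible. -/
def UnsplitAll (n j : ℕ) {l : ℕ} (C D : Tuple l) : Prop :=
  Relation.ReflTransGen (UnsplitStep n j) C D ∧ ∀ D', ¬ UnsplitStep n j D D'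

/-! ## Kashiwara operators on slices

`FStep n pat i C C'` means `f̃_i C = C'`; if there is no such `C'` then `f̃_i C = 0`.  Similarly
for `EStep` and `ẽ_i`. -/

/-- Some layer of `C` has the property `P`. -/
def Occurs {l : ℕ} (P : Layer → Prop) (C : Tuple l) : Prop := ∃ a, P (C a)

/-- `f̃_i` for `2 ≤ i ≤ n-2`. -/
def FMid (n i : ℕ) {l : ℕ} (C C' : Tuple l) : Prop :=
  -- full-slots of both kinds
  (∃ a b, RearLowest (HasWholeSlot n .covering i) C a ∧
    RearLowest (HasWholeSlot n .supporting i) C b ∧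
    C' = Function.update (Function.update C a (C a).addHalf) b (C b).addHalf) ∨
  -- full-slots of one kind only
  (∃ (k : Kind) (a b : Fin l) (C₁ : Tuple l), ¬ Occurs (HasWholeSlot n k.swap i) C ∧
    RearLowest (HasWholeSlot n k i) C a ∧
    C₁ = Function.update C a (C a).addHalf ∧
    RearLowest (HasHalf n k i) C₁ b ∧
    C' = Function.update C₁ b (C₁ b).completeHalf) ∨
  -- half-slots only
  ((∀ k, ¬ Occurs (HasWholeSlot n k i) C) ∧
    ∃ a b, RearLowest (HasHalf n .covering i) C a ∧
      RearLowest (HasHalf n .supporting i) C b ∧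
      C' = Function.update (Function.update C a (C a).completeHalf) b (C b).completeHalf)

/-- `ẽ_i` for `2 ≤ i ≤ n-2`. -/
def EMid (n i : ℕ) {l : ℕ} (C C' : Tuple l) : Prop :=
  -- full-blocks of both kinds
  (∃ a b, ForeHighest (HasWholeBlock n .covering i) C a ∧
    ForeHighest (HasWholeBlock n .supporting i) C b ∧
    C' = Function.update (Function.update C a (C a).removeUpperHalf) b (C b).removeUpperHalf) ∨
  -- full-blocks of one kind only
  (∃ (k : Kind) (a b : Fin l) (C₁ : Tuple l), ¬ Occurs (HasWholeBlock n k.swap i) C ∧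
    ForeHighest (HasWholeBlock n k i) C a ∧
    C₁ = Function.update C a (C a).removeUpperHalf ∧
    ForeHighest (HasHalf n k i) C₁ b ∧
    C' = Function.update C₁ b (C₁ b).removeHalf) ∨
  -- half-blocks only
  ((∀ k, ¬ Occurs (HasWholeBlock n k i) C) ∧
    ∃ a b, ForeHighest (HasHalf n .covering i) C a ∧
      ForeHighest (HasHalf n .supporting i) C b ∧
      C' = Function.update (Function.update C a (C a).removeHalf) b (C b).removeHalf)

/-- For `i = 0, 1, n-1, n`: the layer `c'` results from `c` by adding an `i`-block at the top. -/
def AddBlock (n : ℕ) (pat : Pattern) (i : ℕ) (c c' : Layer) : Prop :=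
  (c.top = .flat ∧ ∃ s, color n pat c.height s = i ∧ c' = ⟨c.height, .single s⟩) ∨
  (∃ s : Side, c.top = .single s ∧ color n pat c.height s.other = i ∧
    c' = ⟨c.height + 1, .flat⟩)

/-- For `i = 0, 1, n-1, n`: the label of the whole block having an `i`-block as a half. -/
def edgeLabel (n i : ℕ) : ℕ := if i ≤ 1 then 1 else n - 1

/-- `f̃_i` for `i = 0, 1, n-1, n`. -/
def FEnd (n : ℕ) (pat : Pattern) (i : ℕ) {l : ℕ} (C C' : Tuple l) : Prop :=
  ∃ (D : Tuple l) (a : Fin l) (c' : Layer), UnsplitAll n (edgeLabel n i) C D ∧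
    RearLowest (fun c => ∃ d, AddBlock n pat i c d) D a ∧
    AddBlock n pat i (D a) c' ∧
    SplitAll n (edgeLabel n i) (Function.update D a c') C'

/-- `ẽ_i` for `i = 0, 1, n-1, n`. -/
def EEnd (n : ℕ) (pat : Pattern) (i : ℕ) {l : ℕ} (C C' : Tuple l) : Prop :=
  ∃ (D : Tuple l) (a : Fin l) (c' : Layer), UnsplitAll n (edgeLabel n i) C D ∧
    ForeHighest (fun c => ∃ d, AddBlock n pat i d c) D a ∧
    AddBlock n pat i c' (D a) ∧
    SplitAll n (edgeLabel n i) (Function.update D a c') C'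

/-- The graph of `f̃_i` on slices. -/
def FStep (n : ℕ) (pat : Pattern) (i : ℕ) {l : ℕ} (C C' : Tuple l) : Prop :=
  if 2 ≤ i ∧ i ≤ n - 2 then FMid n i C C' else FEnd n pat i C C'

/-- The graph of `ẽ_i` on slices. -/
def EStep (n : ℕ) (pat : Pattern) (i : ℕ) {l : ℕ} (C C' : Tuple l) : Prop :=
  if 2 ≤ i ∧ i ≤ n - 2 then EMid n i C C' else EEnd n pat i C C'

/-! ## Equivalence classes of slices -/

/-- `C + δ = (c_2, …, c_l, c_1 + δ)`. -/
def addDelta (n : ℕ) {l : ℕ} (C : Tuple l) : Tuple l := fun a =>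
  if h : a.val + 1 < l then C ⟨a.val + 1, h⟩
  else (C ⟨0, lt_of_le_of_lt (Nat.zero_le _) a.isLt⟩).addDelta n

/-- `C ∼ C'`: one of them is obtained from the other by adding finitely many `δ`'s. -/
def Related (n : ℕ) {l : ℕ} (C C' : Tuple l) : Prop :=
  ∃ m : ℕ, (addDelta n)^[m] C = C' ∨ (addDelta n)^[m] C' = C

theorem addDelta_injective (n l : ℕ) : Function.Injective (addDelta n (l := l)) := by
  intro C C' h
  funext a
  rcases a with ⟨a, ha⟩
  rcases a with _ | a
  · have h1 := congrFun h ⟨l - 1, by omega⟩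
    have h2 : ¬ (l - 1 + 1 < l) := by omega
    simp only [addDelta, h2, dite_false, Layer.addDelta, Layer.mk.injEq] at h1
    ext1
    · linarith [h1.1]
    · exact h1.2
  · have h1 := congrFun h ⟨a, by omega⟩
    simpa [addDelta, ha] using h1

theorem related_equivalence (n l : ℕ) : Equivalence (Related n (l := l)) := by
  have inj := fun m => (addDelta_injective n l).iterate m
  have key : ∀ (p q : ℕ) (A B : Tuple l), (addDelta n)^[p] A = (addDelta n)^[q] B →
      Related n A B := by
    intro p q A B h
    rcases le_total p q with hpq | hpq
    · obtain ⟨r, rfl⟩ := Nat.exists_eq_add_of_le hpq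
      rw [Function.iterate_add_apply] at h
      exact ⟨r, Or.inr (inj p h).symm⟩
    · obtain ⟨r, rfl⟩ := Nat.exists_eq_add_of_le hpq
      rw [Function.iterate_add_apply] at h
      exact ⟨r, Or.inl (inj q h)⟩
  refine ⟨fun C => ⟨0, Or.inl rfl⟩, ?_, ?_⟩
  · rintro C C' ⟨m, h⟩
    exact ⟨m, h.symm⟩
  · rintro A B C ⟨p, hp⟩ ⟨q, hq⟩
    rcases hp with rfl | rfl <;> rcases hq with rfl | hq
    · exact ⟨q + p, Or.inl (Function.iterate_add_apply _ _ _ _)⟩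
    · exact key p q _ _ hq.symm
    · exact key q p _ _ (by
        rw [← Function.iterate_add_apply, ← Function.iterate_add_apply, Nat.add_comm])
    · subst hq
      exact ⟨p + q, Or.inr (Function.iterate_add_apply _ _ _ _)⟩

/-- The equivalence relation `∼` on slices. -/
instance sliceSetoid (n l : ℕ) : Setoid (Slice n l) where
  r C C' := Related n C.1 C'.1
  iseqv := ⟨fun C => (related_equivalence n l).refl C.1,
    fun h => (related_equivalence n l).symm h,
    fun h h' => (related_equivalence n l).trans h h'⟩

/-- The set of equivalence classes of level-`l` slices. -/
def NewCrystal (n l : ℕ) : Type := Quotient (sliceSetoid n l)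

/-- The class of a slice. -/
def toClass {n l : ℕ} (C : Tuple l) (h : IsSlice n C) : NewCrystal n l :=
  Quotient.mk (sliceSetoid n l) ⟨C, h⟩

open Classical in
/-- The partial operator on classes of slices induced by a relation between slices. -/
def classOp {n l : ℕ} (R : Tuple l → Tuple l → Prop) (X : NewCrystal n l) :
    Option (NewCrystal n l) :=
  if h : ∃ Y, ∃ (C C' : Tuple l) (hC : IsSlice n C) (hC' : IsSlice n C'),
      toClass C hC = X ∧ toClass C' hC' = Y ∧ R C C'
  then some h.choose else none

/-- `f̃_i` on classes of slices. -/
def newF (n l : ℕ) (pat : Pattern) (i : Fin (n + 1)) (X : NewCrystal n l) :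
    Option (NewCrystal n l) := classOp (FStep n pat i) X

/-- `ẽ_i` on classes of slices. -/
def newE (n l : ℕ) (pat : Pattern) (i : Fin (n + 1)) (X : NewCrystal n l) :
    Option (NewCrystal n l) := classOp (EStep n pat i) X

/-- The exponents `m` such that `g^m b` is not `0`. -/
def exponents {B : Type} (g : B → Option B) (b : B) : Set ℕ :=
  {m | (fun o : Option B => o.bind g)^[m] (some b) ≠ none}

/-- `φ_i(C) = max {m | f̃_i^m C ≠ 0}`. -/
def newPhi (n l : ℕ) (pat : Pattern) (i : Fin (n + 1)) (X : NewCrystal n l) : ℕ :=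
  sSup (exponents (newF n l pat i) X)

/-- `ε_i(C) = max {m | ẽ_i^m C ≠ 0}`. -/
def newEps (n l : ℕ) (pat : Pattern) (i : Fin (n + 1)) (X : NewCrystal n l) : ℕ :=
  sSup (exponents (newE n l pat i) X)

/-- The crystal of equivalence classes of level-`l` slices. -/
def sliceCrystal (n l : ℕ) (pat : Pattern) : CrystalData n (NewCrystal n l) where
  wt X := fun i => (newPhi n l pat i X : ℤ) - (newEps n l pat i X : ℤ)
  e i X := newE n l pat i X
  f i X := newF n l pat i X
  eps i X := ((newEps n l pat i X : ℤ) : WithBot ℤ)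
  phi i X := ((newPhi n l pat i X : ℤ) : WithBot ℤ)

/-! ## The canonical map -/

/-- The layer is an `s_i` (`1 ≤ i ≤ n`). -/
def IsS (n : ℕ) (pat : Pattern) (i : ℕ) (c : Layer) : Prop :=
  if i = 1 then ∃ s, c.top = .single s ∧ color n pat c.height s = 0
  else if i = n then ∃ s, c.top = .single s ∧ color n pat c.height s = n - 1
  else HasWholeBlock n .supporting (i - 1) c

/-- The layer is an `s̄_i` (`1 ≤ i ≤ n`). -/
def IsSbar (n : ℕ) (pat : Pattern) (i : ℕ) (c : Layer) : Prop :=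
  if i = 1 then ∃ s, c.top = .single s ∧ color n pat c.height s = 1
  else if i = n then ∃ s, c.top = .single s ∧ color n pat c.height s = n
  else HasWholeBlock n .covering i c

/-- The number of layers of `C` with the property `P`. -/
def countLayers {l : ℕ} (P : Layer → Prop) (C : Tuple l) : ℕ := {a : Fin l | P (C a)}.ncard

/-- `C` is obtained by pasting together the layers prescribed by `b`: there are `x'_i` layers
`s_i`, `x̄'_i` layers `s̄_i` (`1 ≤ i ≤ n`), and `x*_j` layers `t_j` and `x*_j` layers `t̄_j`
(`j = 01, 2, …, n-2, (n-1)n`).  A layer `t_j` or `t̄_j` ends in a broken half of a supporting or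
covering `j`-block.  As `t_j = t̄_j` for `j = 01, (n-1)n`, there are `2 x*_j` of these. -/
def HasContent (n l : ℕ) (pat : Pattern) (b : Coords n) (C : Tuple l) : Prop :=
  (∀ i, 1 ≤ i → i ≤ n - 1 →
    (countLayers (IsS n pat i) C : ℤ) = max 0 (coord b.1 i - coord b.2 i) ∧
    (countLayers (IsSbar n pat i) C : ℤ) = max 0 (coord b.2 i - coord b.1 i)) ∧
  (countLayers (IsS n pat n) C : ℤ) = coord b.1 n ∧
  (countLayers (IsSbar n pat n) C : ℤ) = coord b.2 n ∧
  (∀ j, j = 1 ∨ j = n - 1 → ∀ k,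
    (countLayers (HasHalf n k j) C : ℤ) = 2 * min (coord b.1 j) (coord b.2 j)) ∧
  (∀ j, 2 ≤ j → j ≤ n - 2 → ∀ k,
    (countLayers (HasHalf n k j) C : ℤ) = min (coord b.1 j) (coord b.2 j))

/-- The class `X` is the image of `b` under the canonical map: it is the class of a slice
obtained by pasting together the layers prescribed by `b`. -/
def IsCanonicalImage (n l : ℕ) (pat : Pattern) (b : Perfect n l) (X : NewCrystal n l) : Prop :=
  ∃ (C : Tuple l) (hC : IsSlice n C), HasContent n l pat b.1 C ∧ toClass C hC = X

end DCrystal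

end

namespace DCrystal

/-! ### Residues of heights -/

/-! The whole theorem is reduced to numbers of layers of given residue and top (`cnt`).

Each layer gets an integer position, four units per cell: a flat layer of height h sits at 4h, a
half-depth block or a half of a unit block at 4h+2, and a half of a 01- or ν-block at 4h+1 if it was
put into a slot, at 4h+3 if it remained from a whole block. The selection rules (fore-most of the
highest, rear-most of the lowest) are exactly those under which a splitting keeps the positions
increasing from fore to rear and inside a window of one cycle. A splitting also creates one half of
each sort. Conversely, a tuple with such positions (`Placed`) and equally many halves of both sorts
(`Balanced`) can be unsplit (`IsPlaceable.exists_unsplit`) until no half is left, and is then a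
pre-slice. So the results of splittings are the placeable tuples (`isSplitResult_iff`), and the
slices are those among them in which s_i and s̄_i never occur together for 2 ≤ i ≤ n-1
(`isSlice_iff`).

Adding δ rotates the tuple and moves one layer up by a cycle, without effect on the counts. After
enough rotations all positions lie in one fixed cycle; there the sorted sequence of positions, and
with it the tuple, is determined by the counts. Thus classes of placeable tuples are the same as
their counts (`related_of_cnt_eq`). The counts of slices are precisely those prescribed by elements
of the perfect crystal (`exists_cont`, `exists_slice`): halves record min(x_i, x̄_i), whole layers
record the difference. Hence the canonical map is well defined and bijective.

For f̃_i it remains to follow the counts. For 2 ≤ i ≤ n-2 the three cases of the definition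
correspond to the signs of x_i - x̄_i and x_{i+1} - x̄_{i+1} (`FMid.spec`). For the other i, after
unsplitting, the new block completes an opposite half-depth block if there is one and otherwise
starts a new cell; maximal resplitting then fixes the number of halves (`FEnd.cnt`). In all cases
the content changes by `fRaw`, and a step exists if and only if φ_i > 0 (`FStep.spec`,
`exists_fStep`).

For ẽ_i one turns tuples upside down and replaces blocks by empty space (`reflT`). This exchanges
ẽ_i with f̃_i on slices and barred with unbarred coordinates on the perfect crystal, where it also
exchanges the two operators (`eRaw_eq`). The crystal axioms are verified in coordinates and carried
over by the bijection. -/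

/-- The representative of `h` modulo the height `2n - 4` of a cycle that lies between `3 - n` and
`n - 2`. -/
def res (n : ℕ) (h : ℤ) : ℤ := (h + (n - 3)) % (2 * (n : ℤ) - 4) - (n - 3)

theorem res_lower {n : ℕ} (hn : 4 ≤ n) (h : ℤ) : 3 - (n : ℤ) ≤ res n h := by
  have := Int.emod_nonneg (h + (n - 3)) (b := 2 * (n : ℤ) - 4) (by omega)
  unfold res; omega

theorem res_upper {n : ℕ} (hn : 4 ≤ n) (h : ℤ) : res n h ≤ (n : ℤ) - 2 := by
  have := Int.emod_lt_of_pos (h + (n - 3)) (b := 2 * (n : ℤ) - 4) (by omega)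
  unfold res; omega

theorem exists_eq_res_add (n : ℕ) (h : ℤ) : ∃ q, h = res n h + (2 * (n : ℤ) - 4) * q :=
  ⟨(h + (n - 3)) / (2 * (n : ℤ) - 4), by
    have := Int.emod_add_mul_ediv (h + (n - 3)) (2 * (n : ℤ) - 4)
    unfold res; linarith⟩

theorem res_add_mul (n : ℕ) (h q : ℤ) : res n (h + (2 * (n : ℤ) - 4) * q) = res n h := by
  unfold res
  rw [show h + (2 * (n : ℤ) - 4) * q + (n - 3) = h + (n - 3) + (2 * (n : ℤ) - 4) * q by ring,
    Int.add_mul_emod_self_left]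

@[simp] theorem res_add_period (n : ℕ) (h : ℤ) : res n (h + (2 * (n : ℤ) - 4)) = res n h := by
  simpa using res_add_mul n h 1

theorem res_of_mem {n : ℕ} {h : ℤ} (h1 : 3 - (n : ℤ) ≤ h) (h2 : h ≤ (n : ℤ) - 2) :
    res n h = h := by
  unfold res
  rw [Int.emod_eq_of_lt (by omega) (by omega)]; ring

theorem res_eq_of_eq_add_mul {n : ℕ} {h r q : ℤ} (h1 : 3 - (n : ℤ) ≤ r)
    (h2 : r ≤ (n : ℤ) - 2) (e : h = r + (2 * (n : ℤ) - 4) * q) : res n h = r := by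
  rw [e, res_add_mul, res_of_mem h1 h2]

theorem res_succ {n : ℕ} (hn : 4 ≤ n) (h : ℤ) :
    res n (h + 1) = if res n h = (n : ℤ) - 2 then 3 - (n : ℤ) else res n h + 1 := by
  obtain ⟨q, hq⟩ := exists_eq_res_add n h
  have h1 := res_lower hn h
  have h2 := res_upper hn h
  split_ifs with hr
  · apply res_eq_of_eq_add_mul (q := q + 1) (by omega) (by omega)
    linarith
  · apply res_eq_of_eq_add_mul (q := q) (by omega) (by omega)
    linarith

theorem res_pred {n : ℕ} (hn : 4 ≤ n) (h : ℤ) :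
    res n (h - 1) = if res n h = 3 - (n : ℤ) then (n : ℤ) - 2 else res n h - 1 := by
  have := res_succ hn (h - 1)
  have h1 := res_lower hn (h - 1)
  have h2 := res_upper hn (h - 1)
  rw [sub_add_cancel] at this
  split_ifs at this ⊢ <;> omega

/-- Since 2(n-2) is a full cycle, reflecting heights in 0 fixes the residues of both cells with
half-depth blocks, 0 and n-2, and exchanges the ascending with the descending part. The symmetry
between ẽ_i and f̃_i rests on this. -/
theorem res_neg {n : ℕ} (hn : 4 ≤ n) (h : ℤ) :
    res n (-h) = if res n h = (n : ℤ) - 2 then (n : ℤ) - 2 else - res n h := by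
  obtain ⟨q, hq⟩ := exists_eq_res_add n h
  have h1 := res_lower hn h
  have h2 := res_upper hn h
  split_ifs with hr
  · apply res_eq_of_eq_add_mul (q := -q - 1) (by omega) (by omega)
    linarith
  · apply res_eq_of_eq_add_mul (q := -q) (by omega) (by omega)
    linarith

/-- Distinct heights of the same residue differ by a cycle at least. -/
theorem period_le_of_res_eq {n : ℕ} (hn : 4 ≤ n) {h h' : ℤ} (e : res n h = res n h')
    (hlt : h < h') : h + (2 * (n : ℤ) - 4) ≤ h' := by
  obtain ⟨q, hq⟩ := exists_eq_res_add n h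
  obtain ⟨q', hq'⟩ := exists_eq_res_add n h'
  have : 1 ≤ q' - q := by
    by_contra hc
    have : (2 * (n : ℤ) - 4) * (q' - q) ≤ 0 :=
      mul_nonpos_of_nonneg_of_nonpos (by omega) (by omega)
    nlinarith
  nlinarith

theorem residue_cast {n : ℕ} (hn : 4 ≤ n) (h : ℤ) :
    (residue n h : ℤ) = if 0 ≤ res n h then res n h else res n h + (2 * (n : ℤ) - 4) := by
  obtain ⟨q, hq⟩ := exists_eq_res_add n h
  have h1 := res_lower hn h
  have h2 := res_upper hn h
  have h0 := Int.emod_nonneg h (b := 2 * (n : ℤ) - 4) (by omega)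
  unfold residue
  rw [Int.toNat_of_nonneg h0]
  generalize res n h = r at *
  subst hq
  rw [Int.add_mul_emod_self_left]
  split_ifs with hr
  · exact Int.emod_eq_of_lt hr (by omega)
  · rw [← Int.add_emod_right]
    exact Int.emod_eq_of_lt (by omega) (by omega)

theorem label_cast {n : ℕ} (hn : 4 ≤ n) (h : ℤ) :
    (label n h : ℤ) = if 0 ≤ res n h then res n h + 1 else 1 - res n h := by
  have h1 := res_lower hn h
  have h2 := res_upper hn h
  have := residue_cast hn h
  unfold label
  split_ifs at * <;> omega

theorem isDouble_iff {n : ℕ} (hn : 4 ≤ n) (h : ℤ) :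
    IsDouble n h ↔ res n h = 0 ∨ res n h = (n : ℤ) - 2 := by
  have h1 := res_lower hn h
  have h2 := res_upper hn h
  have := label_cast hn h
  unfold IsDouble
  split_ifs at * <;> omega

/-! ### Residues of blocks, slots and colours -/

/-- The residue of the cells with the whole `j`-blocks of kind `k`. -/
def rho (n : ℕ) (k : Kind) (j : ℕ) : ℤ :=
  match k with
  | .supporting => j - 1
  | .covering => if j = n - 1 then n - 2 else 1 - j

/-- A label and a kind together single out one residue, so conditions on tops of layers become
equations for `res`. The bounds on `j` are needed because `rho` also takes values at labels that no
cell has. -/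
theorem label_kind_iff {n : ℕ} (hn : 4 ≤ n) (k : Kind) (j : ℕ) (h : ℤ) :
    (label n h = j ∧ k.At n h) ↔ 1 ≤ j ∧ j ≤ n - 1 ∧ res n h = rho n k j := by
  have h1 := res_lower hn h
  have h2 := res_upper hn h
  have := label_cast hn h
  have := residue_cast hn h
  cases k <;> simp only [Kind.At, rho] <;> split_ifs at * <;> omega

theorem hasWholeBlock_iff {n : ℕ} (hn : 4 ≤ n) (k : Kind) (j : ℕ) (c : Layer) :
    HasWholeBlock n k j c ↔
      c.top = .flat ∧ 1 ≤ j ∧ j ≤ n - 1 ∧ res n (c.height - 1) = rho n k j := by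
  rw [HasWholeBlock, label_kind_iff hn]

theorem hasWholeSlot_iff {n : ℕ} (hn : 4 ≤ n) (k : Kind) (j : ℕ) (c : Layer) :
    HasWholeSlot n k j c ↔ c.top = .flat ∧ 1 ≤ j ∧ j ≤ n - 1 ∧ res n c.height = rho n k j := by
  rw [HasWholeSlot, label_kind_iff hn]

theorem hasHalf_iff {n : ℕ} (hn : 4 ≤ n) (k : Kind) (j : ℕ) (c : Layer) :
    HasHalf n k j c ↔ c.top = .broken ∧ 1 ≤ j ∧ j ≤ n - 1 ∧ res n c.height = rho n k j := by
  rw [HasHalf, label_kind_iff hn]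

/-- The half of a cell that contains the `i`-block, for `i = 0, 1, n-1, n`. -/
def sideOf (n : ℕ) (pat : Pattern) (i : ℕ) : Side :=
  match pat with
  | .first => if i = 0 ∨ i = n - 1 then .back else .front
  | .second => if i = 0 ∨ i = n - 1 then .front else .back

/-- The residue of the cells that contain the `i`-blocks, for `i = 0, 1, n-1, n`. -/
def endRes (n i : ℕ) : ℤ := if i ≤ 1 then 0 else n - 2

/-- The two colours of a cell share its residue and differ by the half of the cell, so the chosen
pattern matters only through `sideOf`. -/
theorem color_eq_iff {n : ℕ} (hn : 4 ≤ n) (pat : Pattern) {i : ℕ} (hi : i ≤ n)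
    (hi' : i ≤ 1 ∨ n - 1 ≤ i) (h : ℤ) (s : Side) :
    color n pat h s = i ↔ res n h = endRes n i ∧ s = sideOf n pat i := by
  have h1 := res_lower hn h
  have h2 := res_upper hn h
  have h3 := label_cast hn h
  have hcases : i = 0 ∨ i = 1 ∨ i = n - 1 ∨ i = n := by omega
  have e1 : label n h = 1 ↔ res n h = 0 := by split_ifs at h3 <;> omega
  have e2 : label n h = n - 1 ↔ res n h = (n : ℤ) - 2 := by split_ifs at h3 <;> omega
  have e3 : 1 ≤ label n h ∧ label n h ≤ n - 1 := by split_ifs at h3 <;> omega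
  have hcell : (color n pat h s = i ↔ (label n h = 1 ∧ i ≤ 1 ∨ label n h = n - 1 ∧ n - 1 ≤ i) ∧
      s = sideOf n pat i) := by
    unfold color
    by_cases l1 : label n h = 1
    · have l2 : ¬ n - 1 ≤ 1 := by omega
      rw [if_pos l1, l1]
      rcases hcases with rfl | rfl | rfl | rfl <;> cases pat <;> cases s <;>
        simp only [sideOf] <;> (try split_ifs) <;> grind
    · rw [if_neg l1]
      by_cases l2 : label n h = n - 1
      · rw [if_pos l2, l2]
        rcases hcases with rfl | rfl | rfl | rfl <;> cases pat <;> cases s <;>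
          simp only [sideOf] <;> (try split_ifs) <;> grind
      · rw [if_neg l2]
        constructor
        · intro e; omega
        · rintro ⟨e, -⟩; omega
  rw [hcell, endRes]
  apply and_congr_left'
  rw [e1, e2]
  split_ifs <;> omega

@[simp] theorem Side.other_other (s : Side) : s.other.other = s := by cases s <;> rfl

theorem Side.other_ne (s : Side) : s.other ≠ s := by cases s <;> simp [Side.other]

theorem Side.ne_iff {s t : Side} : s ≠ t ↔ s = t.other := by
  cases s <;> cases t <;> simp [Side.other]

theorem Side.other_eq_iff {s t : Side} : s.other = t ↔ s = t.other := by
  cases s <;> cases t <;> simp [Side.other]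

/-! ### Placed tuples -/

/-- `v` is a position of the layer `c`: a flat layer of height `h` has the position `4h`, a single
block of half-unit depth the position `4h + 2`, a broken half of a unit block the position
`4h + 2`, and a broken half of a `01`- or `ν`-block one of the positions `4h + 1`, `4h + 3`. -/
def IsPos (n : ℕ) (c : Layer) (v : ℤ) : Prop :=
  (c.top = .flat ∧ v = 4 * c.height) ∨
  ((∃ s, c.top = .single s) ∧ (res n c.height = 0 ∨ res n c.height = (n : ℤ) - 2) ∧
    v = 4 * c.height + 2) ∨
  (c.top = .broken ∧ (res n c.height = 0 ∨ res n c.height = (n : ℤ) - 2) ∧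
    (v = 4 * c.height + 1 ∨ v = 4 * c.height + 3)) ∨
  (c.top = .broken ∧ ¬ (res n c.height = 0 ∨ res n c.height = (n : ℤ) - 2) ∧
    v = 4 * c.height + 2)

theorem IsPos.bounds {n : ℕ} {c : Layer} {v : ℤ} (h : IsPos n c v) :
    4 * c.height ≤ v ∧ v ≤ 4 * c.height + 3 := by
  rcases h with h | h | h | h <;> omega

theorem IsPos.flat {n : ℕ} {c : Layer} {v : ℤ} (h : IsPos n c v) (hc : c.top = .flat) :
    v = 4 * c.height := by
  rcases h with h | ⟨⟨s, h⟩, -⟩ | h | h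
  · exact h.2
  all_goals simp_all

theorem IsPos.flat_of_eq {n : ℕ} {c : Layer} {v : ℤ} (h : IsPos n c v) (hc : v = 4 * c.height) :
    c.top = .flat := by
  rcases h with h | h | h | h
  · exact h.1
  all_goals omega

/-- The positions `u` witness that the layers of `C` are ordered as in a pre-slice. -/
structure Placed (n : ℕ) {l : ℕ} (C : Tuple l) (u : Fin l → ℤ) : Prop where
  mono : ∀ a b, a ≤ b → u a ≤ u b
  win : ∀ a b, u b ≤ u a + 4 * (2 * (n : ℤ) - 4)
  pos : ∀ a, IsPos n (C a) (u a)
  side : ∀ a b s s', (C a).top = .single s → (C b).top = .single s' →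
    res n (C a).height = res n (C b).height → s = s'

/-- Only the conditions that involve the altered layer have to be checked again. -/
theorem Placed.update {n l : ℕ} (hn : 4 ≤ n) {C : Tuple l} {u : Fin l → ℤ} (h : Placed n C u)
    (a : Fin l) {c : Layer} {x : ℤ} (hp : IsPos n c x)
    (hs : ∀ s, c.top = .single s → ∀ b s', b ≠ a → (C b).top = .single s' →
      res n (C b).height = res n c.height → s' = s)
    (h1 : ∀ b, b < a → u b ≤ x) (h2 : ∀ b, a < b → x ≤ u b)
    (h3 : ∀ b, b ≠ a → u b ≤ x + 4 * (2 * (n : ℤ) - 4))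
    (h4 : ∀ b, b ≠ a → x ≤ u b + 4 * (2 * (n : ℤ) - 4)) :
    Placed n (Function.update C a c) (Function.update u a x) where
  mono b b' hbb := by
    rcases eq_or_ne b a with hb | hb <;> rcases eq_or_ne b' a with hb' | hb'
    · rw [hb, hb']
    · simpa [hb, hb'] using h2 b' (lt_of_le_of_ne (hb ▸ hbb) hb'.symm)
    · simpa [hb, hb'] using h1 b (lt_of_le_of_ne (hb' ▸ hbb) hb)
    · simpa [hb, hb'] using h.mono _ _ hbb
  win b b' := by
    rcases eq_or_ne b a with hb | hb <;> rcases eq_or_ne b' a with hb' | hb'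
    · rw [hb, hb']; omega
    · simpa [hb, hb'] using h3 _ hb'
    · simpa [hb, hb'] using h4 _ hb
    · simpa [hb, hb'] using h.win b b'
  pos b := by
    rcases eq_or_ne b a with rfl | hb
    · simpa using hp
    · simpa [hb] using h.pos b
  side b b' s s' := by
    rcases eq_or_ne b a with hb | hb <;> rcases eq_or_ne b' a with hb' | hb'
    · rw [hb, hb']; intro e e'; simpa using e.symm.trans e'
    · simp only [hb, Function.update_self, Function.update_of_ne hb']
      exact fun e e' e'' => (hs s e b' s' hb' e' e''.symm).symm
    · simp only [hb', Function.update_self, Function.update_of_ne hb]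
      exact fun e e' e'' => hs s' e' b s hb e e''
    · simpa [hb, hb'] using h.side b b' s s'

/-- When a position only grows, nothing can go wrong towards the fore or in the windows opened by
this layer. What can fail is that it passes a layer behind it (`h2`) or leaves the window of some
other layer (`h4`). -/
theorem Placed.raise {n l : ℕ} (hn : 4 ≤ n) {C : Tuple l} {u : Fin l → ℤ} (h : Placed n C u)
    (a : Fin l) {c : Layer} {x : ℤ} (hp : IsPos n c x)
    (hs : ∀ s, c.top = .single s → ∀ b s', b ≠ a → (C b).top = .single s' →
      res n (C b).height = res n c.height → s' = s)
    (hx : u a ≤ x) (h2 : ∀ b, u a ≤ u b → u b < x → b ≤ a)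
    (h4 : ∀ b, u a ≤ u b + 4 * (2 * (n : ℤ) - 4) → x ≤ u b + 4 * (2 * (n : ℤ) - 4)) :
    Placed n (Function.update C a c) (Function.update u a x) := by
  refine h.update hn a hp hs ?_ ?_ ?_ ?_
  · intro b hb; linarith [h.mono b a hb.le]
  · intro b hb
    by_contra hc
    exact absurd (h2 b (h.mono _ _ hb.le) (by omega)) (not_le.2 hb)
  · intro b _; linarith [h.win a b]
  · intro b _; exact h4 b (h.win b a)

/-- Mirror image of `Placed.raise`: the dangers are passing a layer further to the fore and dropping
so low that another layer leaves the window. -/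
theorem Placed.lower {n l : ℕ} (hn : 4 ≤ n) {C : Tuple l} {u : Fin l → ℤ} (h : Placed n C u)
    (a : Fin l) {c : Layer} {x : ℤ} (hp : IsPos n c x) (hs : ∀ s, c.top ≠ .single s)
    (hx : x ≤ u a) (h2 : ∀ b, u b ≤ u a → x < u b → a ≤ b)
    (h4 : ∀ b, u b ≤ u a + 4 * (2 * (n : ℤ) - 4) → u b ≤ x + 4 * (2 * (n : ℤ) - 4)) :
    Placed n (Function.update C a c) (Function.update u a x) := by
  refine h.update hn a hp (fun s e => absurd e (hs s)) ?_ ?_ ?_ ?_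
  · intro b hb
    by_contra hc
    exact absurd (h2 b (h.mono _ _ hb.le) (by omega)) (not_le.2 hb)
  · intro b hb; linarith [h.mono a b hb.le]
  · intro b _; exact h4 b (h.win a b)
  · intro b _; linarith [h.win b a]

/-- The height within a cell at which a broken half starting from below is placed. -/
def lowPos (n : ℕ) (h : ℤ) : ℤ :=
  if res n h = 0 ∨ res n h = (n : ℤ) - 2 then 4 * h + 1 else 4 * h + 2

/-- The height within a cell at which a broken half remaining from a whole block is placed. -/
def highPos (n : ℕ) (h : ℤ) : ℤ :=
  if res n h = 0 ∨ res n h = (n : ℤ) - 2 then 4 * h + 3 else 4 * h + 2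

theorem isPos_lowPos (n : ℕ) (h : ℤ) : IsPos n ⟨h, .broken⟩ (lowPos n h) := by
  unfold IsPos lowPos; split_ifs with hh <;> simp_all

theorem isPos_highPos (n : ℕ) (h : ℤ) : IsPos n ⟨h, .broken⟩ (highPos n h) := by
  unfold IsPos highPos; split_ifs with hh <;> simp_all

theorem isPos_flat (n : ℕ) (h : ℤ) : IsPos n ⟨h, .flat⟩ (4 * h) := by
  simp [IsPos]

/-- Positions below `lowPos` in the cell are flat. -/
theorem IsPos.flat_of_lt_lowPos {n : ℕ} {c : Layer} {v : ℤ} (h : IsPos n c v)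
    (hc : v < lowPos n c.height) : c.top = .flat := by
  unfold lowPos at hc
  rcases h with h | h | h | h
  · exact h.1
  all_goals split_ifs at hc <;> omega

theorem IsPos.le_highPos {n : ℕ} {c : Layer} {v : ℤ} (h : IsPos n c v) :
    v ≤ highPos n c.height := by
  unfold highPos
  rcases h with h | h | h | h <;> split_ifs <;> omega

theorem lowPos_bounds (n : ℕ) (h : ℤ) : 4 * h < lowPos n h ∧ lowPos n h < 4 * h + 4 := by
  unfold lowPos; split_ifs <;> omega

theorem highPos_bounds (n : ℕ) (h : ℤ) : 4 * h < highPos n h ∧ highPos n h < 4 * h + 4 := by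
  unfold highPos; split_ifs <;> omega

theorem lowPos_sub (n : ℕ) (h : ℤ) : lowPos n (h + (2 * (n : ℤ) - 4)) =
    lowPos n h + 4 * (2 * (n : ℤ) - 4) := by
  unfold lowPos; rw [res_add_period]; split_ifs <;> ring

/-- A layer in the way of the raised position would be flat in the same cell and further back, or
flat exactly one cycle below. In either case its slot would be preferred by `RearLowest`. -/
theorem Placed.addHalf {n l : ℕ} (hn : 4 ≤ n) {C : Tuple l} {u : Fin l → ℤ} (h : Placed n C u)
    {k : Kind} {j : ℕ} {a : Fin l} (ha : RearLowest (HasWholeSlot n k j) C a) :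
    Placed n (Function.update C a (C a).addHalf)
      (Function.update u a (lowPos n (C a).height)) := by
  obtain ⟨ha, hmin⟩ := ha
  simp only [hasWholeSlot_iff hn] at ha hmin
  have hua := (h.pos a).flat ha.1
  have hb := lowPos_bounds n (C a).height
  refine h.raise hn a (isPos_lowPos n _) (by simp [Layer.addHalf]) (by omega) ?_ ?_
  · intro b h1 h2
    have hpb := (h.pos b).bounds
    have e : (C b).height = (C a).height := by omega
    have := hmin b ⟨(h.pos b).flat_of_lt_lowPos (by rw [e]; omega), ha.2.1, ha.2.2.1, by
      rw [e]; exact ha.2.2.2⟩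
    omega
  · intro b h1
    by_contra hc
    have hpb := (h.pos b).bounds
    have e : (C a).height = (C b).height + (2 * (n : ℤ) - 4) := by omega
    have hr := res_add_period n (C b).height
    rw [← e] at hr
    rw [e, lowPos_sub] at hc
    have := hmin b ⟨(h.pos b).flat_of_lt_lowPos (by omega), ha.2.1, ha.2.2.1,
      hr.symm.trans ha.2.2.2⟩
    omega

/-- A layer in the way of the lowered position would be flat at the same height and further to the
fore, or flat one cycle higher, and `ForeHighest` would prefer its block. Nothing lies between, as
`highPos` is the highest position inside a cell. -/
theorem Placed.removeUpperHalf {n l : ℕ} (hn : 4 ≤ n) {C : Tuple l} {u : Fin l → ℤ}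
    (h : Placed n C u) {k : Kind} {j : ℕ} {a : Fin l}
    (ha : ForeHighest (HasWholeBlock n k j) C a) :
    Placed n (Function.update C a (C a).removeUpperHalf)
      (Function.update u a (highPos n ((C a).height - 1))) := by
  obtain ⟨ha, hmax⟩ := ha
  simp only [hasWholeBlock_iff hn] at ha hmax
  have hua := (h.pos a).flat ha.1
  have hb := highPos_bounds n ((C a).height - 1)
  have key : ∀ b, res n (C b).height = res n ((C a).height - 1) → u b ≤ 4 * (C b).height + 3 →
      highPos n ((C a).height - 1) - 4 * ((C a).height - 1) < u b - 4 * (C b).height → False := by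
    intro b e _ h2
    have := (h.pos b).le_highPos
    unfold highPos at *
    rw [← e] at h2
    split_ifs at * <;> omega
  refine h.lower hn a (isPos_highPos n _) (by simp [Layer.removeUpperHalf]) (by omega) ?_ ?_
  · intro b h1 h2
    have hpb := (h.pos b).bounds
    rcases eq_or_ne (u b) (u a) with e | e
    · have e' : (C b).height = (C a).height := by omega
      have hf := (h.pos b).flat_of_eq (by omega)
      have := hmax b ⟨hf, ha.2.1, ha.2.2.1, by rw [e']; exact ha.2.2.2⟩
      simp only [Layer.blockHeight, hf, ha.1] at this
      omega
    · have e' : (C b).height = (C a).height - 1 := by omega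
      exact (key b (by rw [e']) (by omega) (by omega)).elim
  · intro b h1
    by_contra hc
    have hpb := (h.pos b).bounds
    rcases eq_or_ne (u b) (u a + 4 * (2 * (n : ℤ) - 4)) with e | e
    · have e' : (C b).height - 1 = (C a).height - 1 + (2 * (n : ℤ) - 4) := by omega
      have hf := (h.pos b).flat_of_eq (by omega)
      have := hmax b ⟨hf, ha.2.1, ha.2.2.1, by rw [e', res_add_period]; exact ha.2.2.2⟩
      simp only [Layer.blockHeight, hf, ha.1] at this
      omega
    · have e' : (C b).height = (C a).height - 1 + (2 * (n : ℤ) - 4) := by omega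
      exact (key b (by rw [e', res_add_period]) (by omega) (by omega)).elim

/-- Completing a broken half whose position is the highest one in its cell. -/
theorem Placed.complete {n l : ℕ} (hn : 4 ≤ n) {C : Tuple l} {u : Fin l → ℤ} (h : Placed n C u)
    {a : Fin l} (hua : u a = highPos n (C a).height)
    (hmin : ∀ b, res n (C b).height = res n (C a).height → u b = highPos n (C b).height →
      (C b).top = .broken →
      (C a).height < (C b).height ∨ ((C a).height = (C b).height ∧ b ≤ a)) :
    Placed n (Function.update C a (C a).completeHalf)
      (Function.update u a (4 * ((C a).height + 1))) := by
  have hb := highPos_bounds n (C a).height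
  -- In a cell of this residue only broken halves reach the highest position: half-depth blocks stop
  -- at offset 2, below 3, and do not occur in cells of unit blocks.
  have key : ∀ b, res n (C b).height = res n (C a).height →
      u a - 4 * (C a).height ≤ u b - 4 * (C b).height → u b = highPos n (C b).height ∧
        (C b).top = .broken := by
    intro b e h1
    rw [hua] at h1
    have hpb := h.pos b
    unfold highPos at *
    rw [← e] at h1 hb
    rcases hpb with hpb | hpb | hpb | hpb <;> split_ifs at * <;> first | omega | skip
    · exact ⟨by omega, hpb.1⟩
    · exact ⟨by omega, hpb.1⟩
  refine h.raise hn a (isPos_flat n _) (by simp [Layer.completeHalf]) (by omega) ?_ ?_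
  · intro b h1 h2
    have hpb := (h.pos b).bounds
    have e : (C b).height = (C a).height := by omega
    obtain ⟨k1, k2⟩ := key b (by rw [e]) (by omega)
    have := hmin b (by rw [e]) k1 k2
    omega
  · intro b h1
    by_contra hc
    have hpb := (h.pos b).bounds
    have e : (C a).height = (C b).height + (2 * (n : ℤ) - 4) := by omega
    have hr : res n (C b).height = res n (C a).height := by rw [e, res_add_period]
    obtain ⟨k1, k2⟩ := key b hr (by omega)
    have := hmin b hr k1 k2
    omega

/-- Removing a broken half whose position is the lowest one in its cell. -/
theorem Placed.removeHalf {n l : ℕ} (hn : 4 ≤ n) {C : Tuple l} {u : Fin l → ℤ} (h : Placed n C u)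
    {a : Fin l} (hua : u a = lowPos n (C a).height)
    (hmax : ∀ b, res n (C b).height = res n (C a).height → u b = lowPos n (C b).height →
      (C b).top = .broken →
      (C b).height < (C a).height ∨ ((C b).height = (C a).height ∧ a ≤ b)) :
    Placed n (Function.update C a (C a).removeHalf)
      (Function.update u a (4 * (C a).height)) := by
  have hb := lowPos_bounds n (C a).height
  have key : ∀ b, res n (C b).height = res n (C a).height → 4 * (C b).height < u b →
      u b - 4 * (C b).height ≤ u a - 4 * (C a).height → u b = lowPos n (C b).height ∧
        (C b).top = .broken := by
    intro b e h0 h1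
    rw [hua] at h1
    have hpb := h.pos b
    unfold lowPos at *
    rw [← e] at h1 hb
    rcases hpb with hpb | hpb | hpb | hpb <;> split_ifs at * <;> first | omega | skip
    · exact ⟨by omega, hpb.1⟩
    · exact ⟨by omega, hpb.1⟩
  refine h.lower hn a (isPos_flat n _) (by simp [Layer.removeHalf]) (by omega) ?_ ?_
  · intro b h1 h2
    have hpb := (h.pos b).bounds
    have e : (C b).height = (C a).height := by omega
    obtain ⟨k1, k2⟩ := key b (by rw [e]) (by omega) (by omega)
    have := hmax b (by rw [e]) k1 k2
    omega
  · intro b h1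
    by_contra hc
    have hpb := (h.pos b).bounds
    have e : (C b).height = (C a).height + (2 * (n : ℤ) - 4) := by omega
    have hr : res n (C b).height = res n (C a).height := by rw [e, res_add_period]
    obtain ⟨k1, k2⟩ := key b hr (by omega) (by omega)
    have := hmax b hr k1 k2
    omega

/-! ### Counting layers -/

/-- The number of layers of `C` with the top `t` and the residue `r`. -/
def cnt (n : ℕ) {l : ℕ} (C : Tuple l) (r : ℤ) (t : Top) : ℤ :=
  ∑ a, if res n (C a).height = r ∧ (C a).top = t then 1 else 0

theorem sum_update {l : ℕ} {β : Type*} (g : β → ℤ) (f : Fin l → β) (a : Fin l) (x : β) :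
    ∑ b, g (Function.update f a x b) = ∑ b, g (f b) - g (f a) + g x := by
  rw [← Finset.add_sum_erase _ _ (Finset.mem_univ a),
    ← Finset.add_sum_erase _ (fun b => g (f b)) (Finset.mem_univ a), Function.update_self,
    Finset.sum_congr rfl (g := fun b => g (f b))]
  · ring
  · intro b hb
    rw [Function.update_of_ne (Finset.ne_of_mem_erase hb)]

theorem cnt_update (n : ℕ) {l : ℕ} (C : Tuple l) (a : Fin l) (c : Layer) (r : ℤ) (t : Top) :
    cnt n (Function.update C a c) r t = cnt n C r t -
      (if res n (C a).height = r ∧ (C a).top = t then 1 else 0) +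
      (if res n c.height = r ∧ c.top = t then 1 else 0) :=
  sum_update (fun c : Layer => if res n c.height = r ∧ c.top = t then 1 else 0) C a c

theorem cnt_nonneg (n : ℕ) {l : ℕ} (C : Tuple l) (r : ℤ) (t : Top) : 0 ≤ cnt n C r t :=
  Finset.sum_nonneg fun _ _ => by split_ifs <;> simp

theorem cnt_pos_iff {n l : ℕ} {C : Tuple l} {r : ℤ} {t : Top} :
    0 < cnt n C r t ↔ ∃ a, res n (C a).height = r ∧ (C a).top = t := by
  unfold cnt
  rw [Finset.sum_pos_iff_of_nonneg (fun _ _ => by split_ifs <;> simp)]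
  refine ⟨fun ⟨a, _, ha⟩ => ⟨a, ?_⟩, fun ⟨a, ha⟩ => ⟨a, Finset.mem_univ a, by simp [ha]⟩⟩
  by_contra hc
  simp [hc] at ha

/-- The contribution of a position to the difference of the numbers of broken halves at low and
high positions of a cell of residue `r`. -/
def balTerm (n : ℕ) (r v : ℤ) : ℤ :=
  if res n (v / 4) = r then (if v % 4 = 1 then 1 else if v % 4 = 3 then -1 else 0) else 0

/-- As many broken halves are at low positions as at high positions, for each kind of block. -/
structure Balanced (n : ℕ) {l : ℕ} (C : Tuple l) (u : Fin l → ℤ) : Prop where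
  zero : ∑ a, balTerm n 0 (u a) = 0
  last : ∑ a, balTerm n (n - 2) (u a) = 0
  mid : ∀ r : ℤ, 1 ≤ r → r ≤ n - 3 → cnt n C r .broken = cnt n C (-r) .broken

/-- The invariants of results of splittings of pre-slices. -/
def IsPlaceable (n : ℕ) {l : ℕ} (C : Tuple l) : Prop :=
  ∃ u, Placed n C u ∧ Balanced n C u

/-- Replacing another layer by one without the property only removes a competitor. -/
theorem RearLowest.update {l : ℕ} {Q : Layer → Prop} {C : Tuple l} {a b : Fin l} {c : Layer}
    (h : RearLowest Q C b) (hab : b ≠ a) (hc : ¬ Q c) :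
    RearLowest Q (Function.update C a c) b := by
  refine ⟨by simpa [hab] using h.1, fun b' hb' => ?_⟩
  have hne : b' ≠ a := by rintro rfl; exact hc (by simpa using hb')
  simp only [ne_eq, hab, not_false_eq_true, Function.update_of_ne, hne] at hb' ⊢
  exact h.2 b' hb'

theorem exists_rearLowest {l : ℕ} {p : Fin l → Prop} (f : Fin l → ℤ) (h : ∃ a, p a) :
    ∃ a, p a ∧ ∀ b, p b → f a < f b ∨ (f a = f b ∧ b ≤ a) := by
  classical
  -- A lexicographic minimum; the dual order on the indices settles ties in favour of the rear.
  obtain ⟨a, ha, hmin⟩ := Finset.exists_min_image (Finset.univ.filter p)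
    (fun b => toLex (f b, OrderDual.toDual b)) (by simpa [Finset.filter_nonempty_iff] using h)
  refine ⟨a, by simpa using ha, fun b hb => ?_⟩
  have := hmin b (by simpa using hb)
  simpa [Prod.Lex.toLex_le_toLex] using this

theorem exists_foreHighest {l : ℕ} {p : Fin l → Prop} (f : Fin l → ℤ) (h : ∃ a, p a) :
    ∃ a, p a ∧ ∀ b, p b → f b < f a ∨ (f b = f a ∧ a ≤ b) := by
  classical
  obtain ⟨a, ha, hmin⟩ := Finset.exists_min_image (Finset.univ.filter p)
    (fun b => toLex (- f b, b)) (by simpa [Finset.filter_nonempty_iff] using h)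
  refine ⟨a, by simpa using ha, fun b hb => ?_⟩
  have := hmin b (by simpa using hb)
  simp only [Prod.Lex.toLex_le_toLex] at this
  omega

/-! ### Splittings preserve the invariants -/

/-- The residue following `r`. -/
def nextRes (n : ℕ) (r : ℤ) : ℤ := if r = (n : ℤ) - 2 then 3 - n else r + 1

theorem res_eq_nextRes {n : ℕ} (hn : 4 ≤ n) (h : ℤ) : res n h = nextRes n (res n (h - 1)) := by
  have := res_succ hn (h - 1)
  rwa [sub_add_cancel] at this

theorem res_add_one {n : ℕ} (hn : 4 ≤ n) (h : ℤ) : res n (h + 1) = nextRes n (res n h) :=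
  res_succ hn h

/-- The case j = 1, where both kinds also share their residue, needs no separate treatment because j
- 1 = 1 - j there. -/
theorem rho_spec {n j : ℕ} (k : Kind) (h1 : 1 ≤ j) (h2 : j ≤ n - 1) :
    (j = n - 1 ∧ rho n k j = j - 1 ∧ rho n k.swap j = j - 1) ∨
    (j < n - 1 ∧ ((rho n k j = j - 1 ∧ rho n k.swap j = 1 - j) ∨
      (rho n k j = 1 - j ∧ rho n k.swap j = j - 1))) := by
  by_cases hj : j = n - 1
  · cases k <;> simp only [rho, Kind.swap] <;> rw [if_pos hj] <;> grind
  · cases k <;> simp only [rho, Kind.swap] <;> rw [if_neg hj] <;> grind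

theorem balTerm_flat (n : ℕ) (r h : ℤ) : balTerm n r (4 * h) = 0 := by
  unfold balTerm
  have h1 : 4 * h % 4 = 0 := by omega
  simp [h1]

theorem balTerm_single (n : ℕ) (r h : ℤ) : balTerm n r (4 * h + 2) = 0 := by
  unfold balTerm
  have h1 : (4 * h + 2) % 4 = 2 := by omega
  simp [h1]

theorem balTerm_lowPos (n : ℕ) {r : ℤ} (hr : r = 0 ∨ r = n - 2) (h : ℤ) :
    balTerm n r (lowPos n h) = if res n h = r then 1 else 0 := by
  unfold balTerm lowPos
  have h1 : (4 * h + 1) % 4 = 1 := by omega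
  have h2 : (4 * h + 1) / 4 = h := by omega
  have h3 : (4 * h + 2) % 4 = 2 := by omega
  split_ifs <;> simp_all

theorem balTerm_highPos (n : ℕ) {r : ℤ} (hr : r = 0 ∨ r = n - 2) (h : ℤ) :
    balTerm n r (highPos n h) = if res n h = r then -1 else 0 := by
  unfold balTerm highPos
  have h1 : (4 * h + 3) % 4 = 3 := by omega
  have h2 : (4 * h + 3) / 4 = h := by omega
  have h3 : (4 * h + 2) % 4 = 2 := by omega
  split_ifs <;> simp_all

/-- Consecutive cells never have the same label. -/
theorem wholeBlock_ne_wholeSlot {n : ℕ} (hn : 4 ≤ n) {k k' : Kind} {j : ℕ} {c d : Layer}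
    (hc : HasWholeBlock n k j c) (hd : HasWholeSlot n k' j d) : c ≠ d := by
  rintro rfl
  have h1 := hc.2.1
  have h2 := hd.2.1
  have e1 := label_cast hn c.height
  have e2 := label_cast hn (c.height - 1)
  have e3 := res_pred hn c.height
  split_ifs at * <;> omega

theorem cnt_update_two {n l : ℕ} (C : Tuple l) {a b : Fin l} (hab : a ≠ b) (c d : Layer) (r : ℤ)
    (t : Top) :
    cnt n (Function.update (Function.update C a c) b d) r t = cnt n C r t -
      (if res n (C a).height = r ∧ (C a).top = t then 1 else 0) +
      (if res n c.height = r ∧ c.top = t then 1 else 0) -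
      (if res n (C b).height = r ∧ (C b).top = t then 1 else 0) +
      (if res n d.height = r ∧ d.top = t then 1 else 0) := by
  rw [cnt_update, cnt_update, Function.update_of_ne hab.symm]

/-- The height of a flat layer is that of the empty cell above its block. So the layer that loses
its upper half leaves the residue following that of the block, while the other layer keeps its
residue. -/
theorem SplitStep.cnt {n : ℕ} (hn : 4 ≤ n) {j l : ℕ} {C C' : Tuple l} (h : SplitStep n j C C') :
    1 ≤ j ∧ j ≤ n - 1 ∧ ∃ k, ∀ r t, cnt n C' r t = cnt n C r t
      - (if r = nextRes n (rho n k j) ∧ t = .flat then 1 else 0)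
      - (if r = rho n k.swap j ∧ t = .flat then 1 else 0)
      + (if r = rho n k j ∧ t = .broken then 1 else 0)
      + (if r = rho n k.swap j ∧ t = .broken then 1 else 0) := by
  obtain ⟨k, a, b, ha, hb, rfl⟩ := h
  have hab : a ≠ b := fun e => wholeBlock_ne_wholeSlot hn ha.1 hb.1 (by rw [e])
  have ha' := (hasWholeBlock_iff hn _ _ _).1 ha.1
  have hb' := (hasWholeSlot_iff hn _ _ _).1 hb.1
  refine ⟨ha'.2.1, ha'.2.2.1, k, fun r t => ?_⟩
  rw [cnt_update_two C hab, res_eq_nextRes hn (C a).height]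
  simp only [Layer.removeUpperHalf, Layer.addHalf, ha'.1, hb'.1, ha'.2.2.2, hb'.2.2.2]
  simp only [@eq_comm _ r, @eq_comm _ t]
  ring

/-- The half that remains takes the high position of its cell, the half put into the slot the low
one. In the cells of half-depth blocks the contributions to the balance are -1 and 1; for unit
blocks the two kinds have opposite residues, and each gains one half. -/
theorem SplitStep.isPlaceable {n : ℕ} (hn : 4 ≤ n) {j l : ℕ} {C C' : Tuple l}
    (h : SplitStep n j C C') (hC : IsPlaceable n C) : IsPlaceable n C' := by
  obtain ⟨hj1, hj2, k', hcnt⟩ := h.cnt hn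
  obtain ⟨u, hu, hbal⟩ := hC
  obtain ⟨k, a, b, ha, hb, hC'⟩ := h
  have hab : a ≠ b := fun e => wholeBlock_ne_wholeSlot hn ha.1 hb.1 (by rw [e])
  have ha' := (hasWholeBlock_iff hn _ _ _).1 ha.1
  have hb' := (hasWholeSlot_iff hn _ _ _).1 hb.1
  have hp1 := hu.removeUpperHalf hn ha
  -- Breaking the block does not interfere with the choice of the slot, since the altered layer is
  -- no longer flat.
  have hb1 : RearLowest (HasWholeSlot n k.swap j)
      (Function.update C a (C a).removeUpperHalf) b :=
    hb.update hab.symm (by simp [HasWholeSlot, Layer.removeUpperHalf])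
  have hp2 := hp1.addHalf hn hb1
  rw [Function.update_of_ne hab.symm, ← hC'] at hp2
  have hua := (hu.pos a).flat ha'.1
  have hub := (hu.pos b).flat hb'.1
  have hr := rho_spec (n := n) k hj1 hj2
  have hr' := rho_spec (n := n) k' hj1 hj2
  refine ⟨_, hp2, ?_, ?_, ?_⟩
  · rw [sum_update, sum_update, Function.update_of_ne hab.symm, hua, hub, balTerm_flat,
      balTerm_flat, balTerm_lowPos n (Or.inl rfl), balTerm_highPos n (Or.inl rfl), hbal.zero,
      ha'.2.2.2, hb'.2.2.2]
    split_ifs <;> omega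
  · rw [sum_update, sum_update, Function.update_of_ne hab.symm, hua, hub, balTerm_flat,
      balTerm_flat, balTerm_lowPos n (Or.inr rfl), balTerm_highPos n (Or.inr rfl), hbal.last,
      ha'.2.2.2, hb'.2.2.2]
    split_ifs <;> omega
  · intro r h1 h2
    have := hbal.mid r h1 h2
    rw [hcnt, hcnt]
    simp only [reduceCtorEq, and_false, if_false, and_true]
    split_ifs <;> omega

/-! ### Undoing a splitting -/

/-- Terms from {1, -1, 0} with sum zero, not all of them zero, include both signs. -/
theorem exists_balTerm {n l : ℕ} {u : Fin l → ℤ} {r : ℤ} (h : ∑ a, balTerm n r (u a) = 0)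
    (h1 : ∃ a, balTerm n r (u a) ≠ 0) :
    (∃ a, balTerm n r (u a) = 1) ∧ ∃ a, balTerm n r (u a) = -1 := by
  have h3 : ∀ v, balTerm n r v = 1 ∨ balTerm n r v = -1 ∨ balTerm n r v = 0 := by
    intro v; unfold balTerm; split_ifs <;> simp
  obtain ⟨a, ha⟩ := h1
  constructor
  · by_contra! hc
    have := (Finset.sum_eq_zero_iff_of_nonpos (s := Finset.univ) (f := fun a => balTerm n r (u a))
      (fun b _ => by have := h3 (u b); have := hc b; omega)).1 h a (Finset.mem_univ a)
    exact ha this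
  · by_contra! hc
    have := (Finset.sum_eq_zero_iff_of_nonneg (s := Finset.univ) (f := fun a => balTerm n r (u a))
      (fun b _ => by have := h3 (u b); have := hc b; omega)).1 h a (Finset.mem_univ a)
    exact ha this

theorem IsPos.eq_low_or_high {n : ℕ} {c : Layer} {v : ℤ} (h : IsPos n c v)
    (hc : c.top = .broken) : v = lowPos n c.height ∨ v = highPos n c.height := by
  unfold lowPos highPos
  rcases h with h | ⟨⟨s, h⟩, -⟩ | h | h
  · simp_all
  · simp_all
  · rw [if_pos h.2.1, if_pos h.2.1]; omega
  · rw [if_neg h.2.1, if_neg h.2.1]; omega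

theorem IsPos.balTerm_cases {n : ℕ} {c : Layer} {v : ℤ} (h : IsPos n c v) {r : ℤ}
    (hr : r = 0 ∨ r = n - 2) :
    (balTerm n r v = 1 → c.top = .broken ∧ res n c.height = r ∧ v = lowPos n c.height) ∧
    (balTerm n r v = -1 → c.top = .broken ∧ res n c.height = r ∧ v = highPos n c.height) ∧
    (c.top = .broken → res n c.height = r → balTerm n r v ≠ 0) := by
  by_cases hb : c.top = .broken
  · rcases h.eq_low_or_high hb with rfl | rfl
    · rw [balTerm_lowPos n hr]; split_ifs <;> simp_all
    · rw [balTerm_highPos n hr]; split_ifs <;> simp_all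
  · have : balTerm n r v = 0 := by
      rcases h with h | h | h | h
      · rw [h.2, balTerm_flat]
      · rw [h.2.2, balTerm_single]
      · exact absurd h.1 hb
      · exact absurd h.1 hb
    simp [this, hb]

/-- If there are broken halves of `j`-blocks then there is one at a high position of the given
kind, and one at a low position of the opposite kind. -/
theorem exists_low_high {n : ℕ} (hn : 4 ≤ n) {l : ℕ} {C : Tuple l} {u : Fin l → ℤ}
    (hu : Placed n C u) (hb : Balanced n C u) {j : ℕ} (hj1 : 1 ≤ j) (hj2 : j ≤ n - 1) {k : Kind}
    (h : ∃ a, (C a).top = .broken ∧ res n (C a).height = rho n k j) (k' : Kind) :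
    (∃ a, (C a).top = .broken ∧ res n (C a).height = rho n k' j ∧
      u a = highPos n (C a).height) ∧
    (∃ a, (C a).top = .broken ∧ res n (C a).height = rho n k' j ∧
      u a = lowPos n (C a).height) := by
  by_cases hj : j = 1 ∨ j = n - 1
  · have hr : rho n k j = rho n k' j ∧ (rho n k j = 0 ∨ rho n k j = n - 2) := by
      rcases hj with rfl | hj
      · cases k <;> cases k' <;> simp only [rho] <;> grind
      · cases k <;> cases k' <;> simp only [rho] <;> grind
    have hsum : ∑ a, balTerm n (rho n k j) (u a) = 0 := by
      rcases hr.2 with e | e <;> rw [e]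
      exacts [hb.zero, hb.last]
    obtain ⟨a, ha⟩ := h
    obtain ⟨⟨b, h1⟩, ⟨c, h2⟩⟩ :=
      exists_balTerm hsum ⟨a, ((hu.pos a).balTerm_cases hr.2).2.2 ha.1 ha.2⟩
    rw [← hr.1]
    exact ⟨⟨c, ((hu.pos c).balTerm_cases hr.2).2.1 h2⟩, ⟨b, ((hu.pos b).balTerm_cases hr.2).1 h1⟩⟩
  · have hmid := hb.mid (j - 1) (by omega) (by omega)
    have key : ∃ a, (C a).top = .broken ∧ res n (C a).height = rho n k' j := by
      have hpos : 0 < cnt n C (rho n k j) .broken :=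
        cnt_pos_iff.2 (h.imp fun _ => And.symm)
      have : 0 < cnt n C (rho n k' j) .broken := by
        have e : -((j : ℤ) - 1) = 1 - j := by ring
        rw [e] at hmid
        have hj' : j ≠ n - 1 := by omega
        cases k <;> cases k' <;> simp only [rho, if_neg hj'] at hpos ⊢ <;> omega
      exact (cnt_pos_iff.1 this).imp fun _ => And.symm
    obtain ⟨a, h1, h2⟩ := key
    have hd : ¬ (res n (C a).height = 0 ∨ res n (C a).height = (n : ℤ) - 2) := by
      rw [h2]; cases k' <;> simp only [rho] <;> (try split_ifs) <;> omega
    have hlh : lowPos n (C a).height = highPos n (C a).height := by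
      rw [lowPos, highPos, if_neg hd, if_neg hd]
    rcases (hu.pos a).eq_low_or_high h1 with e | e
    · exact ⟨⟨a, h1, h2, e.trans hlh⟩, ⟨a, h1, h2, e⟩⟩
    · exact ⟨⟨a, h1, h2, e⟩, ⟨a, h1, h2, e.trans hlh.symm⟩⟩

/-- The choices of a splitting are dualized: of the halves in high position the rear-most lowest one
is completed, of those in low position the fore-most highest one is removed. These are then the two
layers that a splitting selects. By balance, one half of a `j`-block guarantees halves of every
sort, so the completed one may be taken covering and the removed one supporting. -/
theorem IsPlaceable.exists_unsplit {n : ℕ} (hn : 4 ≤ n) {l : ℕ} {C : Tuple l}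
    (hC : IsPlaceable n C) {j : ℕ} (hj1 : 1 ≤ j) (hj2 : j ≤ n - 1) {k : Kind}
    (h : ∃ a, (C a).top = .broken ∧ res n (C a).height = rho n k j) :
    ∃ D, IsPlaceable n D ∧ SplitStep n j D C := by
  obtain ⟨u, hu, hbal⟩ := hC
  have h1 := (exists_low_high hn hu hbal hj1 hj2 h .covering).1
  have h2 := (exists_low_high hn hu hbal hj1 hj2 h Kind.covering.swap).2
  obtain ⟨a, ⟨ha1, ha2, ha3⟩, hamin⟩ := exists_rearLowest (fun a => (C a).height) h1
  obtain ⟨b, ⟨hb1, hb2, hb3⟩, hbmax⟩ := exists_foreHighest (fun a => (C a).height) h2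
  have hr := rho_spec (n := n) Kind.covering hj1 hj2
  -- In a cell of half-depth blocks the low and the high position differ; for a unit block the
  -- residues of the two kinds differ.
  have hab : a ≠ b := by
    rintro rfl
    rw [ha3, highPos, lowPos] at hb3
    split_ifs at hb3 <;> omega
  have hp1 := hu.complete hn ha3 (fun b' e1 e2 e3 => hamin b' ⟨e3, e1.trans ha2, e2⟩)
  have hp2 := hp1.removeHalf hn (a := b) (by simpa [hab.symm] using hb3) (by
    intro b' e1 e2 e3
    rcases eq_or_ne b' a with rfl | hne
    · simp [Layer.completeHalf] at e3
    · simp only [ne_eq, hne, hab.symm, not_false_eq_true, Function.update_of_ne] at e1 e2 e3 ⊢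
      exact hbmax b' ⟨e3, e1.trans hb2, e2⟩)
  simp only [Function.update_of_ne hab.symm] at hp2
  set D := Function.update (Function.update C a (C a).completeHalf) b (C b).removeHalf with hD
  set w := Function.update (Function.update u a (4 * ((C a).height + 1))) b (4 * (C b).height)
    with hw
  have hDa : D a = ⟨(C a).height + 1, .flat⟩ := by simp [hD, hab, Layer.completeHalf]
  have hDb : D b = ⟨(C b).height, .flat⟩ := by simp [hD, Layer.removeHalf]
  have hDo : ∀ c, c ≠ a → c ≠ b → D c = C c ∧ w c = u c := fun c h1 h2 => by simp [hD, hw, h1, h2]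
  have hwa : w a = 4 * ((C a).height + 1) := by simp [hw, hab]
  have hwb : w b = 4 * (C b).height := by simp [hw]
  have hba := highPos_bounds n (C a).height
  have hbb := lowPos_bounds n (C b).height
  have blk : HasWholeBlock n .covering j (D a) := by
    rw [hasWholeBlock_iff hn, hDa]
    exact ⟨rfl, hj1, hj2, by simpa using ha2⟩
  have slt : HasWholeSlot n Kind.covering.swap j (D b) := by
    rw [hasWholeSlot_iff hn, hDb]
    exact ⟨rfl, hj1, hj2, hb2⟩
  have hstep : SplitStep n j D C := by
    refine ⟨.covering, a, b, ⟨blk, ?_⟩, ⟨slt, ?_⟩, ?_⟩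
    · intro c hc
      have hcb : c ≠ b := fun e => wholeBlock_ne_wholeSlot hn hc slt (by rw [e])
      rcases eq_or_ne c a with rfl | hca
      · exact Or.inr ⟨rfl, le_rfl⟩
      · obtain ⟨o1, o2⟩ := hDo c hca hcb
        have hc' := (hasWholeBlock_iff hn _ _ _).1 hc
        have hwc := (hp2.pos c).flat hc.1
        simp only [Layer.blockHeight, hc.1, hDa]
        -- A competing block at the same height and further to the fore violates the order of `C`,
        -- where layer `a` was strictly lower. A higher one is at least a cycle higher and leaves
        -- the window of `a`.
        by_contra hcon
        rcases lt_trichotomy (D c).height ((C a).height + 1) with hlt | heq | hgt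
        · omega
        · have := hu.mono c a (by omega)
          omega
        · have := period_le_of_res_eq hn (h := (C a).height) (h' := (D c).height - 1)
            (ha2.trans hc'.2.2.2.symm) (by omega)
          have := hu.win a c
          omega
    · intro c hc
      have hca : c ≠ a := fun e => wholeBlock_ne_wholeSlot hn blk hc (by rw [e])
      rcases eq_or_ne c b with rfl | hcb
      · exact Or.inr ⟨rfl, le_rfl⟩
      · obtain ⟨o1, o2⟩ := hDo c hca hcb
        have hc' := (hasWholeSlot_iff hn _ _ _).1 hc
        have hwc := (hp2.pos c).flat hc.1
        simp only [hDb]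
        -- Likewise: in `C` layer `b` was strictly above the level of the slot, so no rival slot
        -- lies at the same height further back, and none a cycle below.
        by_contra hcon
        rcases lt_trichotomy (D c).height (C b).height with hlt | heq | hgt
        · have := period_le_of_res_eq hn (h := (D c).height) (h' := (C b).height)
            (hc'.2.2.2.trans hb2.symm) (by omega)
          have := hu.win c b
          omega
        · have := hu.mono b c (by omega)
          omega
        · omega
    · funext c
      rcases eq_or_ne c b with rfl | hcb
      · simp [hDb, Layer.addHalf, Layer.ext_iff, hb1]
      · rcases eq_or_ne c a with rfl | hca
        · simp [hcb, hDa, Layer.removeUpperHalf, Layer.ext_iff, ha1]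
        · simp [hcb, hca, (hDo c hca hcb).1]
  obtain ⟨-, -, k', hcnt⟩ := hstep.cnt hn
  have hr' := rho_spec (n := n) k' hj1 hj2
  refine ⟨D, ⟨w, hp2, ?_, ?_, ?_⟩, hstep⟩
  · rw [hw, sum_update, sum_update, Function.update_of_ne hab.symm, ha3, hb3, balTerm_flat,
      balTerm_flat, balTerm_lowPos n (Or.inl rfl), balTerm_highPos n (Or.inl rfl), hbal.zero,
      ha2, hb2]
    split_ifs <;> omega
  · rw [hw, sum_update, sum_update, Function.update_of_ne hab.symm, ha3, hb3, balTerm_flat,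
      balTerm_flat, balTerm_lowPos n (Or.inr rfl), balTerm_highPos n (Or.inr rfl), hbal.last,
      ha2, hb2]
    split_ifs <;> omega
  · intro r h1 h2
    have := hbal.mid r h1 h2
    rw [hcnt, hcnt] at this
    simp only [reduceCtorEq, and_false, if_false, and_true] at this
    split_ifs at this <;> omega

/-! ### Pre-slices -/

/-- Both halves of the topmost full cell of `c` must be in `d`, and a half-depth block supplies only
one of them; this compares the heights. At equal heights only the tops matter. -/
theorem Layer.blocks_subset_iff {c d : Layer} (hc : c.top ≠ .broken) :
    c.blocks ⊆ d.blocks ↔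
      c.height < d.height ∨ (c.height = d.height ∧ (c.top = .flat ∨ c.top = d.top)) := by
  constructor
  · intro h
    have h1 : ∀ s, ((c.height - 1, s) : ℤ × Side) ∈ d.blocks :=
      fun s => h (Or.inl (by simp))
    have h2 := h1 .front
    have h3 := h1 .back
    simp only [Layer.blocks, Set.mem_ofPred_eq] at h2 h3
    have hle : c.height ≤ d.height := by
      by_contra hlt
      have e1 : d.top = .single .front := by
        rcases h2 with h | h
        · omega
        · exact h.2
      have e2 : d.top = .single .back := by
        rcases h3 with h | h
        · omega
        · exact h.2
      simp_all
    rcases hle.lt_or_eq with hlt | heq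
    · exact Or.inl hlt
    · refine Or.inr ⟨heq, ?_⟩
      match ht : c.top with
      | .flat => exact Or.inl rfl
      | .broken => exact absurd ht hc
      | .single s =>
        have : ((c.height, s) : ℤ × Side) ∈ d.blocks := h (Or.inr ⟨rfl, ht⟩)
        rcases this with h | h
        · simp only at h; omega
        · exact Or.inr h.2.symm
  · rintro (h | ⟨h, h' | h'⟩) b (hb | hb)
    · exact Or.inl (by omega)
    · exact Or.inl (by omega)
    · exact Or.inl (by omega)
    · simp_all
    · exact Or.inl (by omega)
    · exact Or.inr ⟨hb.1.trans h, h' ▸ hb.2⟩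

/-- Without broken halves the position is a function of the layer that respects inclusion and grows
by a cycle under δ. The chain c_1 ⊂ ⋯ ⊂ c_l ⊂ c_1 + δ then gives order and window, and there is
nothing to balance. -/
theorem IsPreSlice.isPlaceable {n : ℕ} (hn : 4 ≤ n) {l : ℕ} {C : Tuple l} (h : IsPreSlice n C) :
    IsPlaceable n C := by
  obtain ⟨h1, h2, h3⟩ := h
  have sub : ∀ a b : Fin l, a ≤ b → (C a).height < (C b).height ∨
      ((C a).height = (C b).height ∧ ((C a).top = .flat ∨ (C a).top = (C b).top)) :=
    fun a b hab => (Layer.blocks_subset_iff (h1 a).1).1 (h2 a b hab)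
  have wrap : ∀ a b : Fin l, a.val = 0 → b.val = l - 1 →
      (C b).height < (C a).height + (2 * (n : ℤ) - 4) ∨
      ((C b).height = (C a).height + (2 * (n : ℤ) - 4) ∧
        ((C b).top = .flat ∨ (C b).top = (C a).top)) :=
    fun a b ha hb => (Layer.blocks_subset_iff (h1 b).1).1 (h3 a b ha hb)
  have nb : ∀ a r, ¬ (res n (C a).height = r ∧ (C a).top = .broken) := fun a r e => (h1 a).1 e.2
  let z : ∀ a : Fin l, Fin l := fun a => ⟨0, a.pos⟩
  let y : ∀ a : Fin l, Fin l := fun a => ⟨l - 1, by have := a.isLt; omega⟩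
  have hz : ∀ a, z a ≤ a := fun a => Fin.mk_le_of_le_val (Nat.zero_le _)
  have hy : ∀ a, a ≤ y a := fun a => Fin.le_def.2 (by simp only [y]; omega)
  let p : Layer → ℤ := fun c => if c.top = .flat then 4 * c.height else 4 * c.height + 2
  have p_le : ∀ c d : Layer, (c.height < d.height ∨
      (c.height = d.height ∧ (c.top = .flat ∨ c.top = d.top))) → p c ≤ p d := by
    rintro c d (g | ⟨g, g' | g'⟩)
    · simp only [p]; split_ifs <;> omega
    · simp only [p, g']; split_ifs <;> omega
    · simp only [p, g']; split_ifs <;> omega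
  have p_add : ∀ c : Layer, p (c.addDelta n) = p c + 4 * (2 * (n : ℤ) - 4) := by
    intro c; simp only [p, Layer.addDelta]; split_ifs <;> ring
  refine ⟨fun a => p (C a), ⟨?_, ?_, ?_, ?_⟩, ?_, ?_, ?_⟩
  · intro a b hab
    exact p_le _ _ (sub a b hab)
  · intro a b
    have g1 := p_le _ _ (sub _ _ (hz a))
    have g2 := p_le _ _ (sub _ _ (hy b))
    have g3 := p_le _ ((C (z a)).addDelta n) (wrap (z a) (y b) rfl rfl)
    rw [p_add] at g3
    linarith
  · intro a
    match ht : (C a).top with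
    | .flat => simp [IsPos, ht, p]
    | .broken => exact absurd ht (h1 a).1
    | .single s =>
      right; left
      exact ⟨⟨s, ht⟩, (isDouble_iff hn _).1 ((h1 a).2 s ht), by simp [p, ht]⟩
  · have key : ∀ a b s s', a ≤ b → (C a).top = .single s → (C b).top = .single s' →
        res n (C a).height = res n (C b).height → s = s' := by
      intro a b s s' hab e1 e2 e3
      rcases sub a b hab with g | g
      -- With equal residues, a strictly higher layer `b` is a whole cycle above `a`. The chain
      -- leaves no room for more: `a` is at the height of c_1, `b` at that of c_l, and these are a
      -- cycle apart. The inclusions then pass the side on from `b` via c_l and c_1 to `a`.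
      · have g0 := period_le_of_res_eq hn e3 g
        have g1 := sub _ _ (hz a)
        have g2 := sub _ _ (hy b)
        have g3 := wrap (z a) (y b) rfl rfl
        simp only [e1, e2] at g1 g2
        have t2 : (C (y b)).top = .single s' := by
          rcases g2 with g2 | g2
          · omega
          · simpa [eq_comm] using g2.2
        have t1 : (C (z a)).top = .single s' := by
          rcases g3 with g3 | g3
          · omega
          · simpa [t2, eq_comm] using g3.2
        rcases g1 with g1 | g1
        · omega
        · simpa [t1, eq_comm] using g1.2
      · simpa [e1, e2] using g.2
    intro a b s s' e1 e2 e3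
    rcases le_total a b with hab | hab
    · exact key a b s s' hab e1 e2 e3
    · exact (key b a s' s hab e2 e1 e3.symm).symm
  · apply Finset.sum_eq_zero
    intro a _
    simp only [p]
    split_ifs
    exacts [balTerm_flat _ _ _, balTerm_single _ _ _]
  · apply Finset.sum_eq_zero
    intro a _
    simp only [p]
    split_ifs
    exacts [balTerm_flat _ _ _, balTerm_single _ _ _]
  · intro r _ _
    simp [cnt, nb]

/-- Positions determine the inclusions between layers except for the side of half-depth blocks in a
common cell, and that is settled by `side`. -/
theorem Placed.isPreSlice {n : ℕ} (hn : 4 ≤ n) {l : ℕ} {C : Tuple l} {u : Fin l → ℤ}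
    (h : Placed n C u) (hb : ∀ a, (C a).top ≠ .broken) : IsPreSlice n C := by
  have key : ∀ a b : Fin l, ∀ d : Layer, ∀ q, d.height = (C b).height + q → d.top = (C b).top →
      res n (C b).height = res n d.height → u a ≤ u b + 4 * q → (C a).blocks ⊆ d.blocks := by
    intro a b d q e1 e2 e3 e4
    rw [Layer.blocks_subset_iff (hb a)]
    have p1 := (h.pos a).bounds
    have p2 := (h.pos b).bounds
    rcases lt_or_ge (C a).height d.height with hlt | hge
    · exact Or.inl hlt
    · have e : (C a).height = d.height := by omega
      refine Or.inr ⟨e, ?_⟩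
      rcases h.pos a with q1 | q1 | q1 | q1
      · exact Or.inl q1.1
      · rcases h.pos b with q2 | q2 | q2 | q2
        · omega
        · obtain ⟨⟨s, hs⟩, -⟩ := q1
          obtain ⟨⟨s', hs'⟩, -⟩ := q2
          have := h.side a b s s' hs hs' (by rw [e3, e])
          rw [e2, hs, hs', this]; exact Or.inr rfl
        all_goals exact absurd q2.1 (hb b)
      all_goals exact absurd q1.1 (hb a)
  refine ⟨fun a => ⟨hb a, fun s hs => ?_⟩, fun a b hab => ?_, fun a b _ _ => ?_⟩
  · rw [isDouble_iff hn]
    rcases h.pos a with q | q | q | q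
    · simp_all
    · exact q.2.1
    · simp_all
    · simp_all
  · exact key a b _ 0 (by simp) rfl rfl (by have := h.mono a b hab; omega)
  · exact key b a _ _ rfl rfl (by simp [Layer.addDelta]) (h.win a b)

/-! ### The characterization of results of splittings -/

theorem IsSplitResult.isPlaceable {n : ℕ} (hn : 4 ≤ n) {l : ℕ} {C : Tuple l}
    (h : IsSplitResult n C) : IsPlaceable n C := by
  obtain ⟨C₀, h0, hr⟩ := h
  induction hr with
  | refl => exact h0.isPlaceable hn
  | tail _ hs ih =>
    obtain ⟨j, hj⟩ := hs
    exact hj.isPlaceable hn ih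

/-- The number of broken halves. -/
def brokenCount {l : ℕ} (C : Tuple l) : ℤ := ∑ a, if (C a).top = .broken then 1 else 0

theorem SplitStep.brokenCount {n : ℕ} (hn : 4 ≤ n) {j l : ℕ} {C C' : Tuple l}
    (h : SplitStep n j C C') : brokenCount C' = brokenCount C + 2 := by
  obtain ⟨k, a, b, ha, hb, rfl⟩ := h
  have hab : a ≠ b := fun e => wholeBlock_ne_wholeSlot hn ha.1 hb.1 (by rw [e])
  unfold DCrystal.brokenCount
  rw [sum_update (fun c : Layer => if c.top = .broken then (1 : ℤ) else 0),
    sum_update (fun c : Layer => if c.top = .broken then (1 : ℤ) else 0),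
    Function.update_of_ne hab.symm]
  simp [ha.1.1, hb.1.1, Layer.removeUpperHalf, Layer.addHalf]
  ring

theorem exists_rho_eq {n : ℕ} (hn : 4 ≤ n) (h : ℤ) :
    ∃ k j, 1 ≤ j ∧ j ≤ n - 1 ∧ res n h = rho n k j := by
  have h1 := label_cast hn h
  have h2 := residue_cast hn h
  have h3 := res_upper hn h
  by_cases hs : Kind.supporting.At n h
  · exact ⟨_, _, (label_kind_iff hn .supporting (label n h) h).1 ⟨rfl, hs⟩⟩
  · refine ⟨_, _, (label_kind_iff hn .covering (label n h) h).1 ⟨rfl, ?_⟩⟩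
    simp only [Kind.At] at *
    omega

theorem brokenCount_nonneg {l : ℕ} (C : Tuple l) : 0 ≤ brokenCount C :=
  Finset.sum_nonneg fun _ _ => by split_ifs <;> simp

/-- Each unsplitting removes two broken halves, and a placeable tuple without halves is a pre-slice.
-/
theorem IsPlaceable.isSplitResult {n : ℕ} (hn : 4 ≤ n) {l : ℕ} {C : Tuple l}
    (h : IsPlaceable n C) : IsSplitResult n C := by
  by_cases hb : ∃ a, (C a).top = .broken
  · obtain ⟨a, ha⟩ := hb
    obtain ⟨k, j, hj1, hj2, hr⟩ := exists_rho_eq hn (C a).height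
    obtain ⟨D, hD, hs⟩ := h.exists_unsplit hn hj1 hj2 ⟨a, ha, hr⟩
    have hlt := hs.brokenCount hn
    have := brokenCount_nonneg D
    obtain ⟨C₀, h0, hr⟩ := IsPlaceable.isSplitResult hn hD
    exact ⟨C₀, h0, hr.tail ⟨j, hs⟩⟩
  · obtain ⟨u, hu, -⟩ := h
    exact ⟨C, hu.isPreSlice hn (fun a ha => hb ⟨a, ha⟩), .refl⟩
termination_by (brokenCount C).toNat
decreasing_by omega

theorem isSplitResult_iff {n : ℕ} (hn : 4 ≤ n) {l : ℕ} {C : Tuple l} :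
    IsSplitResult n C ↔ IsPlaceable n C :=
  ⟨fun h => h.isPlaceable hn, fun h => h.isSplitResult hn⟩

/-- The required extremal layers exist as soon as there are any candidates, so whether a splitting
is possible is visible from the counts. -/
theorem exists_splitStep_iff {n : ℕ} (hn : 4 ≤ n) {l : ℕ} {C : Tuple l} {j : ℕ} (hj1 : 1 ≤ j)
    (hj2 : j ≤ n - 1) :
    (∃ C', SplitStep n j C C') ↔ ∃ k, 0 < cnt n C (nextRes n (rho n k j)) .flat ∧
      0 < cnt n C (rho n k.swap j) .flat := by
  have hblk : ∀ k c, HasWholeBlock n k j c ↔ res n c.height = nextRes n (rho n k j) ∧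
      c.top = .flat := by
    intro k c
    rw [hasWholeBlock_iff hn]
    have e := res_eq_nextRes hn c.height
    have := res_lower hn (c.height - 1)
    have := res_upper hn (c.height - 1)
    have := rho_spec (n := n) k hj1 hj2
    unfold nextRes at *
    constructor
    · rintro ⟨h1, -, -, h2⟩; rw [e, h2]; exact ⟨rfl, h1⟩
    · rintro ⟨h1, h2⟩; exact ⟨h2, hj1, hj2, by split_ifs at * <;> omega⟩
  have hslt : ∀ k c, HasWholeSlot n k j c ↔ res n c.height = rho n k j ∧ c.top = .flat := by
    intro k c
    rw [hasWholeSlot_iff hn]; tauto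
  constructor
  · rintro ⟨_, k, a, b, ha, hb, -⟩
    exact ⟨k, cnt_pos_iff.2 ⟨a, (hblk _ _).1 ha.1⟩, cnt_pos_iff.2 ⟨b, (hslt _ _).1 hb.1⟩⟩
  · rintro ⟨k, h1, h2⟩
    obtain ⟨a, ha⟩ := exists_foreHighest (p := fun a => HasWholeBlock n k j (C a))
      (fun a => (C a).blockHeight) ((cnt_pos_iff.1 h1).imp fun a => (hblk _ _).2)
    obtain ⟨b, hb⟩ := exists_rearLowest (p := fun a => HasWholeSlot n k.swap j (C a))
      (fun a => (C a).height) ((cnt_pos_iff.1 h2).imp fun a => (hslt _ _).2)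
    exact ⟨_, k, a, b, ha, hb, rfl⟩

/-- A result of splittings is a slice when `s_i` and `s̄_i` do not occur together
(`2 ≤ i ≤ n-1`). -/
theorem isSlice_iff {n : ℕ} (hn : 4 ≤ n) {l : ℕ} {C : Tuple l} :
    IsSlice n C ↔ IsPlaceable n C ∧
      ∀ r : ℤ, 1 ≤ r → r ≤ n - 2 → cnt n C r .flat = 0 ∨ cnt n C (1 - r) .flat = 0 := by
  unfold IsSlice
  rw [isSplitResult_iff hn]
  apply and_congr_right'
  have nn := fun r => cnt_nonneg n C r .flat
  constructor
  · intro h r h1 h2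
    by_contra! hc
    have n1 := nn r
    have n2 := nn (1 - r)
    obtain ⟨j, rfl⟩ : ∃ j : ℕ, r = j := ⟨r.toNat, by omega⟩
    -- A flat layer of residue r ends in a supporting block of label r, and one of residue 1 - r has
    -- a covering slot of that label. The pair s_{r+1}, s̄_{r+1} therefore allows a splitting.
    obtain ⟨C', hC'⟩ := (exists_splitStep_iff hn (C := C) (j := j) (by omega) (by omega)).2
      ⟨.supporting, by
        have : nextRes n (rho n .supporting j) = j := by
          simp only [rho, nextRes]; split_ifs <;> omega
        rw [this]; omega, by
        have : rho n Kind.supporting.swap j = 1 - j := by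
          simp only [rho, Kind.swap]; split_ifs <;> omega
        rw [this]; omega⟩
    exact h j C' hC'
  · intro h j C' hC'
    obtain ⟨hj1, hj2, -⟩ := hC'.cnt hn
    obtain ⟨k, h1, h2⟩ := (exists_splitStep_iff hn hj1 hj2).1 ⟨C', hC'⟩
    have hs := rho_spec (n := n) k hj1 hj2
    have := h (j - 1)
    have g1 := h j
    unfold nextRes at h1
    have e1 : (1 : ℤ) - (j - 1) = 2 - j := by ring
    rw [e1] at this
    -- Splitting a `j`-block uses the pair s_{j+1}, s̄_{j+1} if the broken block is supporting and
    -- s_j, s̄_j if it is covering. At j = n-1 only the second pair is left, at j = 1 only the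
    -- first.
    rcases hs with ⟨e, r1, r2⟩ | ⟨e, ⟨r1, r2⟩ | ⟨r1, r2⟩⟩
    · rw [r1, if_pos (by omega)] at h1
      rw [r2] at h2
      rw [show 3 - (n : ℤ) = 2 - j by omega] at h1
      omega
    · rw [r1, if_neg (by omega), sub_add_cancel] at h1
      rw [r2] at h2
      omega
    · rw [r1, if_neg (by omega), show (1 : ℤ) - j + 1 = 2 - j by ring] at h1
      rw [r2] at h2
      rcases eq_or_ne j 1 with rfl | hj
      · norm_num at h1 h2 g1
        omega
      · omega

/-! ### Adding a `δ` -/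

/-- The tuple `(f 1, …, f (l-1), T (f 0))`. -/
def rot {β : Type*} (T : β → β) {l : ℕ} (f : Fin (l + 1) → β) : Fin (l + 1) → β :=
  Fin.snoc (fun a => f a.succ) (T (f 0))

@[simp] theorem rot_castSucc {β : Type*} (T : β → β) {l : ℕ} (f : Fin (l + 1) → β) (a : Fin l) :
    rot T f a.castSucc = f a.succ := by
  simp only [rot, Fin.snoc_castSucc]

@[simp] theorem rot_last {β : Type*} (T : β → β) {l : ℕ} (f : Fin (l + 1) → β) :
    rot T f (Fin.last l) = T (f 0) := by
  simp only [rot, Fin.snoc_last]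

theorem exists_rot_eq {β : Type*} {T : β → β} (hT : Function.Surjective T) {l : ℕ}
    (g : Fin (l + 1) → β) : ∃ f, rot T f = g := by
  obtain ⟨x, hx⟩ := hT (g (Fin.last l))
  refine ⟨Fin.cons x (fun a => g a.castSucc), funext fun a => ?_⟩
  refine Fin.lastCases ?_ (fun a => ?_) a
  · rw [rot_last, Fin.cons_zero, hx]
  · rw [rot_castSucc, Fin.cons_succ]

theorem sum_rot {β : Type*} (T : β → β) {l : ℕ} (f : Fin (l + 1) → β) (g : β → ℤ) :
    ∑ a, g (rot T f a) = ∑ a, g (f a) - g (f 0) + g (T (f 0)) := by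
  rw [Fin.sum_univ_castSucc, Fin.sum_univ_succ (fun a => g (f a))]
  simp only [rot_castSucc, rot_last]
  ring

theorem sum_rot_of_periodic {β : Type*} (T : β → β) {l : ℕ} (f : Fin (l + 1) → β) (g : β → ℤ)
    (hg : ∀ x, g (T x) = g x) : ∑ a, g (rot T f a) = ∑ a, g (f a) := by
  rw [sum_rot, hg]; ring

theorem addDelta_eq_rot (n l : ℕ) (C : Tuple (l + 1)) :
    addDelta n C = rot (Layer.addDelta n) C := by
  funext a
  refine Fin.lastCases ?_ (fun a => ?_) a
  · simp [addDelta]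
  · simp [addDelta, Fin.succ]

theorem layer_addDelta_surjective (n : ℕ) : Function.Surjective (Layer.addDelta n) :=
  fun c => ⟨⟨c.height - (2 * (n : ℤ) - 4), c.top⟩, by simp [Layer.addDelta]⟩

/-- The positions of `C + δ`. -/
def shiftPos (n : ℕ) {l : ℕ} (u : Fin (l + 1) → ℤ) : Fin (l + 1) → ℤ :=
  rot (· + 4 * (2 * (n : ℤ) - 4)) u

theorem isPos_addDelta (n : ℕ) (c : Layer) (v : ℤ) :
    IsPos n (c.addDelta n) (v + 4 * (2 * (n : ℤ) - 4)) ↔ IsPos n c v := by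
  unfold IsPos
  simp only [Layer.addDelta, res_add_period]
  have e : ∀ m, v + 4 * (2 * (n : ℤ) - 4) = 4 * (c.height + (2 * (n : ℤ) - 4)) + m ↔
      v = 4 * c.height + m := fun m => by omega
  have e0 : v + 4 * (2 * (n : ℤ) - 4) = 4 * (c.height + (2 * (n : ℤ) - 4)) ↔
      v = 4 * c.height := by omega
  rw [e, e, e, e0]

/-- Moving the first layer to the rear, one cycle up, turns its order relations into window
relations of the last layer and conversely. So `mono` and `win` together are invariant, while `pos`
and `side` only see residues. -/
theorem placed_rot_iff {n : ℕ} (hn : 4 ≤ n) {l : ℕ} (C : Tuple (l + 1)) (u : Fin (l + 1) → ℤ) :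
    Placed n (rot (Layer.addDelta n) C) (shiftPos n u) ↔ Placed n C u := by
  unfold shiftPos
  constructor
  · intro h
    have key : ∀ a, ∃ a', (rot (Layer.addDelta n) C a').top = (C a).top ∧
        res n (rot (Layer.addDelta n) C a').height = res n (C a).height := by
      intro a
      refine Fin.cases ⟨Fin.last l, ?_⟩ (fun a => ⟨a.castSucc, ?_⟩) a
      · simp [Layer.addDelta]
      · simp
    refine ⟨fun a b => ?_, fun a b => ?_, fun a => ?_, fun a b s s' h1 h2 h3 => ?_⟩
    · refine Fin.cases ?_ (fun a => ?_) a <;> refine Fin.cases ?_ (fun b => ?_) b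
      · simp
      · intro _
        have := h.win b.castSucc (Fin.last l)
        simp only [rot_castSucc, rot_last] at this
        linarith
      · intro hab; exact absurd hab (by simp)
      · intro hab
        have := h.mono a.castSucc b.castSucc (by simpa using hab)
        simpa using this
    · refine Fin.cases ?_ (fun a => ?_) a <;> refine Fin.cases ?_ (fun b => ?_) b
      · omega
      · have := h.mono b.castSucc (Fin.last l) (Fin.le_last _)
        simpa using this
      · have := h.win a.castSucc (Fin.last l)
        simp only [rot_castSucc, rot_last] at this
        omega
      · have := h.win a.castSucc b.castSucc
        simpa using this
    · refine Fin.cases ?_ (fun a => ?_) a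
      · have := h.pos (Fin.last l)
        simpa [isPos_addDelta] using this
      · simpa using h.pos a.castSucc
    · obtain ⟨a', e1, e2⟩ := key a
      obtain ⟨b', e3, e4⟩ := key b
      exact h.side a' b' s s' (e1.trans h1) (e3.trans h2) (e2.trans (h3.trans e4.symm))
  · intro h
    have key : ∀ a', ∃ a, (rot (Layer.addDelta n) C a').top = (C a).top ∧
        res n (rot (Layer.addDelta n) C a').height = res n (C a).height := by
      intro a
      refine Fin.lastCases ⟨0, ?_⟩ (fun a => ⟨a.succ, ?_⟩) a
      · simp [Layer.addDelta]
      · simp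
    refine ⟨fun a b => ?_, fun a b => ?_, fun a => ?_, fun a b s s' h1 h2 h3 => ?_⟩
    · refine Fin.lastCases ?_ (fun a => ?_) a <;> refine Fin.lastCases ?_ (fun b => ?_) b
      · simp
      · intro hab; exact absurd hab (by simp [Fin.le_def])
      · intro _; simpa using h.win 0 a.succ
      · intro hab; simpa using h.mono a.succ b.succ (by simpa using hab)
    · refine Fin.lastCases ?_ (fun a => ?_) a <;> refine Fin.lastCases ?_ (fun b => ?_) b
      · omega
      · have := h.win 0 b.succ
        simp only [rot_castSucc, rot_last]; omega
      · simpa using h.mono 0 a.succ (Fin.zero_le _)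
      · simpa using h.win a.succ b.succ
    · refine Fin.lastCases ?_ (fun a => ?_) a
      · simpa [isPos_addDelta] using h.pos 0
      · simpa using h.pos a.succ
    · obtain ⟨a', e1, e2⟩ := key a
      obtain ⟨b', e3, e4⟩ := key b
      exact h.side a' b' s s' (e1.symm.trans h1) (e3.symm.trans h2)
        (e2.symm.trans (h3.trans e4))

theorem cnt_rot (n : ℕ) {l : ℕ} (C : Tuple (l + 1)) (r : ℤ) (t : Top) :
    cnt n (rot (Layer.addDelta n) C) r t = cnt n C r t :=
  sum_rot_of_periodic (Layer.addDelta n) C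
    (fun c => if res n c.height = r ∧ c.top = t then 1 else 0)
    (fun c => by simp [Layer.addDelta])

theorem balTerm_add (n : ℕ) (r v : ℤ) :
    balTerm n r (v + 4 * (2 * (n : ℤ) - 4)) = balTerm n r v := by
  unfold balTerm
  rw [show (v + 4 * (2 * (n : ℤ) - 4)) / 4 = v / 4 + (2 * (n : ℤ) - 4) by omega, res_add_period,
    show (v + 4 * (2 * (n : ℤ) - 4)) % 4 = v % 4 by omega]

theorem balanced_rot_iff (n : ℕ) {l : ℕ} (C : Tuple (l + 1)) (u : Fin (l + 1) → ℤ) :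
    Balanced n (rot (Layer.addDelta n) C) (shiftPos n u) ↔ Balanced n C u := by
  have e : ∀ r, ∑ a, balTerm n r (shiftPos n u a) = ∑ a, balTerm n r (u a) := fun r =>
    sum_rot_of_periodic _ u (balTerm n r) (balTerm_add n r)
  constructor
  · rintro ⟨h1, h2, h3⟩
    simp only [e, cnt_rot] at h1 h2 h3
    exact ⟨h1, h2, h3⟩
  · rintro ⟨h1, h2, h3⟩
    refine ⟨?_, ?_, ?_⟩ <;> simp only [e, cnt_rot] <;> assumption

theorem shiftPos_surjective (n : ℕ) {l : ℕ} :
    Function.Surjective (shiftPos n (l := l)) := fun w =>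
  exists_rot_eq (fun x => ⟨x - 4 * (2 * (n : ℤ) - 4), by simp⟩) w

theorem isPlaceable_rot_iff {n : ℕ} (hn : 4 ≤ n) {l : ℕ} (C : Tuple (l + 1)) :
    IsPlaceable n (rot (Layer.addDelta n) C) ↔ IsPlaceable n C := by
  constructor
  · rintro ⟨w, h1, h2⟩
    obtain ⟨u, rfl⟩ := shiftPos_surjective n w
    exact ⟨u, (placed_rot_iff hn C u).1 h1, (balanced_rot_iff n C u).1 h2⟩
  · rintro ⟨u, h1, h2⟩
    exact ⟨_, (placed_rot_iff hn C u).2 h1, (balanced_rot_iff n C u).2 h2⟩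

theorem cnt_addDelta (n : ℕ) {l : ℕ} (C : Tuple l) (r : ℤ) (t : Top) :
    cnt n (addDelta n C) r t = cnt n C r t := by
  cases l with
  | zero => simp [cnt]
  | succ l => rw [addDelta_eq_rot, cnt_rot]

theorem isSlice_addDelta_iff {n : ℕ} (hn : 4 ≤ n) {l : ℕ} (C : Tuple l) :
    IsSlice n C ↔ IsSlice n (addDelta n C) := by
  cases l with
  | zero => rw [Subsingleton.elim (addDelta n C) C]
  | succ l =>
    simp only [isSlice_iff hn, cnt_addDelta]
    rw [addDelta_eq_rot, isPlaceable_rot_iff hn]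

theorem Related.cnt_eq {n l : ℕ} {C C' : Tuple l} (h : Related n C C') (r : ℤ) (t : Top) :
    cnt n C r t = cnt n C' r t := by
  have key : ∀ (m : ℕ) (D : Tuple l), cnt n ((addDelta n)^[m] D) r t = cnt n D r t := by
    intro m
    induction m with
    | zero => intro D; rfl
    | succ m ih => intro D; rw [Function.iterate_succ_apply, ih, cnt_addDelta]
  obtain ⟨m, rfl | rfl⟩ := h
  · exact (key m C).symm
  · exact key m C'

theorem related_rot (n : ℕ) {l : ℕ} (C : Tuple (l + 1)) :
    Related n C (rot (Layer.addDelta n) C) :=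
  ⟨1, Or.inl (addDelta_eq_rot n l C)⟩

/-! ### Normalized representatives -/

/-- A rotation lifts the fore-most layer, which has the smallest position, by a cycle. As long as it
is below `L`, the total deficit below `L` strictly decreases. -/
theorem exists_related_ge {n : ℕ} (hn : 4 ≤ n) {l : ℕ} (L : ℤ) (C : Tuple (l + 1))
    (u : Fin (l + 1) → ℤ) (h1 : Placed n C u) (h2 : Balanced n C u) :
    ∃ C' u', Related n C C' ∧ Placed n C' u' ∧ Balanced n C' u' ∧ ∀ a, L ≤ u' a := by
  by_cases h : L ≤ u 0
  · exact ⟨C, u, (related_equivalence n _).refl C, h1, h2,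
      fun a => h.trans (h1.mono 0 a (Fin.zero_le _))⟩
  · obtain ⟨C', u', g1, g2⟩ := exists_related_ge hn L _ _ ((placed_rot_iff hn C u).2 h1)
      ((balanced_rot_iff n C u).2 h2)
    exact ⟨C', u', (related_equivalence n _).trans (related_rot n C) g1, g2⟩
termination_by (∑ a, max 0 (L - u a)).toNat
decreasing_by
  have e := sum_rot (· + 4 * (2 * (n : ℤ) - 4)) u (fun v => max 0 (L - v))
  have p : 0 ≤ ∑ a, max 0 (L - rot (· + 4 * (2 * (n : ℤ) - 4)) u a) :=
    Finset.sum_nonneg fun _ _ => le_max_left _ _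
  unfold shiftPos
  omega

/-- Rotating backwards lowers the rear-most layer by a cycle. It is done only while this layer stays
at or above `L`, so the nonnegative sum of the excesses over `L` decreases. -/
theorem exists_related_lt {n : ℕ} (hn : 4 ≤ n) {l : ℕ} (L : ℤ) (C : Tuple (l + 1))
    (u : Fin (l + 1) → ℤ) (h1 : Placed n C u) (h2 : Balanced n C u) (h3 : ∀ a, L ≤ u a) :
    ∃ C' u', Related n C C' ∧ Placed n C' u' ∧ Balanced n C' u' ∧
      ∀ a, L ≤ u' a ∧ u' a < L + 4 * (2 * (n : ℤ) - 4) := by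
  by_cases h : u (Fin.last l) < L + 4 * (2 * (n : ℤ) - 4)
  · exact ⟨C, u, (related_equivalence n _).refl C, h1, h2,
      fun a => ⟨h3 a, (h1.mono a _ (Fin.le_last _)).trans_lt h⟩⟩
  · obtain ⟨D, rfl⟩ := exists_rot_eq (layer_addDelta_surjective n) C
    obtain ⟨w, rfl⟩ := shiftPos_surjective n u
    have h4 : ∀ a, L ≤ w a := by
      intro a
      refine Fin.cases ?_ (fun a => ?_) a
      · simp only [shiftPos, rot_last] at h; omega
      · simpa [shiftPos] using h3 a.castSucc
    obtain ⟨C', u', g1, g2⟩ := exists_related_lt hn L D w ((placed_rot_iff hn D w).1 h1)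
      ((balanced_rot_iff n D w).1 h2) h4
    exact ⟨C', u', (related_equivalence n _).trans
      ((related_equivalence n _).symm (related_rot n D)) g1, g2⟩
termination_by (∑ a, (u a - L)).toNat
decreasing_by
  have e := sum_rot (· + 4 * (2 * (n : ℤ) - 4)) w (fun v => v - L)
  have p : 0 ≤ ∑ a, (w a - L) := Finset.sum_nonneg fun a _ => by have := h4 a; omega
  simp_all only [shiftPos]
  omega

/-- An increasing sequence is the sorted list of the multiset of its values. -/
theorem eq_of_monotone_of_count {l : ℕ} {u w : Fin l → ℤ} (hu : Monotone u) (hw : Monotone w)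
    (h : ∀ v, ∑ a, (if u a = v then (1 : ℤ) else 0) = ∑ a, if w a = v then 1 else 0) :
    u = w := by
  have hm : (Finset.univ : Finset (Fin l)).val.map u = Finset.univ.val.map w := by
    ext v
    have := h v
    simp only [Finset.sum_boole, Nat.cast_inj] at this
    rw [Multiset.count_map, Multiset.count_map]
    simp only [eq_comm (a := v)]
    exact this
  rw [Fin.univ_val_map, Fin.univ_val_map, Multiset.coe_eq_coe] at hm
  apply List.ofFn_injective
  exact hm.eq_of_pairwise' (List.pairwise_ofFn.2 fun _ _ hij => hu hij.le)
    (List.pairwise_ofFn.2 fun _ _ hij => hw hij.le)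

/-- A half in such a cell is either low or high and contributes 1 or -1 to a vanishing sum, so
exactly one half of them are low. In particular their number is even. -/
theorem Placed.two_mul_low {n l : ℕ} {C : Tuple l} {u : Fin l → ℤ} (h : Placed n C u) {r : ℤ}
    (hr : r = 0 ∨ r = n - 2) (hb : ∑ a, balTerm n r (u a) = 0) :
    cnt n C r .broken = 2 * ∑ a, if balTerm n r (u a) = 1 then 1 else 0 := by
  have key : ∀ a, (2 : ℤ) * (if balTerm n r (u a) = 1 then 1 else 0) =
      (if res n (C a).height = r ∧ (C a).top = .broken then 1 else 0) + balTerm n r (u a) := by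
    intro a
    obtain ⟨k1, k2, k3⟩ := (h.pos a).balTerm_cases hr
    have h3 : balTerm n r (u a) = 1 ∨ balTerm n r (u a) = -1 ∨ balTerm n r (u a) = 0 := by
      unfold balTerm; split_ifs <;> simp
    rcases h3 with e | e | e
    · rw [e, if_pos rfl, if_pos ⟨(k1 e).2.1, (k1 e).1⟩]; rfl
    · rw [e, if_neg (by omega), if_pos ⟨(k2 e).2.1, (k2 e).1⟩]; rfl
    · rw [e, if_neg (by omega), if_neg (fun g => k3 g.2 g.1 e)]; rfl
  rw [Finset.mul_sum, Finset.sum_congr rfl fun a _ => key a, Finset.sum_add_distrib, hb, add_zero]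
  rfl

/-- A placeable tuple with normalized positions is determined by its counts of layers. -/
theorem eq_of_cnt_eq {n : ℕ} (hn : 4 ≤ n) {l : ℕ} {C D : Tuple l} {u w : Fin l → ℤ}
    (hC : Placed n C u) (bC : Balanced n C u) (hD : Placed n D w) (bD : Balanced n D w)
    (rC : ∀ a, 4 * (3 - (n : ℤ)) ≤ u a ∧ u a < 4 * (3 - (n : ℤ)) + 4 * (2 * (n : ℤ) - 4))
    (rD : ∀ a, 4 * (3 - (n : ℤ)) ≤ w a ∧ w a < 4 * (3 - (n : ℤ)) + 4 * (2 * (n : ℤ) - 4))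
    (h : ∀ r t, cnt n C r t = cnt n D r t) : C = D := by
  have hgt : ∀ {C : Tuple l} {u : Fin l → ℤ}, Placed n C u →
      (∀ a, 4 * (3 - (n : ℤ)) ≤ u a ∧ u a < 4 * (3 - (n : ℤ)) + 4 * (2 * (n : ℤ) - 4)) →
      ∀ a, res n (C a).height = (C a).height := by
    intro C u hC rC a
    have := (hC.pos a).bounds
    have := rC a
    exact res_of_mem (by omega) (by omega)
  -- The number of layers at every single position can be read off from the counts. In the cells of
  -- half-depth blocks the halves are shared equally between the low and the high position.
  have N : ∀ {C : Tuple l} {u : Fin l → ℤ}, Placed n C u →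
      (∀ r, r = 0 ∨ r = (n : ℤ) - 2 → ∑ a, balTerm n r (u a) = 0) →
      (∀ a, res n (C a).height = (C a).height) → ∀ q : ℤ,
      (∑ a, (if u a = 4 * q then 1 else 0) = cnt n C q .flat) ∧
      (∑ a, (if u a = 4 * q + 2 then 1 else 0) = (if q = 0 ∨ q = (n : ℤ) - 2 then
        cnt n C q (.single .front) + cnt n C q (.single .back) else cnt n C q .broken)) ∧
      (2 * ∑ a, (if u a = 4 * q + 1 then 1 else 0) = (if q = 0 ∨ q = (n : ℤ) - 2 then
        cnt n C q .broken else 0)) ∧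
      (2 * ∑ a, (if u a = 4 * q + 3 then 1 else 0) = (if q = 0 ∨ q = (n : ℤ) - 2 then
        cnt n C q .broken else 0)) := by
    intro C u hC bC hr q
    refine ⟨?_, ?_, ?_, ?_⟩
    · refine Finset.sum_congr rfl fun a _ => ?_
      rw [hr a]
      have e : u a = 4 * q ↔ ((C a).height = q ∧ (C a).top = .flat) := by
        have hb := (hC.pos a).bounds
        refine ⟨fun e => ?_, fun e => by rw [(hC.pos a).flat e.2, e.1]⟩
        have : (C a).height = q := by omega
        exact ⟨this, (hC.pos a).flat_of_eq (by omega)⟩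
      simp only [e]
    · split_ifs with hq
      · unfold cnt
        rw [← Finset.sum_add_distrib]
        refine Finset.sum_congr rfl fun a _ => ?_
        rw [hr a]
        have hp := hC.pos a
        unfold IsPos at hp
        rw [hr a] at hp
        rcases hp with g | ⟨⟨s, g1⟩, g⟩ | g | g
        · simp only [g.1, reduceCtorEq, and_false, if_false]
          rw [if_neg (by omega)]; rfl
        · have e : u a = 4 * q + 2 ↔ (C a).height = q := by omega
          simp only [e, g1]
          cases s <;> simp
        · simp only [g.1, reduceCtorEq, and_false, if_false]
          rw [if_neg (by omega)]; rfl
        · simp only [g.1, reduceCtorEq, and_false, if_false]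
          rw [if_neg (by omega)]; rfl
      · refine Finset.sum_congr rfl fun a _ => ?_
        rw [hr a]
        have hp := hC.pos a
        unfold IsPos at hp
        rw [hr a] at hp
        rcases hp with g | ⟨⟨s, g1⟩, g⟩ | g | g
        · simp only [g.1, reduceCtorEq, and_false, if_false]
          rw [if_neg (by omega)]
        · simp only [g1, reduceCtorEq, and_false, if_false]
          rw [if_neg (by omega)]
        · rw [if_neg (by omega), if_neg (by omega)]
        · have e : u a = 4 * q + 2 ↔ (C a).height = q := by omega
          simp only [e, g.1, and_true]
    all_goals
      split_ifs with hq
      · rw [hC.two_mul_low hq (bC q hq)]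
        first
        | (congr 1
           refine Finset.sum_congr rfl fun a _ => ?_
           have e : u a = 4 * q + 1 ↔ balTerm n q (u a) = 1 := by
             obtain ⟨k1, k2, k3⟩ := (hC.pos a).balTerm_cases hq
             constructor
             · intro e
               have hb := (hC.pos a).bounds
               have e1 : u a / 4 = q := by omega
               have e2 : (C a).height = q := by omega
               have e3 : u a % 4 = 1 := by omega
               have := hr a
               rw [balTerm, e1, if_pos (by rw [← e2, this]), if_pos e3]
             · intro e
               have := (k1 e).2.2
               have h5 := (k1 e).2.1
               rw [hr a] at h5
               rw [this, lowPos, hr a, h5, if_pos hq]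
           simp only [e])
        | (rw [← hC.two_mul_low hq (bC q hq)]
           have hb := bC q hq
           have hl := hC.two_mul_low hq hb
           rw [hl]
           have : ∑ a, balTerm n q (u a) = ∑ a, (if balTerm n q (u a) = 1 then (1 : ℤ) else 0) -
               ∑ a, (if u a = 4 * q + 3 then 1 else 0) := by
             rw [← Finset.sum_sub_distrib]
             refine Finset.sum_congr rfl fun a _ => ?_
             have e : u a = 4 * q + 3 ↔ balTerm n q (u a) = -1 := by
               obtain ⟨k1, k2, k3⟩ := (hC.pos a).balTerm_cases hq
               constructor
               · intro e
                 have hb := (hC.pos a).bounds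
                 have e1 : u a / 4 = q := by omega
                 have e2 : (C a).height = q := by omega
                 have e3 : u a % 4 = 3 := by omega
                 have := hr a
                 rw [balTerm, e1, if_pos (by rw [← e2, this]), if_neg (by omega), if_pos e3]
               · intro e
                 have := (k2 e).2.2
                 have h5 := (k2 e).2.1
                 rw [hr a] at h5
                 rw [this, highPos, hr a, h5, if_pos hq]
             have h3 : balTerm n q (u a) = 1 ∨ balTerm n q (u a) = -1 ∨
                 balTerm n q (u a) = 0 := by
               unfold balTerm; split_ifs <;> simp
             simp only [e]
             rcases h3 with e | e | e <;> simp [e]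
           linarith)
      · rw [Finset.sum_eq_zero, mul_zero]
        intro a _
        rw [if_neg]
        intro e
        have hp := hC.pos a
        unfold IsPos at hp
        rw [hr a] at hp
        omega
  have NC := N hC (by rintro r (rfl | rfl); exacts [bC.zero, bC.last]) (hgt hC rC)
  have ND := N hD (by rintro r (rfl | rfl); exacts [bD.zero, bD.last]) (hgt hD rD)
  have huw : u = w := by
    refine eq_of_monotone_of_count (fun a b => hC.mono a b) (fun a b => hD.mono a b) fun v => ?_
    obtain ⟨c0, c2, c1, c3⟩ := NC (v / 4)
    obtain ⟨d0, d2, d1, d3⟩ := ND (v / 4)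
    simp only [h] at c0 c1 c2 c3
    have : v = 4 * (v / 4) ∨ v = 4 * (v / 4) + 1 ∨ v = 4 * (v / 4) + 2 ∨
        v = 4 * (v / 4) + 3 := by omega
    rcases this with e | e | e | e <;> rw [e]
    · exact c0.trans d0.symm
    · linarith
    · exact c2.trans d2.symm
    · linarith
  subst huw
  funext a
  have hh : (C a).height = (D a).height := by
    have := (hC.pos a).bounds
    have := (hD.pos a).bounds
    omega
  refine Layer.ext hh ?_
  rcases hC.pos a with g | g | g | g <;> rcases hD.pos a with g' | g' | g' | g' <;>
    first
    | omega
    | exact g.1.trans g'.1.symm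
    | exact absurd (hh ▸ g.2.1) g'.2.1
    | exact absurd (hh ▸ g'.2.1) g.2.1
    | skip
  -- Only the sides of half-depth blocks are left. The counts provide a layer of `D` with side `s`
  -- and the same residue, and all such layers of `D` agree.
  obtain ⟨⟨s, e⟩, -⟩ := g
  obtain ⟨⟨s', e'⟩, -⟩ := g'
  have h1 : 0 < cnt n C (res n (C a).height) (.single s) := cnt_pos_iff.2 ⟨a, rfl, e⟩
  rw [h] at h1
  obtain ⟨b, hb1, hb2⟩ := cnt_pos_iff.1 h1
  have := hD.side b a s s' hb2 e' (by rw [hb1, hh])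
  rw [e, e', this]

/-- Both tuples are rotated until their positions lie in the cycle starting with the cell of height
3 - n, where heights equal residues. There the counts leave only one tuple. -/
theorem related_of_cnt_eq {n : ℕ} (hn : 4 ≤ n) {l : ℕ} {C D : Tuple l} (hC : IsPlaceable n C)
    (hD : IsPlaceable n D) (h : ∀ r t, cnt n C r t = cnt n D r t) : Related n C D := by
  cases l with
  | zero => rw [Subsingleton.elim C D]; exact (related_equivalence n _).refl D
  | succ l =>
    have key : ∀ C : Tuple (l + 1), IsPlaceable n C → ∃ C' u', Related n C C' ∧ Placed n C' u' ∧
        Balanced n C' u' ∧ ∀ a, 4 * (3 - (n : ℤ)) ≤ u' a ∧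
          u' a < 4 * (3 - (n : ℤ)) + 4 * (2 * (n : ℤ) - 4) := by
      rintro C ⟨u, h1, h2⟩
      obtain ⟨C₁, u₁, r1, p1, b1, g1⟩ := exists_related_ge hn (4 * (3 - (n : ℤ))) C u h1 h2
      obtain ⟨C₂, u₂, r2, p2, b2, g2⟩ := exists_related_lt hn _ C₁ u₁ p1 b1 g1
      exact ⟨C₂, u₂, (related_equivalence n _).trans r1 r2, p2, b2, g2⟩
    obtain ⟨C', u, r1, p1, b1, g1⟩ := key C hC
    obtain ⟨D', w, r2, p2, b2, g2⟩ := key D hD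
    have : C' = D' := eq_of_cnt_eq hn p1 b1 p2 b2 g1 g2 fun r t => by
      rw [← r1.cnt_eq, ← r2.cnt_eq, h]
    subst this
    exact (related_equivalence n _).trans r1 ((related_equivalence n _).symm r2)

/-! ### Coordinates -/

theorem coord_eq {n : ℕ} (v : Fin n → ℤ) {i : ℕ} (h1 : 1 ≤ i) (h2 : i ≤ n) :
    coord v i = v ⟨i - 1, by omega⟩ := by
  rw [coord, dif_pos ⟨h1, h2⟩]

@[simp] theorem coord_succ {n : ℕ} (v : Fin n → ℤ) (k : Fin n) : coord v (k.val + 1) = v k := by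
  rw [coord_eq v (by omega) (by omega)]; rfl

theorem coord_ext {n : ℕ} {v w : Fin n → ℤ}
    (h : ∀ i, 1 ≤ i → i ≤ n → coord v i = coord w i) : v = w := by
  funext k
  rw [← coord_succ v, ← coord_succ w]
  exact h _ (by omega) (by omega)

@[simp] theorem coord_add {n : ℕ} (v w : Fin n → ℤ) (i : ℕ) :
    coord (v + w) i = coord v i + coord w i := by
  unfold coord; split_ifs <;> simp

@[simp] theorem coord_sub {n : ℕ} (v w : Fin n → ℤ) (i : ℕ) :
    coord (v - w) i = coord v i - coord w i := by
  unfold coord; split_ifs <;> simp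

theorem coord_unit {n : ℕ} (i j : ℕ) :
    coord (unit n j) i = if i = j ∧ 1 ≤ i ∧ i ≤ n then 1 else 0 := by
  unfold coord unit; split_ifs <;> simp_all <;> omega

theorem coord_mk {n : ℕ} (f : ℕ → ℤ) {i : ℕ} (h1 : 1 ≤ i) (h2 : i ≤ n) :
    coord (fun k : Fin n => f (k.val + 1)) i = f i := by
  rw [coord_eq _ h1 h2]; dsimp only; rw [Nat.sub_add_cancel h1]

theorem coord_nonneg {n l : ℕ} {b : Coords n} (h : IsPerfectElt n l b) (i : ℕ) :
    0 ≤ coord b.1 i ∧ 0 ≤ coord b.2 i := by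
  unfold coord; split_ifs
  exacts [⟨h.1 _, h.2.1 _⟩, ⟨le_rfl, le_rfl⟩]

/-! ### The content of a tuple -/

/-- `HasContent`, expressed by counts of layers of given residues and tops. -/
structure Cont (n : ℕ) (pat : Pattern) (b : Coords n) {l : ℕ} (C : Tuple l) : Prop where
  s : ∀ i : ℕ, 2 ≤ i → i ≤ n - 1 → cnt n C (i - 1) .flat = max 0 (coord b.1 i - coord b.2 i)
  sbar : ∀ i : ℕ, 2 ≤ i → i ≤ n - 1 → cnt n C (2 - i) .flat = max 0 (coord b.2 i - coord b.1 i)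
  s_one : cnt n C 0 (.single (sideOf n pat 0)) = max 0 (coord b.1 1 - coord b.2 1)
  sbar_one : cnt n C 0 (.single (sideOf n pat 1)) = max 0 (coord b.2 1 - coord b.1 1)
  s_last : cnt n C (n - 2) (.single (sideOf n pat (n - 1))) = coord b.1 n
  sbar_last : cnt n C (n - 2) (.single (sideOf n pat n)) = coord b.2 n
  t_one : cnt n C 0 .broken = 2 * min (coord b.1 1) (coord b.2 1)
  t_last : cnt n C (n - 2) .broken = 2 * min (coord b.1 (n - 1)) (coord b.2 (n - 1))
  t : ∀ j : ℕ, 2 ≤ j → j ≤ n - 2 → cnt n C (j - 1) .broken = min (coord b.1 j) (coord b.2 j)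
  tbar : ∀ j : ℕ, 2 ≤ j → j ≤ n - 2 → cnt n C (1 - j) .broken = min (coord b.1 j) (coord b.2 j)

theorem countLayers_eq {n l : ℕ} {P : Layer → Prop} (C : Tuple l) {r : ℤ} {t : Top}
    (h : ∀ c : Layer, P c ↔ res n c.height = r ∧ c.top = t) :
    (countLayers P C : ℤ) = cnt n C r t := by
  classical
  rw [countLayers, Set.ncard_eq_toFinset_card', cnt, Finset.sum_boole]
  simp [h]

theorem isS_mid_iff {n : ℕ} (hn : 4 ≤ n) (pat : Pattern) {i : ℕ} (h1 : 2 ≤ i) (h2 : i ≤ n - 1)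
    (c : Layer) : IsS n pat i c ↔ res n c.height = i - 1 ∧ c.top = .flat := by
  rw [IsS, if_neg (by omega), if_neg (by omega), hasWholeBlock_iff hn, rho]
  have h3 := res_pred hn c.height
  have := res_lower hn c.height
  have := res_upper hn c.height
  split_ifs at h3 <;> grind

theorem isSbar_mid_iff {n : ℕ} (hn : 4 ≤ n) (pat : Pattern) {i : ℕ} (h1 : 2 ≤ i) (h2 : i ≤ n - 1)
    (c : Layer) : IsSbar n pat i c ↔ res n c.height = 2 - i ∧ c.top = .flat := by
  rw [IsSbar, if_neg (by omega), if_neg (by omega), hasWholeBlock_iff hn, rho]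
  have h3 := res_pred hn c.height
  have := res_lower hn c.height
  have := res_upper hn c.height
  split_ifs at h3 <;> grind

theorem single_color_iff {n : ℕ} (hn : 4 ≤ n) (pat : Pattern) {i : ℕ} (hi : i ≤ n)
    (hi' : i ≤ 1 ∨ n - 1 ≤ i) (c : Layer) :
    (∃ s, c.top = .single s ∧ color n pat c.height s = i) ↔
      res n c.height = endRes n i ∧ c.top = .single (sideOf n pat i) := by
  simp only [color_eq_iff hn pat hi hi']
  constructor
  · rintro ⟨s, h1, h2, rfl⟩; exact ⟨h2, h1⟩
  · rintro ⟨h1, h2⟩; exact ⟨_, h2, h1, rfl⟩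

/-- Every prescribed type of layer is one residue with one top. At the labels 1 and n-1 both kinds
have the same residue, so the conditions for the two kinds merge into one. -/
theorem hasContent_iff {n : ℕ} (hn : 4 ≤ n) {l : ℕ} (pat : Pattern) (b : Coords n) (C : Tuple l) :
    HasContent n l pat b C ↔ Cont n pat b C := by
  have eS : ∀ i, 2 ≤ i → i ≤ n - 1 → (countLayers (IsS n pat i) C : ℤ) = cnt n C (i - 1) .flat :=
    fun i h1 h2 => countLayers_eq C (isS_mid_iff hn pat h1 h2)
  have eSb : ∀ i, 2 ≤ i → i ≤ n - 1 →
      (countLayers (IsSbar n pat i) C : ℤ) = cnt n C (2 - i) .flat :=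
    fun i h1 h2 => countLayers_eq C (isSbar_mid_iff hn pat h1 h2)
  have eS1 : (countLayers (IsS n pat 1) C : ℤ) = cnt n C 0 (.single (sideOf n pat 0)) :=
    countLayers_eq C fun c => by
      have := single_color_iff hn pat (i := 0) (by omega) (by omega) c
      simpa [IsS, endRes] using this
  have eSb1 : (countLayers (IsSbar n pat 1) C : ℤ) = cnt n C 0 (.single (sideOf n pat 1)) :=
    countLayers_eq C fun c => by
      have := single_color_iff hn pat (i := 1) (by omega) (by omega) c
      simpa [IsSbar, endRes] using this
  have eSn : (countLayers (IsS n pat n) C : ℤ) =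
      cnt n C (n - 2) (.single (sideOf n pat (n - 1))) :=
    countLayers_eq C fun c => by
      have := single_color_iff hn pat (i := n - 1) (by omega) (by omega) c
      rw [endRes, if_neg (by omega)] at this
      rw [IsS, if_neg (by omega), if_pos rfl, this]
  have eSbn : (countLayers (IsSbar n pat n) C : ℤ) = cnt n C (n - 2) (.single (sideOf n pat n)) :=
    countLayers_eq C fun c => by
      have := single_color_iff hn pat (i := n) (by omega) (by omega) c
      rw [endRes, if_neg (by omega)] at this
      rw [IsSbar, if_neg (by omega), if_pos rfl, this]
  have eT : ∀ k j, 1 ≤ j → j ≤ n - 1 →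
      (countLayers (HasHalf n k j) C : ℤ) = cnt n C (rho n k j) .broken :=
    fun k j h1 h2 => countLayers_eq C fun c => by rw [hasHalf_iff hn]; tauto
  have r1 : ∀ k, rho n k 1 = 0 := by
    intro k; cases k <;> simp only [rho] <;> grind
  have rn : ∀ k, rho n k (n - 1) = n - 2 := by
    intro k; cases k <;> simp only [rho] <;> grind
  have rs : ∀ j, rho n .supporting j = j - 1 := fun _ => rfl
  have rc : ∀ j, j ≠ n - 1 → rho n .covering j = 1 - j := fun j hj => by simp [rho, hj]
  constructor
  · rintro ⟨h1, h2, h3, h4, h5⟩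
    refine ⟨fun i g1 g2 => ?_, fun i g1 g2 => ?_, ?_, ?_, ?_, ?_, ?_, ?_, fun j g1 g2 => ?_,
      fun j g1 g2 => ?_⟩
    · rw [← eS i g1 g2]; exact (h1 i (by omega) g2).1
    · rw [← eSb i g1 g2]; exact (h1 i (by omega) g2).2
    · rw [← eS1]; exact (h1 1 le_rfl (by omega)).1
    · rw [← eSb1]; exact (h1 1 le_rfl (by omega)).2
    · rw [← eSn]; exact h2
    · rw [← eSbn]; exact h3
    · rw [← r1 .covering, ← eT _ _ le_rfl (by omega)]; exact h4 1 (Or.inl rfl) _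
    · rw [← rn .covering, ← eT _ _ (by omega) le_rfl]; exact h4 _ (Or.inr rfl) _
    · rw [← rs, ← eT _ _ (by omega) (by omega)]; exact h5 j g1 g2 _
    · rw [← rc j (by omega), ← eT _ _ (by omega) (by omega)]; exact h5 j g1 g2 _
  · intro h
    refine ⟨fun i g1 g2 => ?_, ?_, ?_, ?_, fun j g1 g2 k => ?_⟩
    · rcases Nat.lt_or_ge i 2 with hi | hi
      · obtain rfl : i = 1 := by omega
        rw [eS1, eSb1]; exact ⟨h.s_one, h.sbar_one⟩
      · rw [eS i hi g2, eSb i hi g2]; exact ⟨h.s i hi g2, h.sbar i hi g2⟩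
    · rw [eSn]; exact h.s_last
    · rw [eSbn]; exact h.sbar_last
    · rintro j (rfl | rfl) k
      · rw [eT _ _ le_rfl (by omega), r1]; exact h.t_one
      · rw [eT _ _ (by omega) le_rfl, rn]; exact h.t_last
    · rw [eT _ _ (by omega) (by omega)]
      cases k
      · rw [rc j (by omega)]; exact h.tbar j g1 g2
      · exact h.t j g1 g2

theorem Cont.congr {n l l' : ℕ} {pat : Pattern} {b : Coords n} {C : Tuple l} {D : Tuple l'}
    (h : Cont n pat b C) (e : ∀ r t, cnt n C r t = cnt n D r t) : Cont n pat b D := by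
  obtain ⟨h1, h2, h3, h4, h5, h6, h7, h8, h9, h10⟩ := h
  simp only [e] at h1 h2 h3 h4 h5 h6 h7 h8 h9 h10
  exact ⟨h1, h2, h3, h4, h5, h6, h7, h8, h9, h10⟩

/-- Two numbers are recovered from their minimum and the positive parts of their two differences;
the coordinates of number n are counted directly. -/
theorem Cont.unique {n l : ℕ} (hn : 4 ≤ n) {pat : Pattern} {b b' : Coords n} {C : Tuple l}
    (h : Cont n pat b C) (h' : Cont n pat b' C) : b = b' := by
  have key : ∀ i, 1 ≤ i → i ≤ n → coord b.1 i = coord b'.1 i ∧ coord b.2 i = coord b'.2 i := by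
    intro i h1 h2
    rcases eq_or_ne i 1 with rfl | g1
    · have := h.s_one.symm.trans h'.s_one
      have := h.sbar_one.symm.trans h'.sbar_one
      have := h.t_one.symm.trans h'.t_one
      omega
    rcases eq_or_ne i n with rfl | g2
    · exact ⟨h.s_last.symm.trans h'.s_last, h.sbar_last.symm.trans h'.sbar_last⟩
    have e1 := (h.s i (by omega) (by omega)).symm.trans (h'.s i (by omega) (by omega))
    have e2 := (h.sbar i (by omega) (by omega)).symm.trans (h'.sbar i (by omega) (by omega))
    rcases eq_or_ne i (n - 1) with rfl | g3
    · have := h.t_last.symm.trans h'.t_last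
      omega
    · have := (h.t i (by omega) (by omega)).symm.trans (h'.t i (by omega) (by omega))
      omega
  exact Prod.ext (coord_ext fun i h1 h2 => (key i h1 h2).1) (coord_ext fun i h1 h2 => (key i h1 h2).2)

theorem sideOf_one {n : ℕ} (hn : 4 ≤ n) (pat : Pattern) :
    sideOf n pat 1 = (sideOf n pat 0).other := by
  cases pat <;> simp [sideOf, Side.other] <;> omega

theorem sideOf_last {n : ℕ} (hn : 4 ≤ n) (pat : Pattern) :
    sideOf n pat n = (sideOf n pat (n - 1)).other := by
  have : n ≠ 0 ∧ n ≠ n - 1 := by omega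
  cases pat <;> simp [sideOf, Side.other, this]

theorem cnt_eq_zero {n l : ℕ} {C : Tuple l} {r : ℤ} {t : Top}
    (h : ∀ a, res n (C a).height = r → (C a).top = t → False) : cnt n C r t = 0 :=
  Finset.sum_eq_zero fun a _ => if_neg fun e => h a e.1 e.2

theorem Placed.single_res {n l : ℕ} {C : Tuple l} {u : Fin l → ℤ} (h : Placed n C u) {a : Fin l}
    {s : Side} (ha : (C a).top = .single s) :
    res n (C a).height = 0 ∨ res n (C a).height = (n : ℤ) - 2 := by
  rcases h.pos a with g | g | g | g
  · simp [ha] at g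
  · exact g.2.1
  · simp [ha] at g
  · simp [ha] at g

/-- Placeable tuples of the same content have the same counts of layers. -/
theorem Cont.cnt_eq {n l : ℕ} (hn : 4 ≤ n) {pat : Pattern} {b : Coords n} {C D : Tuple l}
    (hC : IsPlaceable n C) (hD : IsPlaceable n D) (h : Cont n pat b C) (h' : Cont n pat b D)
    (r : ℤ) (t : Top) : cnt n C r t = cnt n D r t := by
  obtain ⟨u, hC, -⟩ := hC
  obtain ⟨w, hD, -⟩ := hD
  by_cases hr : 3 - (n : ℤ) ≤ r ∧ r ≤ n - 2
  · match t with
    | .flat =>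
      rcases lt_or_ge 0 r with h0 | h0
      · obtain ⟨i, rfl⟩ : ∃ i : ℕ, r = i - 1 := ⟨(r + 1).toNat, by omega⟩
        rw [h.s i (by omega) (by omega), h'.s i (by omega) (by omega)]
      · obtain ⟨i, rfl⟩ : ∃ i : ℕ, r = 2 - i := ⟨(2 - r).toNat, by omega⟩
        rw [h.sbar i (by omega) (by omega), h'.sbar i (by omega) (by omega)]
    | .single s =>
      rcases eq_or_ne r 0 with rfl | h0
      · rcases eq_or_ne s (sideOf n pat 0) with rfl | hs
        · rw [h.s_one, h'.s_one]
        · rw [Side.ne_iff, ← sideOf_one hn] at hs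
          rw [hs, h.sbar_one, h'.sbar_one]
      rcases eq_or_ne r (n - 2) with rfl | h1
      · rcases eq_or_ne s (sideOf n pat (n - 1)) with rfl | hs
        · rw [h.s_last, h'.s_last]
        · rw [Side.ne_iff, ← sideOf_last hn] at hs
          rw [hs, h.sbar_last, h'.sbar_last]
      rw [cnt_eq_zero fun a e1 e2 => ?_, cnt_eq_zero fun a e1 e2 => ?_]
      · have := hD.single_res e2; omega
      · have := hC.single_res e2; omega
    | .broken =>
      rcases eq_or_ne r 0 with rfl | h0
      · rw [h.t_one, h'.t_one]
      rcases eq_or_ne r (n - 2) with rfl | h1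
      · rw [h.t_last, h'.t_last]
      rcases lt_or_ge 0 r with h2 | h2
      · obtain ⟨i, rfl⟩ : ∃ i : ℕ, r = i - 1 := ⟨(r + 1).toNat, by omega⟩
        rw [h.t i (by omega) (by omega), h'.t i (by omega) (by omega)]
      · obtain ⟨i, rfl⟩ : ∃ i : ℕ, r = 1 - i := ⟨(1 - r).toNat, by omega⟩
        rw [h.tbar i (by omega) (by omega), h'.tbar i (by omega) (by omega)]
  · have key : ∀ C : Tuple l, cnt n C r t = 0 := fun C => cnt_eq_zero fun a e _ => by
      have := res_lower hn (C a).height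
      have := res_upper hn (C a).height
      omega
    rw [key, key]

/-! ### The content of a slice -/

/-- The number `i` such that the layer is one of `s_i`, `s̄_i`, `t_i`, `t̄_i`. -/
def layerIndex (n : ℕ) (c : Layer) : ℤ :=
  match c.top with
  | .flat => if 1 ≤ res n c.height then res n c.height + 1 else 2 - res n c.height
  | .single _ => if res n c.height = 0 then 1 else n
  | .broken => if 0 ≤ res n c.height then res n c.height + 1 else 1 - res n c.height

theorem layerIndex_bounds {n : ℕ} (hn : 4 ≤ n) (c : Layer) :
    1 ≤ layerIndex n c ∧ layerIndex n c ≤ n := by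
  have h1 := res_lower hn c.height
  have h2 := res_upper hn c.height
  unfold layerIndex
  split <;> split_ifs <;> omega

/-- The coordinates read off from a tuple. -/
def readX (n : ℕ) (pat : Pattern) {l : ℕ} (C : Tuple l) (i : ℕ) : ℤ :=
  if i = 1 then cnt n C 0 (.single (sideOf n pat 0)) + cnt n C 0 .broken / 2
  else if i = n then cnt n C (n - 2) (.single (sideOf n pat (n - 1)))
  else if i = n - 1 then cnt n C (n - 2) .flat + cnt n C (n - 2) .broken / 2
  else cnt n C (i - 1) .flat + cnt n C (i - 1) .broken

/-- The barred coordinates read off from a tuple. -/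
def readY (n : ℕ) (pat : Pattern) {l : ℕ} (C : Tuple l) (i : ℕ) : ℤ :=
  if i = 1 then cnt n C 0 (.single (sideOf n pat 1)) + cnt n C 0 .broken / 2
  else if i = n then cnt n C (n - 2) (.single (sideOf n pat n))
  else if i = n - 1 then cnt n C (3 - n) .flat + cnt n C (n - 2) .broken / 2
  else cnt n C (2 - i) .flat + cnt n C (1 - i) .broken

/-- All half-depth blocks of one residue are on the same side. On the perfect crystal this is the
condition that x_n or x̄_n vanishes. -/
theorem Placed.single_zero {n l : ℕ} {C : Tuple l} {u : Fin l → ℤ} (h : Placed n C u) (r : ℤ)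
    (s : Side) : cnt n C r (.single s) = 0 ∨ cnt n C r (.single s.other) = 0 := by
  by_contra! hc
  have n1 := cnt_nonneg n C r (.single s)
  have n2 := cnt_nonneg n C r (.single s.other)
  obtain ⟨a, a1, a2⟩ := cnt_pos_iff.1 (show 0 < cnt n C r (.single s) by omega)
  obtain ⟨b, b1, b2⟩ := cnt_pos_iff.1 (show 0 < cnt n C r (.single s.other) by omega)
  exact Side.other_ne s (h.side b a _ _ b2 a2 (b1.trans a1.symm))

/-- Every layer belongs to exactly one coordinate number; this yields the total `l` required in the
perfect crystal. -/
theorem sum_layerIndex {n : ℕ} (hn : 4 ≤ n) {l : ℕ} (C : Tuple l) :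
    ∑ k : Fin n, ∑ a, (if layerIndex n (C a) = (k.val + 1 : ℕ) then (1 : ℤ) else 0) = l := by
  rw [Finset.sum_comm, Finset.sum_congr rfl (g := fun _ => (1 : ℤ))]
  · simp
  · intro a _
    obtain ⟨h1, h2⟩ := layerIndex_bounds hn (C a)
    rw [Finset.sum_eq_single ⟨(layerIndex n (C a)).toNat - 1, by omega⟩]
    · rw [if_pos]; simp only; omega
    · intro k _ hk
      rw [if_neg]
      intro e
      apply hk
      ext
      simp only
      omega
    · simp

/-- The layers of index `i` are the s_i, s̄_i, t_i and t̄_i. Where t_i and t̄_i coincide they are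
divided equally between x_i and x̄_i, which is exact because balance makes their number even. -/
theorem sum_ite_layerIndex {n : ℕ} (hn : 4 ≤ n) {l : ℕ} {C : Tuple l} (pat : Pattern)
    (hC : IsPlaceable n C) {i : ℕ} (h1 : 1 ≤ i) (h2 : i ≤ n) :
    ∑ a, (if layerIndex n (C a) = i then (1 : ℤ) else 0) = readX n pat C i + readY n pat C i := by
  obtain ⟨u, hC, hb⟩ := hC
  have ev0 := hC.two_mul_low (Or.inl rfl) hb.zero
  have evn := hC.two_mul_low (Or.inr rfl) hb.last
  have hres : ∀ a, 3 - (n : ℤ) ≤ res n (C a).height ∧ res n (C a).height ≤ n - 2 :=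
    fun a => ⟨res_lower hn _, res_upper hn _⟩
  unfold readX readY
  split_ifs with g1 g2 g3
  · subst g1
    trans cnt n C 0 (.single (sideOf n pat 0)) + cnt n C 0 (.single (sideOf n pat 1)) +
      cnt n C 0 .broken
    · simp only [cnt, ← Finset.sum_add_distrib]
      refine Finset.sum_congr rfl fun a _ => ?_
      have := hres a
      rw [sideOf_one hn]
      cases ht : (C a).top with
      | flat => simp only [layerIndex, ht]; simp; split_ifs <;> omega
      | broken => simp only [layerIndex, ht]; simp; split_ifs <;> omega
      | single s =>
        have := hC.single_res ht
        have o1 := Side.other_ne (sideOf n pat 0)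
        rcases eq_or_ne s (sideOf n pat 0) with rfl | hs
        · simp only [layerIndex, ht, Top.single.injEq, o1.symm, reduceCtorEq, and_true, and_false,
            if_false]
          split_ifs <;> omega
        · rw [Side.ne_iff] at hs
          simp only [layerIndex, ht, hs, Top.single.injEq, o1, reduceCtorEq, and_true, and_false,
            if_false]
          split_ifs <;> omega
    · omega
  · subst g2
    simp only [cnt, ← Finset.sum_add_distrib]
    refine Finset.sum_congr rfl fun a _ => ?_
    have := hres a
    rw [sideOf_last hn]
    cases ht : (C a).top with
    | flat => simp only [layerIndex, ht]; simp; split_ifs <;> omega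
    | broken => simp only [layerIndex, ht]; simp; split_ifs <;> omega
    | single s =>
      have := hC.single_res ht
      have o1 := Side.other_ne (sideOf i pat (i - 1))
      rcases eq_or_ne s (sideOf i pat (i - 1)) with rfl | hs
      · simp only [layerIndex, ht, Top.single.injEq, o1.symm, reduceCtorEq, and_true, and_false,
          if_false]
        split_ifs <;> omega
      · rw [Side.ne_iff] at hs
        simp only [layerIndex, ht, hs, Top.single.injEq, o1, reduceCtorEq, and_true, and_false,
          if_false]
        split_ifs <;> omega
  · trans cnt n C (n - 2) .flat + cnt n C (3 - n) .flat + cnt n C (n - 2) .broken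
    · simp only [cnt, ← Finset.sum_add_distrib]
      refine Finset.sum_congr rfl fun a _ => ?_
      have := hres a
      cases ht : (C a).top with
      | flat => simp only [layerIndex, ht]; simp; split_ifs <;> omega
      | broken => simp only [layerIndex, ht]; simp; split_ifs <;> omega
      | single s => simp only [layerIndex, ht]; simp; split_ifs <;> omega
    · omega
  · simp only [cnt, ← Finset.sum_add_distrib]
    refine Finset.sum_congr rfl fun a _ => ?_
    have := hres a
    cases ht : (C a).top with
    | flat => simp only [layerIndex, ht]; simp; split_ifs <;> omega
    | broken => simp only [layerIndex, ht]; simp; split_ifs <;> omega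
    | single s => simp only [layerIndex, ht]; simp; split_ifs <;> omega

/-- In a slice one of s_i, s̄_i is missing, so the pairs of halves are the minimum of x_i and x̄_i
and the remaining whole layers their difference. Hence `readX` and `readY` invert the prescription
of layers. -/
theorem exists_cont {n : ℕ} (hn : 4 ≤ n) {l : ℕ} {C : Tuple l} (pat : Pattern)
    (hC : IsSlice n C) : ∃ b, IsPerfectElt n l b ∧ Cont n pat b C := by
  rw [isSlice_iff hn] at hC
  obtain ⟨hp, hs⟩ := hC
  have hsum := fun k : Fin n => sum_ite_layerIndex hn pat hp (i := k.val + 1) (by omega) (by omega)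
  obtain ⟨u, hC, hb⟩ := hp
  have nn := cnt_nonneg n C
  have ev0 := hC.two_mul_low (Or.inl rfl) hb.zero
  have evn := hC.two_mul_low (Or.inr rfl) hb.last
  have z0 := hC.single_zero 0 (sideOf n pat 0)
  have zn := hC.single_zero (n - 2) (sideOf n pat (n - 1))
  rw [← sideOf_one hn] at z0
  rw [← sideOf_last hn] at zn
  have hx : ∀ i, 1 ≤ i → i ≤ n →
      coord (fun k : Fin n => readX n pat C (k.val + 1)) i = readX n pat C i :=
    fun i h1 h2 => coord_mk _ h1 h2
  have hy : ∀ i, 1 ≤ i → i ≤ n →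
      coord (fun k : Fin n => readY n pat C (k.val + 1)) i = readY n pat C i :=
    fun i h1 h2 => coord_mk _ h1 h2
  have x1 : readX n pat C 1 = cnt n C 0 (.single (sideOf n pat 0)) + cnt n C 0 .broken / 2 := by
    simp [readX]
  have y1 : readY n pat C 1 = cnt n C 0 (.single (sideOf n pat 1)) + cnt n C 0 .broken / 2 := by
    simp [readY]
  have xn : readX n pat C n = cnt n C (n - 2) (.single (sideOf n pat (n - 1))) := by
    rw [readX, if_neg (by omega), if_pos rfl]
  have yn : readY n pat C n = cnt n C (n - 2) (.single (sideOf n pat n)) := by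
    rw [readY, if_neg (by omega), if_pos rfl]
  have xv : readX n pat C (n - 1) = cnt n C (n - 2) .flat + cnt n C (n - 2) .broken / 2 := by
    rw [readX, if_neg (by omega), if_neg (by omega), if_pos rfl]
  have yv : readY n pat C (n - 1) = cnt n C (3 - n) .flat + cnt n C (n - 2) .broken / 2 := by
    rw [readY, if_neg (by omega), if_neg (by omega), if_pos rfl]
  have xi : ∀ i : ℕ, 2 ≤ i → i ≤ n - 2 →
      readX n pat C i = cnt n C (i - 1) .flat + cnt n C (i - 1) .broken := fun i h1 h2 => by
    rw [readX, if_neg (by omega), if_neg (by omega), if_neg (by omega)]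
  have yi : ∀ i : ℕ, 2 ≤ i → i ≤ n - 2 →
      readY n pat C i = cnt n C (2 - i) .flat + cnt n C (1 - i) .broken := fun i h1 h2 => by
    rw [readY, if_neg (by omega), if_neg (by omega), if_neg (by omega)]
  have mid : ∀ i : ℕ, 2 ≤ i → i ≤ n - 2 → cnt n C (i - 1) .broken = cnt n C (1 - i) .broken :=
    fun i h1 h2 => by
      have := hb.mid (i - 1) (by omega) (by omega)
      rwa [show -((i : ℤ) - 1) = 1 - i by ring] at this
  have ex : ∀ i : ℕ, 2 ≤ i → i ≤ n - 1 → cnt n C (i - 1) .flat = 0 ∨ cnt n C (2 - i) .flat = 0 :=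
    fun i h1 h2 => by
      have := hs (i - 1) (by omega) (by omega)
      rwa [show 1 - ((i : ℤ) - 1) = 2 - i by ring] at this
  have hX : ∀ i, 0 ≤ readX n pat C i := fun i => by
    have := nn 0 .broken; have := nn (n - 2) .broken
    have := nn 0 (.single (sideOf n pat 0)); have := nn (n - 2) (.single (sideOf n pat (n - 1)))
    have := nn (n - 2) .flat; have := nn (i - 1) .flat; have := nn (i - 1) .broken
    unfold readX; split_ifs <;> omega
  have hY : ∀ i, 0 ≤ readY n pat C i := fun i => by
    have := nn 0 .broken; have := nn (n - 2) .broken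
    have := nn 0 (.single (sideOf n pat 1)); have := nn (n - 2) (.single (sideOf n pat n))
    have := nn (3 - n) .flat; have := nn (2 - i) .flat; have := nn (1 - i) .broken
    unfold readY; split_ifs <;> omega
  refine ⟨(fun k => readX n pat C (k.val + 1), fun k => readY n pat C (k.val + 1)),
    ⟨fun k => hX _, fun k => hY _, ?_, ?_⟩, ?_⟩
  · rw [hx n (by omega) le_rfl, hy n (by omega) le_rfl, xn, yn]; exact zn
  · rw [← sum_layerIndex hn C]
    exact Finset.sum_congr rfl fun k _ => (hsum k).symm
  · have two : ((n - 1 : ℕ) : ℤ) = n - 1 := by omega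
    have exn := ex (n - 1) (by omega) le_rfl
    rw [two, show (n : ℤ) - 1 - 1 = n - 2 by ring, show 2 - ((n : ℤ) - 1) = 3 - n by ring] at exn
    have n1 := nn 0 (.single (sideOf n pat 0)); have n2 := nn 0 (.single (sideOf n pat 1))
    have n3 := nn (n - 2) .flat; have n4 := nn (3 - n) .flat
    refine ⟨fun i g1 g2 => ?_, fun i g1 g2 => ?_, ?_, ?_, ?_, ?_, ?_, ?_, fun j g1 g2 => ?_,
      fun j g1 g2 => ?_⟩
    · dsimp only
      rw [hx i (by omega) (by omega), hy i (by omega) (by omega)]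
      rcases eq_or_ne i (n - 1) with rfl | hi
      · rw [xv, yv, two, show (n : ℤ) - 1 - 1 = n - 2 by ring]; omega
      · have := ex i g1 g2; have := mid i g1 (by omega)
        have := nn (i - 1) .flat; have := nn (2 - i) .flat
        rw [xi i g1 (by omega), yi i g1 (by omega)]; omega
    · dsimp only
      rw [hx i (by omega) (by omega), hy i (by omega) (by omega)]
      rcases eq_or_ne i (n - 1) with rfl | hi
      · rw [xv, yv, two, show 2 - ((n : ℤ) - 1) = 3 - n by ring]; omega
      · have := ex i g1 g2; have := mid i g1 (by omega)
        have := nn (i - 1) .flat; have := nn (2 - i) .flat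
        rw [xi i g1 (by omega), yi i g1 (by omega)]; omega
    · dsimp only
      rw [hx 1 le_rfl (by omega), hy 1 le_rfl (by omega), x1, y1]; omega
    · dsimp only
      rw [hx 1 le_rfl (by omega), hy 1 le_rfl (by omega), x1, y1]; omega
    · dsimp only
      rw [hx n (by omega) le_rfl, xn]
    · dsimp only
      rw [hy n (by omega) le_rfl, yn]
    · dsimp only
      rw [hx 1 le_rfl (by omega), hy 1 le_rfl (by omega), x1, y1]; omega
    · dsimp only
      rw [hx (n - 1) (by omega) (by omega), hy (n - 1) (by omega) (by omega), xv, yv]; omega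
    · dsimp only
      have := ex j g1 (by omega); have := mid j g1 (by omega)
      have := nn (j - 1) .flat; have := nn (2 - j) .flat
      rw [hx j (by omega) (by omega), hy j (by omega) (by omega), xi j g1 g2, yi j g1 g2]; omega
    · dsimp only
      have := ex j g1 (by omega); have := mid j g1 (by omega)
      have := nn (j - 1) .flat; have := nn (2 - j) .flat
      rw [hx j (by omega) (by omega), hy j (by omega) (by omega), xi j g1 g2, yi j g1 g2]; omega

/-! ### Existence of slices of given content -/

/-- Sums along the sorted sequence are sums over the multiset, so occurrences of a position can be
counted without knowing where in the sequence they are. -/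
theorem exists_sorted {l : ℕ} (M : Multiset ℤ) (hM : M.card = l) :
    ∃ u : Fin l → ℤ, Monotone u ∧ (∀ a, u a ∈ M) ∧
      ∀ g : ℤ → ℤ, ∑ a, g (u a) = (M.map g).sum := by
  have hs := M.pairwise_sort (· ≤ ·)
  have he := M.sort_eq (· ≤ ·)
  generalize M.sort (· ≤ ·) = L at hs he
  subst he
  obtain rfl : L.length = l := by simpa using hM
  refine ⟨fun a => L[a], fun a b hab => ?_, fun a => by simp, fun g => ?_⟩
  · rcases hab.lt_or_eq with h | rfl
    · exact List.pairwise_iff_getElem.1 hs _ _ a.2 b.2 h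
    · rfl
  · simp

/-- The positions of the layers `s_i`. -/
def posS (n i : ℕ) : ℤ := if i = 1 then 2 else if i = n then 4 * (n - 2) + 2 else 4 * (i - 1)
/-- The positions of the layers `s̄_i`. -/
def posSbar (n i : ℕ) : ℤ := if i = 1 then 2 else if i = n then 4 * (n - 2) + 2 else 4 * (2 - i)
/-- The positions of the layers `t_i`. -/
def posT (n i : ℕ) : ℤ :=
  if i = 1 then 1 else if n - 1 ≤ i then 4 * (n - 2) + 1 else 4 * (i - 1) + 2
/-- The positions of the layers `t̄_i`. -/
def posTbar (n i : ℕ) : ℤ :=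
  if i = 1 then 3 else if n - 1 ≤ i then 4 * (n - 2) + 3 else 4 * (1 - i) + 2

/-- The positions of the layers prescribed by the coordinates of number `i`. -/
def coordPositions (n : ℕ) (b : Coords n) (i : ℕ) : Multiset ℤ :=
  Multiset.replicate (coord b.1 i - coord b.2 i).toNat (posS n i) +
  Multiset.replicate (coord b.2 i - coord b.1 i).toNat (posSbar n i) +
  Multiset.replicate (min (coord b.1 i) (coord b.2 i)).toNat (posT n i) +
  Multiset.replicate (min (coord b.1 i) (coord b.2 i)).toNat (posTbar n i)

theorem sum_map_positions {n : ℕ} (b : Coords n) (g : ℤ → ℤ) :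
    ((∑ k : Fin n, coordPositions n b (k.val + 1)).map g).sum =
    ∑ k : Fin n, ((coord b.1 (k.val + 1) - coord b.2 (k.val + 1)).toNat * g (posS n (k.val + 1)) +
      (coord b.2 (k.val + 1) - coord b.1 (k.val + 1)).toNat * g (posSbar n (k.val + 1)) +
      (min (coord b.1 (k.val + 1)) (coord b.2 (k.val + 1))).toNat * g (posT n (k.val + 1)) +
      (min (coord b.1 (k.val + 1)) (coord b.2 (k.val + 1))).toNat *
        g (posTbar n (k.val + 1))) := by
  have := map_sum (Multiset.sumAddMonoidHom.comp (Multiset.mapAddMonoidHom g))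
    (fun k : Fin n => coordPositions n b (k.val + 1)) Finset.univ
  simp only [AddMonoidHom.comp_apply, Multiset.coe_mapAddMonoidHom,
    Multiset.coe_sumAddMonoidHom] at this
  rw [this]
  refine Finset.sum_congr rfl fun k _ => ?_
  simp [coordPositions]

theorem mem_coordPositions {n : ℕ} {b : Coords n} {i : ℕ} {v : ℤ}
    (h : v ∈ coordPositions n b i) :
    v = posS n i ∨ v = posSbar n i ∨ v = posT n i ∨ v = posTbar n i := by
  simp only [coordPositions, Multiset.mem_add, Multiset.mem_replicate] at h
  tauto

/-- The normalized layer at a position, given the sides of the single half-depth blocks. -/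
def layerAt (n : ℕ) (s₀ s₁ : Side) (v : ℤ) : Layer :=
  ⟨v / 4, if v % 4 = 0 then .flat else if v % 4 = 2 ∧ v / 4 = 0 then .single s₀
    else if v % 4 = 2 ∧ v / 4 = n - 2 then .single s₁ else .broken⟩

theorem sum_eq_term {n : ℕ} (F : ℕ → ℤ) {i : ℕ} (h1 : 1 ≤ i) (h2 : i ≤ n)
    (h : ∀ j, 1 ≤ j → j ≤ n → j ≠ i → F j = 0) : ∑ k : Fin n, F (k.val + 1) = F i := by
  rw [Finset.sum_eq_single ⟨i - 1, by omega⟩]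
  · simp only; rw [Nat.sub_add_cancel h1]
  · intro k _ hk
    apply h _ (by omega) (by omega)
    rintro rfl
    exact hk (by ext; simp)
  · simp

/-- Normalized positions of the layers prescribed by `b`. -/
structure HasPositions (n : ℕ) (b : Coords n) {l : ℕ} (u : Fin l → ℤ) : Prop where
  mono : Monotone u
  range : ∀ a, 4 * (3 - (n : ℤ)) ≤ u a ∧ u a < 4 * ((n : ℤ) - 1) ∧
    (u a % 4 = 1 ∨ u a % 4 = 3 → u a / 4 = 0 ∨ u a / 4 = n - 2)
  s : ∀ i : ℕ, 2 ≤ i → i ≤ n - 1 → ∑ a, (if u a = 4 * ((i : ℤ) - 1) then (1 : ℤ) else 0) =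
    max 0 (coord b.1 i - coord b.2 i)
  sbar : ∀ i : ℕ, 2 ≤ i → i ≤ n - 1 → ∑ a, (if u a = 4 * (2 - (i : ℤ)) then (1 : ℤ) else 0) =
    max 0 (coord b.2 i - coord b.1 i)
  one : ∑ a, (if u a = 2 then (1 : ℤ) else 0) =
    max 0 (coord b.1 1 - coord b.2 1) + max 0 (coord b.2 1 - coord b.1 1)
  last : ∑ a, (if u a = 4 * (n - 2) + 2 then (1 : ℤ) else 0) =
    max 0 (coord b.1 n - coord b.2 n) + max 0 (coord b.2 n - coord b.1 n)
  t_one : ∑ a, (if u a = 1 then (1 : ℤ) else 0) = min (coord b.1 1) (coord b.2 1)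
  tbar_one : ∑ a, (if u a = 3 then (1 : ℤ) else 0) = min (coord b.1 1) (coord b.2 1)
  t_last : ∑ a, (if u a = 4 * (n - 2) + 1 then (1 : ℤ) else 0) =
    min (coord b.1 (n - 1)) (coord b.2 (n - 1))
  tbar_last : ∑ a, (if u a = 4 * (n - 2) + 3 then (1 : ℤ) else 0) =
    min (coord b.1 (n - 1)) (coord b.2 (n - 1))
  t : ∀ j : ℕ, 2 ≤ j → j ≤ n - 2 → ∑ a, (if u a = 4 * ((j : ℤ) - 1) + 2 then (1 : ℤ) else 0) =
    min (coord b.1 j) (coord b.2 j)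
  tbar : ∀ j : ℕ, 2 ≤ j → j ≤ n - 2 → ∑ a, (if u a = 4 * (1 - (j : ℤ)) + 2 then (1 : ℤ) else 0) =
    min (coord b.1 j) (coord b.2 j)

theorem exists_hasPositions {n : ℕ} (hn : 4 ≤ n) {l : ℕ} {b : Coords n}
    (hb : IsPerfectElt n l b) : ∃ u : Fin l → ℤ, HasPositions n b u := by
  have hnn := coord_nonneg hb
  set M := ∑ k : Fin n, coordPositions n b (k.val + 1) with hM
  have hcard : M.card = l := by
    have h1 := sum_map_positions b (fun _ => 1)
    rw [← hM] at h1
    simp only [Multiset.map_const', Multiset.sum_replicate, mul_one] at h1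
    have h2 : ((M.card : ℕ) : ℤ) = (l : ℤ) := by
      rw [← hb.2.2.2, ← mul_one (M.card : ℤ), ← nsmul_eq_mul, nsmul_eq_mul, mul_one]
      rw [show ((M.card : ℕ) : ℤ) = _ from by simpa using h1]
      refine Finset.sum_congr rfl fun k _ => ?_
      have := hnn (k.val + 1)
      rw [← coord_succ b.1 k, ← coord_succ b.2 k]
      omega
    exact_mod_cast h2
  obtain ⟨u, hu, hmem, hsum⟩ := exists_sorted M hcard
  have hrange : ∀ a, 4 * (3 - (n : ℤ)) ≤ u a ∧ u a < 4 * ((n : ℤ) - 1) ∧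
      (u a % 4 = 1 ∨ u a % 4 = 3 → u a / 4 = 0 ∨ u a / 4 = n - 2) := by
    intro a
    have := hmem a
    rw [hM, Multiset.mem_sum] at this
    obtain ⟨k, -, hk⟩ := this
    have h3 := k.2
    have h4 := mem_coordPositions hk
    generalize k.val = k at *
    rcases h4 with h | h | h | h
    · unfold posS at h; split_ifs at h <;> omega
    · unfold posSbar at h; split_ifs at h <;> omega
    · unfold posT at h; split_ifs at h <;> omega
    · unfold posTbar at h; split_ifs at h <;> omega
  -- At number n the formulas for `posT` and `posTbar` repeat those of n-1. No layer is placed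
  -- there, since x_n or x̄_n is zero; this is why these positions need to avoid `q` only for `j <
  -- n`.
  have count : ∀ q : ℤ → Prop, ∀ [DecidablePred q], ∀ i, 1 ≤ i → i ≤ n →
      (∀ j, 1 ≤ j → j ≤ n → j ≠ i → ¬ q (posS n j) ∧ ¬ q (posSbar n j) ∧
        (j < n → ¬ q (posT n j) ∧ ¬ q (posTbar n j))) →
      ∑ a, (if q (u a) then (1 : ℤ) else 0) =
        (if q (posS n i) then max 0 (coord b.1 i - coord b.2 i) else 0) +
        (if q (posSbar n i) then max 0 (coord b.2 i - coord b.1 i) else 0) +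
        (if q (posT n i) then min (coord b.1 i) (coord b.2 i) else 0) +
        (if q (posTbar n i) then min (coord b.1 i) (coord b.2 i) else 0) := by
    intro q _ i h1 h2 h
    rw [hsum (fun v => if q v then 1 else 0), sum_map_positions, sum_eq_term
      (fun i => (coord b.1 i - coord b.2 i).toNat * (if q (posS n i) then (1 : ℤ) else 0) +
      (coord b.2 i - coord b.1 i).toNat * (if q (posSbar n i) then (1 : ℤ) else 0) +
      (min (coord b.1 i) (coord b.2 i)).toNat * (if q (posT n i) then (1 : ℤ) else 0) +
      (min (coord b.1 i) (coord b.2 i)).toNat * (if q (posTbar n i) then (1 : ℤ) else 0)) h1 h2]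
    · have := hnn i
      simp only [mul_ite, mul_one, mul_zero]
      congr 1
      · congr 1
        · congr 1 <;> (split_ifs <;> omega)
        · split_ifs <;> omega
      · split_ifs <;> omega
    · intro j j1 j2 j3
      obtain ⟨k1, k2, k3⟩ := h j j1 j2 j3
      rw [if_neg k1, if_neg k2]
      rcases j2.lt_or_eq with hj | rfl
      · rw [if_neg (k3 hj).1, if_neg (k3 hj).2]; ring
      · have : (min (coord b.1 j) (coord b.2 j)).toNat = 0 := by
          have := hnn j
          have := hb.2.2.1
          omega
        rw [this]; simp
  refine ⟨u, hu, hrange, ?_, ?_, ?_, ?_, ?_, ?_, ?_, ?_, ?_, ?_⟩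
  · intro i g1 g2
    rw [count (fun v => v = 4 * ((i : ℤ) - 1)) i (by omega) (by omega)]
    · unfold posS posSbar posT posTbar
      split_ifs <;> omega
    · intro j j1 j2 j3
      unfold posS posSbar posT posTbar
      split_ifs <;> omega
  · intro i g1 g2
    rw [count (fun v => v = 4 * (2 - (i : ℤ))) i (by omega) (by omega)]
    · unfold posS posSbar posT posTbar
      split_ifs <;> omega
    · intro j j1 j2 j3
      unfold posS posSbar posT posTbar
      split_ifs <;> omega
  · rw [count (fun v => v = 2) 1 le_rfl (by omega)]
    · unfold posS posSbar posT posTbar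
      split_ifs <;> omega
    · intro j j1 j2 j3
      unfold posS posSbar posT posTbar
      split_ifs <;> omega
  · rw [count (fun v => v = 4 * (n - 2) + 2) n (by omega) le_rfl]
    · unfold posS posSbar posT posTbar
      split_ifs <;> omega
    · intro j j1 j2 j3
      unfold posS posSbar posT posTbar
      split_ifs <;> omega
  · rw [count (fun v => v = 1) 1 le_rfl (by omega)]
    · unfold posS posSbar posT posTbar
      split_ifs <;> omega
    · intro j j1 j2 j3
      unfold posS posSbar posT posTbar
      split_ifs <;> omega
  · rw [count (fun v => v = 3) 1 le_rfl (by omega)]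
    · unfold posS posSbar posT posTbar
      split_ifs <;> omega
    · intro j j1 j2 j3
      unfold posS posSbar posT posTbar
      split_ifs <;> omega
  · rw [count (fun v => v = 4 * (n - 2) + 1) (n - 1) (by omega) (by omega)]
    · unfold posS posSbar posT posTbar
      split_ifs <;> omega
    · intro j j1 j2 j3
      unfold posS posSbar posT posTbar
      split_ifs <;> omega
  · rw [count (fun v => v = 4 * (n - 2) + 3) (n - 1) (by omega) (by omega)]
    · unfold posS posSbar posT posTbar
      split_ifs <;> omega
    · intro j j1 j2 j3
      unfold posS posSbar posT posTbar
      split_ifs <;> omega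
  · intro i g1 g2
    rw [count (fun v => v = 4 * ((i : ℤ) - 1) + 2) i (by omega) (by omega)]
    · unfold posS posSbar posT posTbar
      split_ifs <;> omega
    · intro j j1 j2 j3
      unfold posS posSbar posT posTbar
      split_ifs <;> omega
  · intro i g1 g2
    rw [count (fun v => v = 4 * (1 - (i : ℤ)) + 2) i (by omega) (by omega)]
    · unfold posS posSbar posT posTbar
      split_ifs <;> omega
    · intro j j1 j2 j3
      unfold posS posSbar posT posTbar
      split_ifs <;> omega

/-- All positions lie within one cycle, so the window condition is automatic and residues are
heights. -/
theorem HasPositions.placed {n : ℕ} (hn : 4 ≤ n) {l : ℕ} {b : Coords n} {u : Fin l → ℤ}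
    (hp : HasPositions n b u) (s₀ s₁ : Side) : Placed n (fun a => layerAt n s₀ s₁ (u a)) u := by
  have hrange := hp.range
  have hres : ∀ a, res n (u a / 4) = u a / 4 := fun a => by
    have := hrange a
    exact res_of_mem (by omega) (by omega)
  refine ⟨fun a b hab => hp.mono hab, fun a b => ?_, fun a => ?_, fun a b s s' e1 e2 e3 => ?_⟩
  · have := hrange a; have := hrange b; omega
  · have h1 := hrange a
    have h2 := hres a
    unfold IsPos
    simp only [layerAt, h2]
    split_ifs <;> simp <;> omega
  · simp only [layerAt, hres] at e1 e2 e3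
    split_ifs at e1 e2 with g1 g2 g3 g4 g5 g6 g7 g8 <;>
      simp only [Top.single.injEq, reduceCtorEq] at e1 e2
    all_goals first
      | exact e1.symm.trans e2
      | omega

theorem HasPositions.cont {n : ℕ} (hn : 4 ≤ n) {l : ℕ} (pat : Pattern) {b : Coords n}
    (hb : IsPerfectElt n l b) {u : Fin l → ℤ} (hp : HasPositions n b u) :
    ∃ s₀ s₁, Cont n pat b (fun a => layerAt n s₀ s₁ (u a)) := by
  have hnn := coord_nonneg hb
  have hrange := hp.range
  have hres : ∀ a, res n (u a / 4) = u a / 4 := fun a => by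
    have := hrange a
    exact res_of_mem (by omega) (by omega)
  -- All half-depth blocks of a cell have to be on one side, that of the larger of x_1 and x̄_1. If
  -- these are equal there are no such blocks and the side is immaterial.
  set s₀ := if coord b.2 1 ≤ coord b.1 1 then sideOf n pat 0 else sideOf n pat 1 with hs₀
  set s₁ := if coord b.2 n = 0 then sideOf n pat (n - 1) else sideOf n pat n with hs₁
  let C : Tuple l := fun a => layerAt n s₀ s₁ (u a)
  have hcnt : ∀ (r : ℤ) (t : Top) (q : ℤ → Prop) [DecidablePred q],
      (∀ v, 4 * (3 - (n : ℤ)) ≤ v ∧ v < 4 * ((n : ℤ) - 1) ∧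
        (v % 4 = 1 ∨ v % 4 = 3 → v / 4 = 0 ∨ v / 4 = n - 2) →
        ((v / 4 = r ∧ (layerAt n s₀ s₁ v).top = t) ↔ q v)) →
      cnt n C r t = ∑ a, (if q (u a) then (1 : ℤ) else 0) := by
    intro r t q _ h
    refine Finset.sum_congr rfl fun a _ => ?_
    have := h (u a) (hrange a)
    simp only [C]
    rw [show (layerAt n s₀ s₁ (u a)).height = u a / 4 from rfl, hres]
    simp only [this]
  have hflat : ∀ r : ℤ, cnt n C r .flat = ∑ a, (if u a = 4 * r then (1 : ℤ) else 0) := by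
    intro r
    refine hcnt r _ (fun v => v = 4 * r) fun v hv => ?_
    simp only [layerAt]
    split_ifs <;> simp <;> omega
  have hsing0 : ∀ s, cnt n C 0 (.single s) =
      if s = s₀ then ∑ a, (if u a = 2 then (1 : ℤ) else 0) else 0 := by
    intro s
    split_ifs with h
    · refine hcnt 0 _ (fun v => v = 2) fun v hv => ?_
      subst h
      simp only [layerAt]
      split_ifs <;> simp <;> omega
    · rw [hcnt 0 _ (fun _ => False)]
      · simp
      · intro v hv
        simp only [layerAt]
        have : s₀ ≠ s := fun e => h e.symm
        split_ifs <;> simp [this] <;> omega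
  have hsing1 : ∀ s, cnt n C (n - 2) (.single s) =
      if s = s₁ then ∑ a, (if u a = 4 * (n - 2) + 2 then (1 : ℤ) else 0) else 0 := by
    intro s
    split_ifs with h
    · refine hcnt _ _ (fun v => v = 4 * (n - 2) + 2) fun v hv => ?_
      subst h
      simp only [layerAt]
      split_ifs <;> simp <;> omega
    · rw [hcnt _ _ (fun _ => False)]
      · simp
      · intro v hv
        simp only [layerAt]
        have : s₁ ≠ s := fun e => h e.symm
        split_ifs <;> simp [this] <;> omega
  have hbr0 : cnt n C 0 .broken = ∑ a, (if u a = 1 ∨ u a = 3 then (1 : ℤ) else 0) := by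
    refine hcnt 0 _ (fun v => v = 1 ∨ v = 3) fun v hv => ?_
    simp only [layerAt]
    split_ifs <;> simp <;> omega
  have hbr1 : cnt n C (n - 2) .broken =
      ∑ a, (if u a = 4 * (n - 2) + 1 ∨ u a = 4 * (n - 2) + 3 then (1 : ℤ) else 0) := by
    refine hcnt _ _ (fun v => v = 4 * (n - 2) + 1 ∨ v = 4 * (n - 2) + 3) fun v hv => ?_
    simp only [layerAt]
    split_ifs <;> simp <;> omega
  have hbr : ∀ r : ℤ, r ≠ 0 → r ≠ n - 2 → cnt n C r .broken =
      ∑ a, (if u a = 4 * r + 2 then (1 : ℤ) else 0) := by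
    intro r h0 h1
    refine hcnt _ _ (fun v => v = 4 * r + 2) fun v hv => ?_
    simp only [layerAt]
    split_ifs <;> simp <;> omega
  have side0 : sideOf n pat 0 ≠ sideOf n pat 1 := by
    rw [sideOf_one hn]; exact (Side.other_ne _).symm
  have side1 : sideOf n pat (n - 1) ≠ sideOf n pat n := by
    rw [sideOf_last hn]; exact (Side.other_ne _).symm
  refine ⟨s₀, s₁, ?_⟩
  change Cont n pat b C
  refine ⟨fun i g1 g2 => ?_, fun i g1 g2 => ?_, ?_, ?_, ?_, ?_, ?_, ?_, fun j g1 g2 => ?_,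
    fun j g1 g2 => ?_⟩
  · rw [hflat]; exact hp.s i g1 g2
  · rw [hflat]; exact hp.sbar i g1 g2
  · rw [hsing0, hp.one, hs₀]
    by_cases h : coord b.2 1 ≤ coord b.1 1
    · rw [if_pos h, if_pos rfl]; omega
    · rw [if_neg h, if_neg side0]; omega
  · rw [hsing0, hp.one, hs₀]
    by_cases h : coord b.2 1 ≤ coord b.1 1
    · rw [if_pos h, if_neg side0.symm]; omega
    · rw [if_neg h, if_pos rfl]; omega
  · have := hnn n; have := hb.2.2.1
    rw [hsing1, hp.last, hs₁]
    by_cases h : coord b.2 n = 0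
    · rw [if_pos h, if_pos rfl]; omega
    · rw [if_neg h, if_neg side1]; omega
  · have := hnn n; have := hb.2.2.1
    rw [hsing1, hp.last, hs₁]
    by_cases h : coord b.2 n = 0
    · rw [if_pos h, if_neg side1.symm]; omega
    · rw [if_neg h, if_pos rfl]; omega
  · rw [hbr0, two_mul]
    nth_rewrite 1 [← hp.t_one]
    rw [← hp.tbar_one, ← Finset.sum_add_distrib]
    refine Finset.sum_congr rfl fun a _ => ?_
    split_ifs <;> omega
  · rw [hbr1, two_mul]
    nth_rewrite 1 [← hp.t_last]
    rw [← hp.tbar_last, ← Finset.sum_add_distrib]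
    refine Finset.sum_congr rfl fun a _ => ?_
    split_ifs <;> omega
  · rw [hbr _ (by omega) (by omega)]; exact hp.t j g1 g2
  · rw [hbr _ (by omega) (by omega)]; exact hp.tbar j g1 g2

theorem HasPositions.balanced {n : ℕ} (hn : 4 ≤ n) {l : ℕ} {pat : Pattern} {b : Coords n}
    {u : Fin l → ℤ} (hp : HasPositions n b u) {C : Tuple l} (hcont : Cont n pat b C) :
    Balanced n C u := by
  have hrange := hp.range
  have hres : ∀ a, res n (u a / 4) = u a / 4 := fun a => by
    have := hrange a
    exact res_of_mem (by omega) (by omega)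
  refine ⟨?_, ?_, fun r r1 r2 => ?_⟩
  · trans ∑ a, ((if u a = 1 then (1 : ℤ) else 0) - (if u a = 3 then (1 : ℤ) else 0))
    · refine Finset.sum_congr rfl fun a _ => ?_
      have h1 := hrange a
      rw [balTerm, hres]
      split_ifs <;> omega
    · rw [Finset.sum_sub_distrib, hp.t_one, hp.tbar_one, sub_self]
  · trans ∑ a, ((if u a = 4 * (n - 2) + 1 then (1 : ℤ) else 0) -
      (if u a = 4 * (n - 2) + 3 then (1 : ℤ) else 0))
    · refine Finset.sum_congr rfl fun a _ => ?_
      have h1 := hrange a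
      rw [balTerm, hres]
      split_ifs <;> omega
    · rw [Finset.sum_sub_distrib, hp.t_last, hp.tbar_last, sub_self]
  · obtain ⟨j, rfl⟩ : ∃ j : ℕ, r = j - 1 := ⟨(r + 1).toNat, by omega⟩
    rw [show -((j : ℤ) - 1) = 1 - j by ring, hcont.t j (by omega) (by omega),
      hcont.tbar j (by omega) (by omega)]

/-- The prescribed layers are sorted by position within one cycle. The numbers of s_i and s̄_i are
positive parts of opposite numbers, so one of them is zero and nothing can be split further. -/
theorem exists_slice {n : ℕ} (hn : 4 ≤ n) {l : ℕ} (pat : Pattern) {b : Coords n}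
    (hb : IsPerfectElt n l b) : ∃ C : Tuple l, IsSlice n C ∧ Cont n pat b C := by
  obtain ⟨u, hp⟩ := exists_hasPositions hn hb
  obtain ⟨s₀, s₁, hcont⟩ := hp.cont hn pat hb
  refine ⟨_, (isSlice_iff hn).2 ⟨⟨u, hp.placed hn s₀ s₁, hp.balanced hn hcont⟩,
    fun r r1 r2 => ?_⟩, hcont⟩
  obtain ⟨j, rfl⟩ : ∃ j : ℕ, r = j - 1 := ⟨(r + 1).toNat, by omega⟩
  rw [show 1 - ((j : ℤ) - 1) = 2 - j by ring, hcont.s j (by omega) (by omega),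
      hcont.sbar j (by omega) (by omega)]
  omega

/-! ### The perfect crystal -/

theorem coord_unit_self {n i : ℕ} (h1 : 1 ≤ i) (h2 : i ≤ n) : coord (unit n i) i = 1 := by
  rw [coord_unit, if_pos ⟨rfl, h1, h2⟩]

theorem coord_unit_ne {n i j : ℕ} (h : i ≠ j) : coord (unit n j) i = 0 := by
  rw [coord_unit, if_neg fun e => h e.1]

theorem sum_unit {n i : ℕ} (h1 : 1 ≤ i) (h2 : i ≤ n) : ∑ k, unit n i k = 1 := by
  have := sum_eq_term (n := n) (fun j => if j = i then (1 : ℤ) else 0) h1 h2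
    (fun j _ _ hj => if_neg hj)
  simpa [unit] using this

theorem isPerfectElt_iff {n l : ℕ} {b : Coords n} : IsPerfectElt n l b ↔
    (∀ i, 0 ≤ coord b.1 i) ∧ (∀ i, 0 ≤ coord b.2 i) ∧ (coord b.1 n = 0 ∨ coord b.2 n = 0) ∧
      ∑ k, b.1 k + ∑ k, b.2 k = (l : ℤ) := by
  rw [← Finset.sum_add_distrib]
  constructor
  · intro h
    exact ⟨fun i => (coord_nonneg h i).1, fun i => (coord_nonneg h i).2, h.2.2⟩
  · rintro ⟨h1, h2, h3⟩
    refine ⟨fun k => ?_, fun k => ?_, h3⟩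
    · rw [← coord_succ b.1 k]; exact h1 _
    · rw [← coord_succ b.2 k]; exact h2 _

theorem coord_sub_unit_nonneg {n j : ℕ} {v : Fin n → ℤ} (h : ∀ i, 0 ≤ coord v i)
    (hj : 1 ≤ coord v j) (i : ℕ) : 0 ≤ coord (v - unit n j) i := by
  have := h i
  rw [coord_sub, coord_unit]
  split_ifs with e
  · rw [e.1]; omega
  · omega

theorem coord_add_unit_nonneg {n j : ℕ} {v : Fin n → ℤ} (h : ∀ i, 0 ≤ coord v i) (i : ℕ) :
    0 ≤ coord (v + unit n j) i := by
  have := h i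
  rw [coord_add, coord_unit]
  split_ifs <;> omega

/-- Interchange of the barred and the unbarred coordinates. -/
def swapCoords {n : ℕ} (b : Coords n) : Coords n := (b.2, b.1)

theorem swapCoords_isPerfectElt {n l : ℕ} {b : Coords n} :
    IsPerfectElt n l (swapCoords b) ↔ IsPerfectElt n l b := by
  simp only [isPerfectElt_iff, swapCoords]
  rw [add_comm, or_comm]
  tauto

/-- Exchanging barred and unbarred coordinates conjugates ẽ_i into f̃_i, so only f̃_i has to be
studied. Nonnegativity enters for n-1 and n, where one operator tests for being 0 and the other for
being at least 1. -/
theorem eRaw_eq {n : ℕ} (i : ℕ) {b : Coords n} (h1 : 0 ≤ coord b.1 n) (h2 : 0 ≤ coord b.2 n) :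
    eRaw n i b = swapCoords (fRaw n i (swapCoords b)) := by
  have h3 : coord b.2 n = 0 ↔ ¬ 1 ≤ coord b.2 n := by omega
  simp only [eRaw, fRaw, swapCoords, h3]
  split_ifs <;> first
    | rfl
    | omega
    | (simp only [*, if_true, if_false, Prod.mk.injEq, and_true, true_and, not_false_eq_true]
       try abel)

theorem epsPerfect_eq (n i : ℕ) (b : Coords n) :
    epsPerfect n i b = phiPerfect n i (swapCoords b) := rfl

/-- One coordinate drops by one and one rises, so the total is kept, and the tests prevent x_n and
x̄_n from both becoming positive. The only obstruction is the coordinate that drops: it is positive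
exactly when φ_i is. -/
theorem fRaw_isPerfectElt_iff {n l : ℕ} (hn : 4 ≤ n) {i : ℕ} (hi : i ≤ n) {b : Coords n}
    (hb : IsPerfectElt n l b) : IsPerfectElt n l (fRaw n i b) ↔ 0 < phiPerfect n i b := by
  rw [isPerfectElt_iff] at hb ⊢
  obtain ⟨hx, hy, hlast, hsum⟩ := hb
  have hxn := hx n
  have hyn := hy n
  simp only [fRaw, phiPerfect]
  split_ifs with h0 h1 h1 h2 h2 h2 h3
  · constructor
    · intro h
      have := h.2.1 1
      simp (disch := omega) only [coord_sub, coord_unit_self] at this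
      omega
    · intro h
      refine ⟨coord_add_unit_nonneg hx, coord_sub_unit_nonneg hy (by omega), ?_, ?_⟩
      · simp (disch := omega) only [coord_add, coord_sub, coord_unit_ne]; omega
      · simp (disch := omega) only [Pi.add_apply, Pi.sub_apply, Finset.sum_add_distrib,
          Finset.sum_sub_distrib, sum_unit]; omega
  · constructor
    · intro h
      have := hx 1; have := hy 1; omega
    · intro h
      have := hx 2
      refine ⟨coord_add_unit_nonneg hx, coord_sub_unit_nonneg hy (by omega), ?_, ?_⟩
      · simp (disch := omega) only [coord_add, coord_sub, coord_unit_ne]; omega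
      · simp (disch := omega) only [Pi.add_apply, Pi.sub_apply, Finset.sum_add_distrib,
          Finset.sum_sub_distrib, sum_unit]; omega
  · constructor
    · intro h
      have := h.1 i
      simp (disch := omega) only [coord_add, coord_sub, coord_unit_self, coord_unit_ne] at this
      omega
    · intro h
      refine ⟨coord_add_unit_nonneg (coord_sub_unit_nonneg hx (by omega)), hy, ?_, ?_⟩
      · simp (disch := omega) only [coord_add, coord_sub, coord_unit_ne]; omega
      · simp (disch := omega) only [Pi.add_apply, Pi.sub_apply, Finset.sum_add_distrib,
          Finset.sum_sub_distrib, sum_unit]; omega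
  · constructor
    · intro h
      have := hx i; omega
    · intro h
      have := hx (i + 1)
      refine ⟨hx, coord_add_unit_nonneg (coord_sub_unit_nonneg hy (by omega)), ?_, ?_⟩
      · simp (disch := omega) only [coord_add, coord_sub, coord_unit_ne]; omega
      · simp (disch := omega) only [Pi.add_apply, Pi.sub_apply, Finset.sum_add_distrib,
          Finset.sum_sub_distrib, sum_unit]; omega
  · constructor
    · intro h
      have := h.1 (n - 1)
      simp (disch := omega) only [coord_add, coord_sub, coord_unit_self, coord_unit_ne] at this
      omega
    · intro h
      refine ⟨coord_add_unit_nonneg (coord_sub_unit_nonneg hx (by omega)), hy, ?_, ?_⟩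
      · simp (disch := omega) only [coord_add, coord_sub, coord_unit_ne]; omega
      · simp (disch := omega) only [Pi.add_apply, Pi.sub_apply, Finset.sum_add_distrib,
          Finset.sum_sub_distrib, sum_unit]; omega
  · constructor
    · intro h
      have := hx (n - 1); omega
    · intro h
      refine ⟨hx, coord_add_unit_nonneg (coord_sub_unit_nonneg hy (by omega)), ?_, ?_⟩
      · simp (disch := omega) only [coord_add, coord_sub, coord_unit_ne]; omega
      · simp (disch := omega) only [Pi.add_apply, Pi.sub_apply, Finset.sum_add_distrib,
          Finset.sum_sub_distrib, sum_unit]; omega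
  · constructor
    · intro h
      have := hx (n - 1); omega
    · intro h
      refine ⟨coord_sub_unit_nonneg hx (by omega), coord_add_unit_nonneg hy, ?_, ?_⟩
      · simp (disch := omega) only [coord_add, coord_sub, coord_unit_ne]; omega
      · simp (disch := omega) only [Pi.add_apply, Pi.sub_apply, Finset.sum_add_distrib,
          Finset.sum_sub_distrib, sum_unit]; omega
  · constructor
    · intro h
      have := h.1 (n - 1)
      simp (disch := omega) only [coord_add, coord_sub, coord_unit_self, coord_unit_ne] at this
      omega
    · intro h
      refine ⟨coord_sub_unit_nonneg hx (by omega), coord_add_unit_nonneg hy, ?_, ?_⟩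
      · simp (disch := omega) only [coord_add, coord_sub, coord_unit_ne]; omega
      · simp (disch := omega) only [Pi.add_apply, Pi.sub_apply, Finset.sum_add_distrib,
          Finset.sum_sub_distrib, sum_unit]; omega

theorem phi_eps_fRaw {n l : ℕ} (hn : 4 ≤ n) {i : ℕ} (hi : i ≤ n) {b : Coords n}
    (hb : IsPerfectElt n l b) :
    phiPerfect n i (fRaw n i b) = phiPerfect n i b - 1 ∧
    epsPerfect n i (fRaw n i b) = epsPerfect n i b + 1 := by
  simp only [fRaw, phiPerfect, epsPerfect]
  have := coord_nonneg hb n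
  have := hb.2.2.1
  have hcases : i = 0 ∨ (1 ≤ i ∧ i ≤ n - 2) ∨ i = n - 1 ∨ i = n := by omega
  rcases hcases with h | h | h | h
  · simp only [if_pos h]
    split_ifs <;>
      simp (disch := omega) only [coord_add, coord_sub, coord_unit_self, coord_unit_ne] <;> omega
  · have h0 : i ≠ 0 := by omega
    simp only [if_pos h.2, if_neg h0]
    split_ifs <;>
      simp (disch := omega) only [coord_add, coord_sub, coord_unit_self, coord_unit_ne] <;> omega
  · have h0 : i ≠ 0 := by omega
    have h1 : ¬ i ≤ n - 2 := by omega
    simp only [if_neg h0, if_neg h1, if_pos h]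
    split_ifs <;>
      simp (disch := omega) only [coord_add, coord_sub, coord_unit_self, coord_unit_ne] <;> omega
  · have h0 : i ≠ 0 := by omega
    have h1 : ¬ i ≤ n - 2 := by omega
    have h2 : i ≠ n - 1 := by omega
    simp only [if_neg h0, if_neg h1, if_neg h2]
    split_ifs <;>
      simp (disch := omega) only [coord_add, coord_sub, coord_unit_self, coord_unit_ne] <;> omega

/-- The test in ẽ_i recognizes the branch that f̃_i took: a weak inequality becomes strict by the
change, and a strict one becomes weak. For n-1 and n one uses that x_n or x̄_n vanishes. -/
theorem eRaw_fRaw {n l : ℕ} (hn : 4 ≤ n) {i : ℕ} (hi : i ≤ n) {b : Coords n}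
    (hb : IsPerfectElt n l b) : eRaw n i (fRaw n i b) = b := by
  have h1 := coord_nonneg hb n
  have h2 := hb.2.2.1
  have h3 := coord_nonneg hb
  obtain ⟨x, y⟩ := b
  have hcases : i = 0 ∨ (1 ≤ i ∧ i ≤ n - 2) ∨ i = n - 1 ∨ i = n := by omega
  simp only [fRaw, eRaw]
  simp only at h1 h2 h3
  rcases hcases with h | h | h | h
  · simp only [if_pos h]
    split_ifs with g1 g2 g2 <;>
      simp (disch := omega) only [coord_add, coord_sub, coord_unit_self, coord_unit_ne] at g2 <;>
      first
      | omega
      | simp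
  · have h0 : i ≠ 0 := by omega
    simp only [if_pos h.2, if_neg h0]
    split_ifs with g1 g2 g2 <;>
      simp (disch := omega) only [coord_add, coord_sub, coord_unit_self, coord_unit_ne] at g2 <;>
      first
      | omega
      | (simp only [Prod.mk.injEq, and_true, true_and]; abel)
  · have h0 : i ≠ 0 := by omega
    have h1 : ¬ i ≤ n - 2 := by omega
    simp only [if_neg h0, if_neg h1, if_pos h]
    split_ifs with g1 g2 g2 <;>
      simp (disch := omega) only [coord_add, coord_sub, coord_unit_self, coord_unit_ne] at g2 <;>
      first
      | omega
      | (simp only [Prod.mk.injEq, and_true, true_and]; abel)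
  · have h0 : i ≠ 0 := by omega
    have h1 : ¬ i ≤ n - 2 := by omega
    have h2 : i ≠ n - 1 := by omega
    simp only [if_neg h0, if_neg h1, if_neg h2]
    split_ifs with g1 g2 g2 <;>
      simp (disch := omega) only [coord_add, coord_sub, coord_unit_self, coord_unit_ne] at g2 <;>
      first
      | omega
      | simp

theorem fRaw_eRaw {n l : ℕ} (hn : 4 ≤ n) {i : ℕ} (hi : i ≤ n) {b : Coords n}
    (hb : IsPerfectElt n l b) (hb' : IsPerfectElt n l (eRaw n i b)) :
    fRaw n i (eRaw n i b) = b := by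
  have e := eRaw_eq i (coord_nonneg hb n).1 (coord_nonneg hb n).2
  have h := eRaw_fRaw hn hi (swapCoords_isPerfectElt.2 hb)
  rw [e] at hb' ⊢
  have hb'' := swapCoords_isPerfectElt.1 hb'
  rw [eRaw_eq i (coord_nonneg hb'' n).1 (coord_nonneg hb'' n).2] at h
  exact congrArg swapCoords h

/-! ### Weights in the perfect crystal -/

/-- The weight pairing in terms of the differences `x_i - x̄_i`. -/
def weightOf (n : ℕ) (z : Fin n → ℤ) (j : ℕ) : ℤ :=
  if j = 0 then - coord z 1 - coord z 2
  else if j ≤ n - 1 then coord z j - coord z (j + 1) else coord z (n - 1) + coord z n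

/-- As max(0,t) - max(0,-t) = t, the weight is linear in the differences x_i - x̄_i. -/
theorem phi_sub_eps {n : ℕ} (hn : 4 ≤ n) {j : ℕ} (hj : j ≤ n) (b : Coords n) :
    phiPerfect n j b - epsPerfect n j b = weightOf n (b.1 - b.2) j := by
  have hcases : j = 0 ∨ (1 ≤ j ∧ j ≤ n - 2) ∨ j = n - 1 ∨ j = n := by omega
  simp only [phiPerfect, epsPerfect, weightOf, coord_sub]
  rcases hcases with h | h | h | h
  · subst h; simp only [if_true]; omega
  · have h0 : j ≠ 0 := by omega
    have h1 : j ≤ n - 1 := by omega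
    simp only [if_neg h0, if_pos h.2, if_pos h1]; omega
  · have h0 : j ≠ 0 := by omega
    have h1 : ¬ j ≤ n - 2 := by omega
    have h2 : j ≤ n - 1 := by omega
    have h3 : n - 1 + 1 = n := by omega
    simp only [if_neg h0, if_neg h1, if_pos h2, if_pos h]
    rw [h, h3]; omega
  · have h0 : j ≠ 0 := by omega
    have h1 : ¬ j ≤ n - 2 := by omega
    have h2 : ¬ j ≤ n - 1 := by omega
    have h3 : j ≠ n - 1 := by omega
    simp only [if_neg h0, if_neg h1, if_neg h2, if_neg h3]; omega

/-- The change of the differences `x_i - x̄_i` under `f̃_i`. -/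
def fShift (n i : ℕ) : Fin n → ℤ :=
  if i = 0 then unit n 1 + unit n 2
  else if i ≤ n - 1 then unit n (i + 1) - unit n i else - unit n (n - 1) - unit n n

theorem fRaw_sub {n : ℕ} (hn : 4 ≤ n) {i : ℕ} (b : Coords n) :
    (fRaw n i b).1 - (fRaw n i b).2 = b.1 - b.2 + fShift n i := by
  simp only [fRaw, fShift]
  by_cases h0 : i = 0
  · simp only [if_pos h0]; split_ifs <;> (simp only; abel)
  by_cases h1 : i ≤ n - 2
  · have : i ≤ n - 1 := by omega
    simp only [if_neg h0, if_pos h1, if_pos this]; split_ifs <;> (simp only; abel)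
  by_cases h2 : i = n - 1
  · have h3 : i ≤ n - 1 := by omega
    have h4 : n - 1 + 1 = n := by omega
    simp only [if_neg h0, if_neg h1, if_pos h2, if_pos h3]
    rw [h2, h4]
    split_ifs <;> (simp only; abel)
  · have h3 : ¬ i ≤ n - 1 := by omega
    simp only [if_neg h0, if_neg h1, if_neg h2, if_neg h3]
    split_ifs <;> (simp only; abel)

theorem weightOf_add (n : ℕ) (z w : Fin n → ℤ) (j : ℕ) :
    weightOf n (z + w) j = weightOf n z j + weightOf n w j := by
  simp only [weightOf, coord_add]; split_ifs <;> ring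

theorem coord_neg {n : ℕ} (v : Fin n → ℤ) (i : ℕ) : coord (-v) i = - coord v i := by
  unfold coord; split_ifs <;> simp

theorem coord_unit' {n i : ℕ} (j : ℕ) (h1 : 1 ≤ i) (h2 : i ≤ n) :
    coord (unit n j) i = if i = j then 1 else 0 := by
  rw [coord_unit]; simp [h1, h2]

theorem cartan_cases (n : ℕ) (j i : Fin (n + 1)) :
    (j.val = i.val ∧ cartan n j i = 2) ∨
    (j.val ≠ i.val ∧ (edge n j i ∨ edge n i j) ∧ cartan n j i = -1) ∨
    (j.val ≠ i.val ∧ ¬ edge n j i ∧ ¬ edge n i j ∧ cartan n j i = 0) := by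
  unfold cartan
  by_cases h : j = i
  · left; simp [h]
  · have h' : j.val ≠ i.val := fun e => h (Fin.ext e)
    by_cases h2 : edge n j i ∨ edge n i j
    · right; left; exact ⟨h', h2, by rw [if_neg h, if_pos h2]⟩
    · right; right
      exact ⟨h', fun e => h2 (Or.inl e), fun e => h2 (Or.inr e), by rw [if_neg h, if_neg h2]⟩

/-- Let α_i = ε_i - ε_{i+1} for 1 ≤ i ≤ n-1, α_n = ε_{n-1} + ε_n and α_0 = -ε_1 - ε_2. Then `fShift
n i` is -α_i and `weightOf` pairs with h_j, so the Cartan matrix appears. -/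
theorem weightOf_fShift {n : ℕ} (hn : 4 ≤ n) (i j : Fin (n + 1)) :
    weightOf n (fShift n i) j = - cartan n j i := by
  have hc := cartan_cases n j i
  generalize cartan n j i = c at hc
  obtain ⟨i, hi⟩ := i
  obtain ⟨j, hj⟩ := j
  simp only at hc ⊢
  have hi' : i = 0 ∨ (1 ≤ i ∧ i ≤ n - 1) ∨ i = n := by omega
  have hj' : j = 0 ∨ (1 ≤ j ∧ j ≤ n - 1) ∨ j = n := by omega
  have hW : weightOf n (fShift n i) j = if j = 0 then - coord (fShift n i) 1 - coord (fShift n i) 2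
    else if j ≤ n - 1 then coord (fShift n i) j - coord (fShift n i) (j + 1)
    else coord (fShift n i) (n - 1) + coord (fShift n i) n := rfl
  rw [hW]
  unfold edge at hc
  have hF : ∀ k, 1 ≤ k → k ≤ n → coord (fShift n i) k = if i = 0 then
      (if k = 1 ∨ k = 2 then 1 else 0) else if i ≤ n - 1 then
      (if k = i + 1 then 1 else if k = i then -1 else 0)
      else (if k = n - 1 ∨ k = n then -1 else 0) := by
    intro k h1 h2
    unfold fShift
    rcases hi' with h | h | h
    · simp only [if_pos h]
      simp (disch := omega) only [coord_add, coord_unit']; split_ifs <;> omega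
    · have h0 : i ≠ 0 := by omega
      simp only [if_neg h0, if_pos h.2]
      simp (disch := omega) only [coord_sub, coord_unit']; split_ifs <;> omega
    · have h0 : i ≠ 0 := by omega
      have h1 : ¬ i ≤ n - 1 := by omega
      simp only [if_neg h0, if_neg h1]
      simp (disch := omega) only [coord_sub, coord_neg, coord_unit']; split_ifs <;> omega
  rcases hj' with g | g | g
  · have e1 := hF 1 (by omega) (by omega)
    have e2 := hF 2 (by omega) (by omega)
    rw [if_pos g]
    rcases hi' with h | h | h
    · rw [if_pos h] at e1 e2; omega
    · rw [if_neg (by omega), if_pos h.2] at e1 e2; omega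
    · rw [if_neg (by omega), if_neg (by omega)] at e1 e2; omega
  · have e1 := hF j (by omega) (by omega)
    have e2 := hF (j + 1) (by omega) (by omega)
    rw [if_neg (by omega), if_pos g.2]
    rcases hi' with h | h | h
    · rw [if_pos h] at e1 e2; omega
    · rw [if_neg (by omega), if_pos h.2] at e1 e2; omega
    · rw [if_neg (by omega), if_neg (by omega)] at e1 e2; omega
  · have e1 := hF (n - 1) (by omega) (by omega)
    have e2 := hF n (by omega) (by omega)
    rw [if_neg (by omega), if_neg (by omega)]
    rcases hi' with h | h | h
    · rw [if_pos h] at e1 e2; omega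
    · rw [if_neg (by omega), if_pos h.2] at e1 e2; omega
    · rw [if_neg (by omega), if_neg (by omega)] at e1 e2; omega

theorem wt_fRaw {n : ℕ} (hn : 4 ≤ n) (i j : Fin (n + 1)) (b : Coords n) :
    phiPerfect n j (fRaw n i b) - epsPerfect n j (fRaw n i b) =
      phiPerfect n j b - epsPerfect n j b - cartan n j i := by
  rw [phi_sub_eps hn (by omega), phi_sub_eps hn (by omega), fRaw_sub hn, weightOf_add,
    weightOf_fShift hn]
  ring

theorem toPerfect_eq_some {n l : ℕ} {b : Coords n} {b' : Perfect n l} :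
    toPerfect n l b = some b' ↔ b = b'.1 := by
  unfold toPerfect
  split_ifs with h
  · constructor
    · intro e; rw [← Option.some.inj e]
    · intro e; exact congrArg some (Subtype.ext e)
  · refine ⟨fun e => absurd e (by simp), ?_⟩
    rintro rfl
    exact absurd b'.2 h

theorem perfect_f_iff_e {n l : ℕ} (hn : 4 ≤ n) (i : Fin (n + 1)) (b b' : Perfect n l) :
    (perfectCrystal n l).f i b = some b' ↔ (perfectCrystal n l).e i b' = some b := by
  simp only [perfectCrystal, toPerfect_eq_some]
  constructor
  · intro h
    rw [← h, eRaw_fRaw hn (by omega) b.2]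
  · intro h
    rw [← h, fRaw_eRaw hn (by omega) b'.2 (by rw [h]; exact b.2)]

theorem perfect_wt_f {n l : ℕ} (hn : 4 ≤ n) (i : Fin (n + 1)) (b b' : Perfect n l)
    (h : (perfectCrystal n l).f i b = some b') :
    (perfectCrystal n l).wt b' = (perfectCrystal n l).wt b - simpleRoot n i := by
  simp only [perfectCrystal, toPerfect_eq_some] at h ⊢
  funext j
  rw [← h]
  exact wt_fRaw hn i j b.1

theorem perfect_phi_f {n l : ℕ} (hn : 4 ≤ n) (i : Fin (n + 1)) (b b' : Perfect n l)
    (h : (perfectCrystal n l).f i b = some b') :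
    phiPerfect n i b'.1 = phiPerfect n i b.1 - 1 ∧ epsPerfect n i b'.1 = epsPerfect n i b.1 + 1 := by
  simp only [perfectCrystal, toPerfect_eq_some] at h
  rw [← h]
  exact phi_eps_fRaw hn (by omega) b.2

theorem isCrystal_perfectCrystal {n l : ℕ} (hn : 4 ≤ n) : IsCrystal (perfectCrystal n l) where
  phi_eq i b := by
    simp only [perfectCrystal]; norm_cast; ring
  wt_e i b b' h := by
    have := perfect_wt_f hn i b' b ((perfect_f_iff_e hn i b' b).2 h)
    rw [this]; simp
  wt_f i b b' h := perfect_wt_f hn i b b' h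
  eps_e i b b' h := by
    have := (perfect_phi_f hn i b' b ((perfect_f_iff_e hn i b' b).2 h)).2
    simp only [perfectCrystal]; rw [this]; norm_cast
  phi_e i b b' h := by
    have := (perfect_phi_f hn i b' b ((perfect_f_iff_e hn i b' b).2 h)).1
    simp only [perfectCrystal]; rw [this]; norm_cast; ring
  eps_f i b b' h := by
    have := (perfect_phi_f hn i b b' h).2
    simp only [perfectCrystal]; rw [this]; norm_cast
  phi_f i b b' h := by
    have := (perfect_phi_f hn i b b' h).1
    simp only [perfectCrystal]; rw [this]; norm_cast; ring
  f_iff_e := perfect_f_iff_e hn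
  bot i b h := by simp [perfectCrystal] at h

/-! ### The operators of index `2 ≤ i ≤ n - 2` -/

/-- A content prescribes at most one of s_i and s̄_i, so a placeable tuple that has a content admits
no further splitting. -/
theorem IsPlaceable.isSlice {n l : ℕ} (hn : 4 ≤ n) {pat : Pattern} {b : Coords n} {C : Tuple l}
    (hC : IsPlaceable n C) (h : Cont n pat b C) : IsSlice n C := by
  refine (isSlice_iff hn).2 ⟨hC, fun r h1 h2 => ?_⟩
  obtain ⟨i, rfl⟩ : ∃ i : ℕ, r = i - 1 := ⟨(r + 1).toNat, by omega⟩
  have e1 := h.s i (by omega) (by omega)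
  have e2 := h.sbar i (by omega) (by omega)
  rw [show (1 : ℤ) - (i - 1) = 2 - i by ring]
  omega

/-- `IsPlaceable` without the condition on the halves of unit blocks. -/
def EndPlaceable (n : ℕ) {l : ℕ} (C : Tuple l) : Prop :=
  ∃ u, Placed n C u ∧ ∀ r : ℤ, r = 0 ∨ r = n - 2 → ∑ a, balTerm n r (u a) = 0

/-- A single half of a unit block upsets the balance of its label until the second half has been
handled, whereas order and the balance at the two ends survive every intermediate step. The two
parts of the invariant are therefore separated. -/
theorem isPlaceable_iff_end {n l : ℕ} {C : Tuple l} : IsPlaceable n C ↔ EndPlaceable n C ∧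
    ∀ r : ℤ, 1 ≤ r → r ≤ n - 3 → cnt n C r .broken = cnt n C (-r) .broken := by
  constructor
  · rintro ⟨u, h1, h2⟩
    refine ⟨⟨u, h1, ?_⟩, h2.mid⟩
    rintro r (rfl | rfl)
    exacts [h2.zero, h2.last]
  · rintro ⟨⟨u, h1, h2⟩, h3⟩
    exact ⟨u, h1, h2 0 (Or.inl rfl), h2 _ (Or.inr rfl), h3⟩

theorem rho_mid_ne {n i : ℕ} (h1 : 2 ≤ i) (h2 : i ≤ n - 2) (k : Kind) :
    ¬ (rho n k i = 0 ∨ rho n k i = n - 2) := by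
  cases k <;> simp only [rho] <;> (try split_ifs) <;> omega

theorem EndPlaceable.addHalf {n l i : ℕ} (hn : 4 ≤ n) (h1 : 2 ≤ i) (h2 : i ≤ n - 2) {C : Tuple l}
    (hC : EndPlaceable n C) {k : Kind} {a : Fin l} (ha : RearLowest (HasWholeSlot n k i) C a) :
    EndPlaceable n (Function.update C a (C a).addHalf) := by
  obtain ⟨u, hu, hb⟩ := hC
  refine ⟨_, hu.addHalf hn ha, fun r hr => ?_⟩
  have ha' := (hasWholeSlot_iff hn _ _ _).1 ha.1
  have := rho_mid_ne (n := n) h1 h2 k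
  rw [sum_update, hb r hr, (hu.pos a).flat ha'.1, lowPos, ha'.2.2.2, if_neg this, balTerm_flat,
    balTerm_single]
  ring

theorem EndPlaceable.complete {n l i : ℕ} (hn : 4 ≤ n) (h1 : 2 ≤ i) (h2 : i ≤ n - 2) {C : Tuple l}
    (hC : EndPlaceable n C) {k : Kind} {a : Fin l} (ha : RearLowest (HasHalf n k i) C a) :
    EndPlaceable n (Function.update C a (C a).completeHalf) := by
  obtain ⟨u, hu, hb⟩ := hC
  obtain ⟨ha, hmin⟩ := ha
  simp only [hasHalf_iff hn] at ha hmin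
  have hr := rho_mid_ne (n := n) h1 h2 k
  -- For unit blocks the low and the high position coincide, so every half is at the highest
  -- position and may be completed.
  have hpos : ∀ c, res n c = rho n k i → lowPos n c = 4 * c + 2 ∧ highPos n c = 4 * c + 2 := by
    intro c hc
    rw [lowPos, highPos, hc, if_neg hr, if_neg hr]
    exact ⟨rfl, rfl⟩
  have hua : u a = 4 * (C a).height + 2 := by
    obtain ⟨e1, e2⟩ := hpos _ ha.2.2.2
    rcases (hu.pos a).eq_low_or_high ha.1 with e | e
    exacts [e.trans e1, e.trans e2]
  refine ⟨_, hu.complete hn (hua.trans (hpos _ ha.2.2.2).2.symm) ?_, fun r hr => ?_⟩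
  · intro b e1 _ e3
    exact hmin b ⟨e3, ha.2.1, ha.2.2.1, e1.trans ha.2.2.2⟩
  · rw [sum_update, hb r hr, hua, balTerm_flat, balTerm_single]; ring

/-- The effect on the content of a change of the layers `s_i`, `s̄_{i+1}`, `s_{i+1}`, `s̄_i`, `t_i`
and `t̄_i`. -/
theorem Cont.change {n l i : ℕ} (h1 : 2 ≤ i) (h2 : i ≤ n - 2) {pat : Pattern}
    {b b' : Coords n} {C C' : Tuple l} (hb : Cont n pat b C) {p q p' q' t : ℤ}
    (hcnt : ∀ r d, cnt n C' r d = cnt n C r d + (if r = i - 1 ∧ d = .flat then p else 0) +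
      (if r = 1 - i ∧ d = .flat then q' else 0) + (if r = i ∧ d = .flat then p' else 0) +
      (if r = 2 - i ∧ d = .flat then q else 0) + (if r = i - 1 ∧ d = .broken then t else 0) +
      (if r = 1 - i ∧ d = .broken then t else 0))
    (ho : ∀ j, 1 ≤ j → j ≤ n → j ≠ i → j ≠ i + 1 →
      coord b'.1 j = coord b.1 j ∧ coord b'.2 j = coord b.2 j)
    (e1 : max 0 (coord b'.1 i - coord b'.2 i) = max 0 (coord b.1 i - coord b.2 i) + p)
    (e2 : max 0 (coord b'.2 i - coord b'.1 i) = max 0 (coord b.2 i - coord b.1 i) + q)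
    (e3 : max 0 (coord b'.1 (i + 1) - coord b'.2 (i + 1)) =
      max 0 (coord b.1 (i + 1) - coord b.2 (i + 1)) + p')
    (e4 : max 0 (coord b'.2 (i + 1) - coord b'.1 (i + 1)) =
      max 0 (coord b.2 (i + 1) - coord b.1 (i + 1)) + q')
    (e5 : min (coord b'.1 i) (coord b'.2 i) = min (coord b.1 i) (coord b.2 i) + t)
    (e6 : min (coord b'.1 (i + 1)) (coord b'.2 (i + 1)) =
      min (coord b.1 (i + 1)) (coord b.2 (i + 1))) : Cont n pat b' C' := by
  have hc : ∀ j, 1 ≤ j → j ≤ n → j = i ∨ j = i + 1 ∨ (j ≠ i ∧ j ≠ i + 1 ∧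
      coord b'.1 j = coord b.1 j ∧ coord b'.2 j = coord b.2 j) := by
    intro j g1 g2
    by_cases c1 : j = i
    · exact Or.inl c1
    by_cases c2 : j = i + 1
    · exact Or.inr (Or.inl c2)
    · exact Or.inr (Or.inr ⟨c1, c2, ho j g1 g2 c1 c2⟩)
  obtain ⟨s, sbar, s_one, sbar_one, s_last, sbar_last, t_one, t_last, ht, tbar⟩ := hb
  have h3 : 1 ≤ n ∧ 1 ≠ i ∧ 1 ≠ i + 1 ∧ n ≠ i ∧ n ≠ i + 1 ∧ 1 ≤ n - 1 ∧ n - 1 ≤ n ∧ n - 1 ≠ i ∧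
      n - 2 ≤ n ∧ ∀ j, 2 ≤ j → 1 ≤ j := by
    clear e1 e2 e3 e4 e5 e6 t_one t_last
    refine ⟨?_, ?_, ?_, ?_, ?_, ?_, ?_, ?_, ?_, fun j hj => ?_⟩ <;> omega
  obtain ⟨f1, f2, f3, f4, f5, f6, f7, f8, f9, f10⟩ := h3
  obtain ⟨o1, o2⟩ := ho 1 le_rfl f1 f2 f3
  obtain ⟨o3, o4⟩ := ho n f1 le_rfl f4 f5
  refine ⟨fun j g1 g2 => ?_, fun j g1 g2 => ?_, ?_, ?_, ?_, ?_, ?_, ?_, fun j g1 g2 => ?_,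
    fun j g1 g2 => ?_⟩
  all_goals
    rw [hcnt]
    simp only [reduceCtorEq, and_false, if_false, and_true, add_zero]
  · rw [s j g1 g2]
    rcases hc j (f10 j g1) (g2.trans (by assumption)) with c | c | ⟨c1, c2, c3, c4⟩
    · subst c; rw [e1]; clear e1 e2 e3 e4 e5 e6
      simp (disch := omega) only [if_pos, if_neg, if_true]; ring
    · subst c; rw [e3]; clear e1 e2 e3 e4 e5 e6
      simp (disch := omega) only [if_pos, if_neg, if_true]; ring
    · rw [c3, c4]; clear e1 e2 e3 e4 e5 e6
      simp (disch := omega) only [if_neg]; ring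
  · rw [sbar j g1 g2]
    rcases hc j (f10 j g1) (g2.trans (by assumption)) with c | c | ⟨c1, c2, c3, c4⟩
    · subst c; rw [e2]; clear e1 e2 e3 e4 e5 e6
      simp (disch := omega) only [if_pos, if_neg, if_true]; ring
    · subst c; rw [e4]; clear e1 e2 e3 e4 e5 e6
      simp (disch := omega) only [if_pos, if_neg, if_true]; ring
    · rw [c3, c4]; clear e1 e2 e3 e4 e5 e6
      simp (disch := omega) only [if_neg]; ring
  · rw [s_one, o1, o2]
  · rw [sbar_one, o1, o2]
  · rw [s_last, o3]
  · rw [sbar_last, o4]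
  · rw [t_one, o1, o2]; clear e1 e2 e3 e4 e5 e6
    simp (disch := omega) only [if_neg]; ring
  · rw [t_last]
    rcases hc (n - 1) f6 f7 with c | c | ⟨c1, c2, c3, c4⟩
    · exact absurd c f8
    · rw [c, e6]; clear e1 e2 e3 e4 e5 e6
      simp (disch := omega) only [if_neg]; ring
    · rw [c3, c4]; clear e1 e2 e3 e4 e5 e6
      simp (disch := omega) only [if_neg]; ring
  · rw [ht j g1 g2]
    rcases hc j (f10 j g1) (g2.trans (by assumption)) with c | c | ⟨c1, c2, c3, c4⟩
    · subst c; rw [e5]; clear e1 e2 e3 e4 e5 e6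
      simp (disch := omega) only [if_pos, if_neg, if_true]; ring
    · subst c; rw [e6]; clear e1 e2 e3 e4 e5 e6
      simp (disch := omega) only [if_pos, if_neg, if_true]; ring
    · rw [c3, c4]; clear e1 e2 e3 e4 e5 e6
      simp (disch := omega) only [if_neg]; ring
  · rw [tbar j g1 g2]
    rcases hc j (f10 j g1) (g2.trans (by assumption)) with c | c | ⟨c1, c2, c3, c4⟩
    · subst c; rw [e5]; clear e1 e2 e3 e4 e5 e6
      simp (disch := omega) only [if_pos, if_neg, if_true]; ring
    · subst c; rw [e6]; clear e1 e2 e3 e4 e5 e6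
      simp (disch := omega) only [if_pos, if_neg, if_true]; ring
    · rw [c3, c4]; clear e1 e2 e3 e4 e5 e6
      simp (disch := omega) only [if_neg]; ring

/-- Supporting `i`-slots are the layers s_i and covering ones the layers s̄_{i+1}. With both
present, x̄_{i+1} drops and x̄_i rises below x_i, so that a new pair t_i, t̄_i replaces s_i and
s̄_{i+1}. With one kind only, s_i becomes s_{i+1}, or s̄_{i+1} becomes s̄_i. With halves only, x_i ≤
x̄_i drops, and a pair t_i, t̄_i turns into s_{i+1} and s̄_i. -/
theorem FMid.spec {n l i : ℕ} (hn : 4 ≤ n) (h1 : 2 ≤ i) (h2 : i ≤ n - 2) {pat : Pattern}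
    {b : Coords n} {C C' : Tuple l} (hC : IsSlice n C) (hb : Cont n pat b C) (h : FMid n i C C') :
    IsSlice n C' ∧ Cont n pat (fRaw n i b) C' ∧ 0 < phiPerfect n i b := by
  have hp := ((isSlice_iff hn).1 hC).1
  obtain ⟨hpe, hpm⟩ := isPlaceable_iff_end.1 hp
  have rs : rho n .supporting i = i - 1 := rfl
  have rc : rho n .covering i = 1 - i := by rw [rho, if_neg (by omega)]
  have n1 : nextRes n (1 - i) = 2 - i := by rw [nextRes, if_neg (by omega)]; ring
  have n2 : nextRes n (i - 1) = i := by rw [nextRes, if_neg (by omega)]; ring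
  have s0 := hb.s i h1 (by omega)
  have s1 := hb.s (i + 1) (by omega) (by omega)
  have b0 := hb.sbar i h1 (by omega)
  have b1 := hb.sbar (i + 1) (by omega) (by omega)
  have t0 := hb.t i h1 h2
  have t1 := hb.tbar i h1 h2
  push_cast at s1 b1
  rw [show (2 : ℤ) - (i + 1) = 1 - i by ring] at b1
  rw [show (i : ℤ) + 1 - 1 = i by ring] at s1
  have slot : ∀ {D : Tuple l} {k a}, HasWholeSlot n k i (D a) → 0 < cnt n D (rho n k i) .flat :=
    fun {D k a} h => cnt_pos_iff.2 ⟨a, ((hasWholeSlot_iff hn _ _ _).1 h).2.2.2, h.1⟩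
  have noslot : ∀ {D : Tuple l} {k}, ¬ Occurs (HasWholeSlot n k i) D →
      ¬ 0 < cnt n D (rho n k i) .flat := by
    intro D k h h'
    obtain ⟨a, e1, e2⟩ := cnt_pos_iff.1 h'
    exact h ⟨a, (hasWholeSlot_iff hn _ _ _).2 ⟨e2, by omega, by omega, e1⟩⟩
  have half : ∀ {D : Tuple l} {k a}, HasHalf n k i (D a) → 0 < cnt n D (rho n k i) .broken :=
    fun {D k a} h => cnt_pos_iff.2 ⟨a, ((hasHalf_iff hn _ _ _).1 h).2.2.2, h.1⟩
  have hfr : fRaw n i b = if coord b.2 (i + 1) ≤ coord b.1 (i + 1) then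
      (b.1 - unit n i + unit n (i + 1), b.2) else (b.1, b.2 - unit n (i + 1) + unit n i) := by
    rw [fRaw, if_neg (by omega), if_pos h2]
  have hph : phiPerfect n i b = coord b.1 i + max 0 (coord b.2 (i + 1) - coord b.1 (i + 1)) := by
    rw [phiPerfect, if_neg (by omega), if_pos h2]
  have ix : 0 ≤ min (coord b.1 i) (coord b.2 i) := t0 ▸ cnt_nonneg n C _ _
  have ho : ∀ j, 1 ≤ j → j ≤ n → j ≠ i → j ≠ i + 1 → coord (fRaw n i b).1 j = coord b.1 j ∧
      coord (fRaw n i b).2 j = coord b.2 j := by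
    intro j _ _ c1 c2
    rw [hfr]
    split_ifs <;> simp [coord_unit_ne c1, coord_unit_ne c2]
  have v0 := coord_unit_self (n := n) (i := i) (by omega) (by omega)
  have v1 := coord_unit_self (n := n) (i := i + 1) (by omega) (by omega)
  have v2 := coord_unit_ne (n := n) (i := i) (j := i + 1) (by omega)
  have v3 := coord_unit_ne (n := n) (i := i + 1) (j := i) (by omega)
  -- The change of counts has the same `t` at the residues i-1 and 1-i, so the balance of halves is
  -- inherited, and the content makes the result a slice.
  suffices H : EndPlaceable n C' ∧ 0 < phiPerfect n i b ∧ ∃ p q p' q' t : ℤ,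
      (∀ r d, cnt n C' r d = cnt n C r d + (if r = i - 1 ∧ d = .flat then p else 0) +
      (if r = 1 - i ∧ d = .flat then q' else 0) + (if r = i ∧ d = .flat then p' else 0) +
      (if r = 2 - i ∧ d = .flat then q else 0) + (if r = i - 1 ∧ d = .broken then t else 0) +
      (if r = 1 - i ∧ d = .broken then t else 0)) ∧ Cont n pat (fRaw n i b) C' by
    obtain ⟨H1, H2, p, q, p', q', t, H3, H4⟩ := H
    refine ⟨(isPlaceable_iff_end.2 ⟨H1, fun r q1 q2 => ?_⟩).isSlice hn H4, H4, H2⟩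
    have := hpm r q1 q2
    rw [H3, H3]
    simp only [reduceCtorEq, and_false, if_false, and_true, add_zero]
    split_ifs <;> omega
  rcases h with ⟨a, a', ha, ha', rfl⟩ | ⟨k, a, a', C₁, hno, ha, hC₁, ha', rfl⟩ |
    ⟨hno, a, a', ha, ha', rfl⟩
  · have g := (hasWholeSlot_iff hn _ _ _).1 ha.1
    have g' := (hasWholeSlot_iff hn _ _ _).1 ha'.1
    have p1 := slot ha.1
    have p2 := slot ha'.1
    rw [rc] at g p1
    rw [rs] at g' p2
    have hne : a' ≠ a := by
      rintro rfl; have := g.2.2.2.symm.trans g'.2.2.2; omega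
    have e1 := hpe.addHalf hn h1 h2 ha
    have e2 := e1.addHalf hn h1 h2 (ha'.update hne (by simp [HasWholeSlot, Layer.addHalf]))
    rw [Function.update_of_ne hne] at e2
    have hcnt : ∀ r d, cnt n (Function.update (Function.update C a (C a).addHalf) a'
        (C a').addHalf) r d = cnt n C r d + (if r = i - 1 ∧ d = .flat then -1 else 0) +
      (if r = 1 - i ∧ d = .flat then -1 else 0) + (if r = i ∧ d = .flat then 0 else 0) +
      (if r = 2 - i ∧ d = .flat then 0 else 0) + (if r = i - 1 ∧ d = .broken then 1 else 0) +
      (if r = 1 - i ∧ d = .broken then 1 else 0) := by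
      intro r d
      rw [cnt_update_two C hne.symm]
      simp only [Layer.addHalf, g.1, g.2.2.2, g'.1, g'.2.2.2, @eq_comm _ r, @eq_comm _ d]
      simp only [ite_self, add_zero]
      split_ifs <;> ring
    refine ⟨e2, by omega, _, _, _, _, _, hcnt, hb.change h1 h2 hcnt ho ?_ ?_ ?_ ?_ ?_ ?_⟩
    all_goals
      rw [hfr, if_neg (by omega)]
      simp only [coord_add, coord_sub, v0, v1, v2, v3]
      omega
  · have g := (hasWholeSlot_iff hn _ _ _).1 ha.1
    have g' := (hasHalf_iff hn _ _ _).1 ha'.1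
    have p1 := slot ha.1
    have p2 := noslot hno
    have e1 := hpe.addHalf hn h1 h2 ha
    rw [← hC₁] at e1
    have e2 := e1.complete hn h1 h2 ha'
    -- The completed half may be on another layer than the new one. Counts do not see this: the net
    -- effect is that one flat layer passes to the next residue.
    have hcnt : ∀ r d, cnt n (Function.update C₁ a' (C₁ a').completeHalf) r d = cnt n C r d -
        (if rho n k i = r ∧ Top.flat = d then 1 else 0) +
        (if nextRes n (rho n k i) = r ∧ Top.flat = d then 1 else 0) := by
      intro r d
      rw [cnt_update, hC₁, cnt_update, ← hC₁]
      simp only [Layer.addHalf, Layer.completeHalf, res_add_one hn, g.1, g.2.2.2, g'.1, g'.2.2.2]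
      ring
    refine ⟨e2, ?_⟩
    cases k
    · simp only [Kind.swap, rs, rc] at p1 p2 hcnt
      have hcnt : ∀ r d, cnt n (Function.update C₁ a' (C₁ a').completeHalf) r d = cnt n C r d +
          (if r = i - 1 ∧ d = .flat then 0 else 0) +
          (if r = 1 - i ∧ d = .flat then -1 else 0) + (if r = i ∧ d = .flat then 0 else 0) +
          (if r = 2 - i ∧ d = .flat then 1 else 0) + (if r = i - 1 ∧ d = .broken then 0 else 0) +
          (if r = 1 - i ∧ d = .broken then 0 else 0) := by
        intro r d
        rw [hcnt, n1]
        simp only [@eq_comm _ r, @eq_comm _ d]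
        simp only [ite_self, add_zero]
        split_ifs <;> ring
      refine ⟨by omega, _, _, _, _, _, hcnt, hb.change h1 h2 hcnt ho ?_ ?_ ?_ ?_ ?_ ?_⟩
      all_goals
        rw [hfr, if_neg (by omega)]
        simp only [coord_add, coord_sub, v0, v1, v2, v3]
        omega
    · simp only [Kind.swap, rs, rc] at p1 p2 hcnt
      have hcnt : ∀ r d, cnt n (Function.update C₁ a' (C₁ a').completeHalf) r d = cnt n C r d +
          (if r = i - 1 ∧ d = .flat then -1 else 0) +
          (if r = 1 - i ∧ d = .flat then 0 else 0) + (if r = i ∧ d = .flat then 1 else 0) +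
          (if r = 2 - i ∧ d = .flat then 0 else 0) + (if r = i - 1 ∧ d = .broken then 0 else 0) +
          (if r = 1 - i ∧ d = .broken then 0 else 0) := by
        intro r d
        rw [hcnt, n2]
        simp only [@eq_comm _ r, @eq_comm _ d]
        simp only [ite_self, add_zero]
        split_ifs <;> ring
      refine ⟨by omega, _, _, _, _, _, hcnt, hb.change h1 h2 hcnt ho ?_ ?_ ?_ ?_ ?_ ?_⟩
      all_goals
        rw [hfr, if_pos (by omega)]
        simp only [coord_add, coord_sub, v0, v1, v2, v3]
        omega
  · have g := (hasHalf_iff hn _ _ _).1 ha.1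
    have g' := (hasHalf_iff hn _ _ _).1 ha'.1
    have p1 := half ha.1
    have p2 := half ha'.1
    have p3 := noslot (hno .covering)
    have p4 := noslot (hno .supporting)
    rw [rc] at g p1 p3
    rw [rs] at g' p2 p4
    have hne : a' ≠ a := by
      rintro rfl; have := g.2.2.2.symm.trans g'.2.2.2; omega
    have e1 := hpe.complete hn h1 h2 ha
    have e2 := e1.complete hn h1 h2 (ha'.update hne (by simp [HasHalf, Layer.completeHalf]))
    rw [Function.update_of_ne hne] at e2
    have hcnt : ∀ r d, cnt n (Function.update (Function.update C a (C a).completeHalf) a'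
        (C a').completeHalf) r d = cnt n C r d + (if r = i - 1 ∧ d = .flat then 0 else 0) +
      (if r = 1 - i ∧ d = .flat then 0 else 0) + (if r = i ∧ d = .flat then 1 else 0) +
      (if r = 2 - i ∧ d = .flat then 1 else 0) + (if r = i - 1 ∧ d = .broken then -1 else 0) +
      (if r = 1 - i ∧ d = .broken then -1 else 0) := by
      intro r d
      rw [cnt_update_two C hne.symm]
      simp only [Layer.completeHalf, res_add_one hn, g.1, g.2.2.2, g'.1, g'.2.2.2, n1, n2,
        @eq_comm _ r, @eq_comm _ d]
      simp only [ite_self, add_zero]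
      split_ifs <;> ring
    refine ⟨e2, by omega, _, _, _, _, _, hcnt, hb.change h1 h2 hcnt ho ?_ ?_ ?_ ?_ ?_ ?_⟩
    all_goals
      rw [hfr, if_pos (by omega)]
      simp only [coord_add, coord_sub, v0, v1, v2, v3]
      omega

/-- Without whole slots one has x_i ≤ x̄_i and x̄_{i+1} ≤ x_{i+1}, so φ_i = x_i is the number of
halves of each kind, and both kinds are available. -/
theorem exists_fMid {n l i : ℕ} (hn : 4 ≤ n) (h1 : 2 ≤ i) (h2 : i ≤ n - 2) {pat : Pattern}
    {b : Coords n} {C : Tuple l} (hb : Cont n pat b C) (h : 0 < phiPerfect n i b) :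
    ∃ C', FMid n i C C' := by
  have slot : ∀ k, Occurs (HasWholeSlot n k i) C → ∃ a, RearLowest (HasWholeSlot n k i) C a :=
    fun k hk => exists_rearLowest (fun a => (C a).height) hk
  have half : ∀ k (D : Tuple l), Occurs (HasHalf n k i) D → ∃ a, RearLowest (HasHalf n k i) D a :=
    fun k D hk => exists_rearLowest (fun a => (D a).height) hk
  have one : ∀ k, ¬ Occurs (HasWholeSlot n k.swap i) C → Occurs (HasWholeSlot n k i) C →
      ∃ C', FMid n i C C' := by
    intro k hno hk
    obtain ⟨a, ha⟩ := slot k hk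
    obtain ⟨a', ha'⟩ := half k (Function.update C a (C a).addHalf)
      ⟨a, by simpa [HasHalf, Layer.addHalf] using ha.1.2⟩
    exact ⟨_, Or.inr (Or.inl ⟨k, a, a', _, hno, ha, rfl, ha', rfl⟩)⟩
  by_cases hc : Occurs (HasWholeSlot n .covering i) C
  · by_cases hs : Occurs (HasWholeSlot n .supporting i) C
    · obtain ⟨a, ha⟩ := slot _ hc
      obtain ⟨a', ha'⟩ := slot _ hs
      exact ⟨_, Or.inl ⟨a, a', ha, ha', rfl⟩⟩
    · exact one .covering hs hc
  by_cases hs : Occurs (HasWholeSlot n .supporting i) C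
  · exact one .supporting hc hs
  have noslot : ∀ {k}, ¬ Occurs (HasWholeSlot n k i) C →
      ¬ 0 < cnt n C (rho n k i) .flat := by
    intro k h h'
    obtain ⟨a, e1, e2⟩ := cnt_pos_iff.1 h'
    exact h ⟨a, (hasWholeSlot_iff hn _ _ _).2 ⟨e2, by omega, by omega, e1⟩⟩
  have occ : ∀ k, 0 < cnt n C (rho n k i) .broken → Occurs (HasHalf n k i) C := by
    intro k h'
    obtain ⟨a, e1, e2⟩ := cnt_pos_iff.1 h'
    exact ⟨a, (hasHalf_iff hn _ _ _).2 ⟨e2, by omega, by omega, e1⟩⟩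
  have rs : rho n .supporting i = i - 1 := rfl
  have rc : rho n .covering i = 1 - i := by rw [rho, if_neg (by omega)]
  have c1 := noslot hc
  have c2 := noslot hs
  rw [rc] at c1
  rw [rs] at c2
  have s0 := hb.s i h1 (by omega)
  have b1 := hb.sbar (i + 1) (by omega) (by omega)
  push_cast at b1
  rw [show (2 : ℤ) - (i + 1) = 1 - i by ring] at b1
  have t0 := hb.t i h1 h2
  have t1 := hb.tbar i h1 h2
  have hph : phiPerfect n i b = coord b.1 i + max 0 (coord b.2 (i + 1) - coord b.1 (i + 1)) := by
    rw [phiPerfect, if_neg (by omega), if_pos h2]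
  obtain ⟨a, ha⟩ := half .covering C (occ _ (by rw [rc]; omega))
  obtain ⟨a', ha'⟩ := half .supporting C (occ _ (by rw [rs]; omega))
  refine ⟨_, Or.inr (Or.inr ⟨fun k => ?_, a, a', ha, ha', rfl⟩)⟩
  cases k
  exacts [hc, hs]

/-! ### The operators of index `0`, `1`, `n - 1`, `n` -/

theorem edgeLabel_bounds {n : ℕ} (hn : 4 ≤ n) (i : ℕ) :
    1 ≤ edgeLabel n i ∧ edgeLabel n i ≤ n - 1 := by
  unfold edgeLabel; split_ifs <;> omega

theorem rho_edgeLabel {n : ℕ} (hn : 4 ≤ n) (i : ℕ) (k : Kind) :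
    rho n k (edgeLabel n i) = endRes n i := by
  unfold edgeLabel endRes
  cases k <;> simp only [rho] <;> split_ifs <;> omega

theorem endRes_cases (n i : ℕ) : endRes n i = 0 ∨ endRes n i = n - 2 := by
  unfold endRes; split_ifs <;> simp

theorem nextRes_endRes_ne {n : ℕ} (hn : 4 ≤ n) (i : ℕ) : nextRes n (endRes n i) ≠ endRes n i := by
  unfold nextRes endRes; split_ifs <;> omega

/-- At the ends of the diagram both kinds have the same residue, so both halves are counted there;
hence the factor 2. -/
theorem SplitStep.cnt_end {n : ℕ} (hn : 4 ≤ n) {i l : ℕ} {C C' : Tuple l}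
    (h : SplitStep n (edgeLabel n i) C C') (r : ℤ) (t : Top) :
    DCrystal.cnt n C' r t = DCrystal.cnt n C r t
      - (if r = endRes n i ∧ t = .flat then 1 else 0)
      - (if r = nextRes n (endRes n i) ∧ t = .flat then 1 else 0)
      + 2 * (if r = endRes n i ∧ t = .broken then 1 else 0) := by
  obtain ⟨-, -, k, hk⟩ := h.cnt hn
  rw [hk, rho_edgeLabel hn, rho_edgeLabel hn]
  ring

theorem splits_cnt_end {n : ℕ} (hn : 4 ≤ n) {i l : ℕ} {C C' : Tuple l}
    (h : Relation.ReflTransGen (SplitStep n (edgeLabel n i)) C C') :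
    ∃ m : ℤ, ∀ r t, cnt n C' r t = cnt n C r t
      - (if r = endRes n i ∧ t = .flat then m else 0)
      - (if r = nextRes n (endRes n i) ∧ t = .flat then m else 0)
      + (if r = endRes n i ∧ t = .broken then 2 * m else 0) := by
  induction h with
  | refl => exact ⟨0, fun r t => by simp⟩
  | tail _ h ih =>
    obtain ⟨m, hm⟩ := ih
    refine ⟨m + 1, fun r t => ?_⟩
    rw [h.cnt_end hn, hm]
    split_ifs <;> ring

theorem splits_isPlaceable {n : ℕ} (hn : 4 ≤ n) {j l : ℕ} {C C' : Tuple l}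
    (h : Relation.ReflTransGen (SplitStep n j) C C') (hC : IsPlaceable n C) :
    IsPlaceable n C' := by
  induction h with
  | refl => exact hC
  | tail _ h ih => exact h.isPlaceable hn ih

theorem SplitAll.spec {n : ℕ} (hn : 4 ≤ n) {i l : ℕ} {C C' : Tuple l}
    (h : SplitAll n (edgeLabel n i) C C') (hC : IsPlaceable n C) :
    IsPlaceable n C' ∧ (cnt n C' (endRes n i) .flat = 0 ∨
      cnt n C' (nextRes n (endRes n i)) .flat = 0) ∧
    ∃ m : ℤ, ∀ r t, cnt n C' r t = cnt n C r t
      - (if r = endRes n i ∧ t = .flat then m else 0)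
      - (if r = nextRes n (endRes n i) ∧ t = .flat then m else 0)
      + (if r = endRes n i ∧ t = .broken then 2 * m else 0) := by
  obtain ⟨h1, h2⟩ := h
  refine ⟨splits_isPlaceable hn h1 hC, ?_, splits_cnt_end hn h1⟩
  by_contra hc
  have := cnt_nonneg n C' (endRes n i) .flat
  have := cnt_nonneg n C' (nextRes n (endRes n i)) .flat
  obtain ⟨D, hD⟩ := (exists_splitStep_iff hn (edgeLabel_bounds hn i).1 (edgeLabel_bounds hn i).2
    (C := C')).2 ⟨.covering, by rw [rho_edgeLabel hn]; omega, by rw [rho_edgeLabel hn]; omega⟩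
  exact h2 D hD

/-- By `IsPlaceable.exists_unsplit`, unsplitting can stop only when no half of the block is left.
The integer m is the number of splittings undone. -/
theorem UnsplitAll.spec {n : ℕ} (hn : 4 ≤ n) {i l : ℕ} {C D : Tuple l}
    (h : UnsplitAll n (edgeLabel n i) C D) (hC : IsPlaceable n C) :
    IsPlaceable n D ∧ cnt n D (endRes n i) .broken = 0 ∧
    ∃ m : ℤ, ∀ r t, cnt n C r t = cnt n D r t
      - (if r = endRes n i ∧ t = .flat then m else 0)
      - (if r = nextRes n (endRes n i) ∧ t = .flat then m else 0)
      + (if r = endRes n i ∧ t = .broken then 2 * m else 0) := by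
  obtain ⟨h1, h2⟩ := h
  have hD : IsPlaceable n D := by
    cases h1 with
    | refl => exact hC
    | tail _ h => exact (isSplitResult_iff hn).1 h.1
  refine ⟨hD, ?_, splits_cnt_end hn ?_⟩
  · by_contra hc
    have := cnt_nonneg n D (endRes n i) .broken
    obtain ⟨a, h3, h4⟩ := cnt_pos_iff.1 (lt_of_le_of_ne this (Ne.symm hc))
    obtain ⟨D', h5, h6⟩ := hD.exists_unsplit hn (edgeLabel_bounds hn i).1 (edgeLabel_bounds hn i).2
      (k := .covering) ⟨a, h4, by rw [rho_edgeLabel hn, h3]⟩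
    exact h2 D' ⟨(isSplitResult_iff hn).2 h5, h6⟩
  · clear h2 hD
    induction h1 with
    | refl => exact .refl
    | tail _ h ih => exact .head h.2 ih

theorem exists_terminal {α : Type*} {R : α → α → Prop} (μ : α → ℕ)
    (h : ∀ a b, R a b → μ b < μ a) (a : α) :
    ∃ b, Relation.ReflTransGen R a b ∧ ∀ c, ¬ R b c := by
  by_cases hc : ∃ c, R a c
  · obtain ⟨c, hc⟩ := hc
    have := h a c hc
    obtain ⟨b, h1, h2⟩ := exists_terminal μ h c
    exact ⟨b, .head hc h1, h2⟩
  · exact ⟨a, .refl, fun c hac => hc ⟨c, hac⟩⟩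
termination_by μ a

theorem exists_splitAll {n : ℕ} (hn : 4 ≤ n) (i : ℕ) {l : ℕ} (C : Tuple l) :
    ∃ D, SplitAll n (edgeLabel n i) C D := by
  refine exists_terminal (fun C : Tuple l => (cnt n C (endRes n i) .flat).toNat) ?_ C
  intro C D h
  have h1 := h.cnt_end hn (endRes n i) .flat
  have h2 := nextRes_endRes_ne hn i
  have h3 := cnt_nonneg n D (endRes n i) .flat
  simp only [h2.symm, false_and, if_false, and_self, if_true, reduceCtorEq, and_false] at h1
  omega

theorem exists_unsplitAll {n : ℕ} (hn : 4 ≤ n) (i : ℕ) {l : ℕ} (C : Tuple l) :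
    ∃ D, UnsplitAll n (edgeLabel n i) C D := by
  refine exists_terminal (fun C : Tuple l => (cnt n C (endRes n i) .broken).toNat) ?_ C
  intro C D h
  have h1 := h.2.cnt_end hn (endRes n i) .broken
  have h3 := cnt_nonneg n D (endRes n i) .broken
  simp only [if_false, and_self, if_true, reduceCtorEq, and_false] at h1
  omega

theorem addBlock_iff {n : ℕ} (hn : 4 ≤ n) (pat : Pattern) {i : ℕ} (hi : i ≤ n)
    (hi' : i ≤ 1 ∨ n - 1 ≤ i) (c d : Layer) : AddBlock n pat i c d ↔
      res n c.height = endRes n i ∧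
      ((c.top = .flat ∧ d = ⟨c.height, .single (sideOf n pat i)⟩) ∨
      (c.top = .single (sideOf n pat i).other ∧ d = ⟨c.height + 1, .flat⟩)) := by
  simp only [AddBlock, color_eq_iff hn pat hi hi', Side.other_eq_iff]
  constructor
  · rintro (⟨h1, s, ⟨h2, rfl⟩, h3⟩ | ⟨s, h1, ⟨h2, rfl⟩, h3⟩)
    · exact ⟨h2, Or.inl ⟨h1, h3⟩⟩
    · exact ⟨h2, Or.inr ⟨h1, h3⟩⟩
  · rintro ⟨h1, ⟨h2, h3⟩ | ⟨h2, h3⟩⟩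
    · exact Or.inl ⟨h2, _, ⟨h1, rfl⟩, h3⟩
    · exact Or.inr ⟨_, h2, ⟨h1, rfl⟩, h3⟩

/-- The result of adding an `i`-block to a tuple without broken halves of the whole blocks of which
the `i`-block is a half. -/
theorem IsPlaceable.addBlock {n : ℕ} (hn : 4 ≤ n) {pat : Pattern} {i : ℕ} (hi : i ≤ n)
    (hi' : i ≤ 1 ∨ n - 1 ≤ i) {l : ℕ} {D : Tuple l} (hD : IsPlaceable n D)
    (h0 : cnt n D (endRes n i) .broken = 0) {a : Fin l} {c : Layer}
    (ha : RearLowest (fun c => ∃ d, AddBlock n pat i c d) D a) (hc : AddBlock n pat i (D a) c) :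
    IsPlaceable n (Function.update D a c) ∧
    ((0 < cnt n D (endRes n i) (.single (sideOf n pat i).other) ∧
      ∀ r t, cnt n (Function.update D a c) r t = cnt n D r t
        - (if r = endRes n i ∧ t = .single (sideOf n pat i).other then 1 else 0)
        + (if r = nextRes n (endRes n i) ∧ t = .flat then 1 else 0)) ∨
    (cnt n D (endRes n i) (.single (sideOf n pat i).other) = 0 ∧
      0 < cnt n D (endRes n i) .flat ∧
      ∀ r t, cnt n (Function.update D a c) r t = cnt n D r t
        - (if r = endRes n i ∧ t = .flat then 1 else 0)
        + (if r = endRes n i ∧ t = .single (sideOf n pat i) then 1 else 0))) := by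
  obtain ⟨u, hu, hb⟩ := hD
  obtain ⟨-, hmin⟩ := ha
  simp only [addBlock_iff hn pat hi hi'] at hc hmin
  set ρ := endRes n i with hρ
  set s := sideOf n pat i
  have hslot : ∀ b, res n (D b).height = ρ →
      (D b).top = .flat ∨ (D b).top = .single s.other →
      (D a).height < (D b).height ∨ ((D a).height = (D b).height ∧ b ≤ a) := by
    rintro b h1 (h2 | h2)
    · exact hmin b ⟨_, h1, Or.inl ⟨h2, rfl⟩⟩
    · exact hmin b ⟨_, h1, Or.inr ⟨h2, rfl⟩⟩
  have hnb : ∀ b, res n (D b).height = ρ → (D b).top ≠ .broken := by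
    intro b h1 h2
    have : 0 < cnt n D ρ .broken := cnt_pos_iff.2 ⟨b, h1, h2⟩
    omega
  have hpos : ∀ b, res n (D b).height = ρ → ((D b).top = .flat ∧ u b = 4 * (D b).height) ∨
      ((∃ s', (D b).top = .single s') ∧ u b = 4 * (D b).height + 2) := by
    intro b h1
    rcases hu.pos b with h | h | h | h
    · exact Or.inl h
    · exact Or.inr ⟨h.1, h.2.2⟩
    · exact absurd h.1 (hnb b h1)
    · exact absurd h.1 (hnb b h1)
  have hdbl := endRes_cases n i
  rw [← hρ] at hdbl
  have hper : ∀ b, (D a).height = (D b).height + (2 * (n : ℤ) - 4) →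
      res n (D b).height = res n (D a).height := fun b e => by rw [e, res_add_period]
  obtain ⟨hr, ⟨ht, hc⟩ | ⟨ht, hc⟩⟩ := hc
  · have hua := (hu.pos a).flat ht
    -- Opposite half-depth blocks have precedence. At the height of `a` such a layer is two units
    -- above a flat one, hence further back and preferred; at a greater height it is a cycle up and
    -- two units outside the window. So a flat layer is chosen only if there are none.
    have hno : ∀ b, res n (D b).height = ρ → (D b).top ≠ .single s.other := by
      intro b h1 h2
      have h3 := hslot b h1 (Or.inr h2)
      have h4 := (hpos b h1).resolve_left (by simp [h2])
      rcases h3 with h3 | h3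
      · have := period_le_of_res_eq hn (hr.trans h1.symm) h3
        have := hu.win a b
        omega
      · have := hu.mono _ _ h3.2
        omega
    have hQ : cnt n D ρ (.single s.other) = 0 := cnt_eq_zero fun b h1 h2 => hno b h1 h2
    have hP := hu.raise hn a (c := c) (x := u a + 2)
      (by subst hc; exact Or.inr (Or.inl ⟨⟨s, rfl⟩, by simpa [hr] using hdbl, by simp [hua]⟩))
      (by
        subst hc
        intro s' h1 b s'' _ h2 h3
        simp only [Top.single.injEq] at h1
        subst h1
        by_contra h4
        rw [← ne_eq, Side.ne_iff] at h4
        exact hno b (h3.trans hr) (h4 ▸ h2))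
      (by omega)
      (by
        intro b h1 h2
        have hpb := (hu.pos b).bounds
        have e : (D b).height = (D a).height := by omega
        have := hpos b (by rw [e, hr])
        have hf : (D b).top = .flat := by
          rcases this with h | h
          · exact h.1
          · omega
        have := hslot b (by rw [e, hr]) (Or.inl hf)
        omega)
      (by
        intro b h1
        by_contra h2
        have hpb := (hu.pos b).bounds
        have e : (D a).height = (D b).height + (2 * (n : ℤ) - 4) := by omega
        have e' := (hper b e).trans hr
        have hf : (D b).top = .flat := by
          rcases hpos b e' with h | h
          · exact h.1
          · omega
        have := hslot b e' (Or.inl hf)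
        omega)
    have hcnt : ∀ r t, cnt n (Function.update D a c) r t = cnt n D r t
        - (if r = ρ ∧ t = .flat then 1 else 0) + (if r = ρ ∧ t = .single s then 1 else 0) := by
      intro r t
      rw [cnt_update, hc]
      simp only [hr, ht, @eq_comm _ r, @eq_comm _ t]
    refine ⟨⟨_, hP, ?_, ?_, ?_⟩, Or.inr ⟨hQ, cnt_pos_iff.2 ⟨a, hr, ht⟩, hcnt⟩⟩
    · rw [sum_update, hb.zero, hua, balTerm_flat, balTerm_single]; ring
    · rw [sum_update, hb.last, hua, balTerm_flat, balTerm_single]; ring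
    · intro r h1 h2
      simp only [hcnt, reduceCtorEq, and_false, if_false]
      linarith [hb.mid r h1 h2]
  · have hua : u a = 4 * (D a).height + 2 := ((hpos a hr).resolve_left (by simp [ht])).2
    have hside : ∀ b, res n (D b).height = ρ → u b = 4 * (D b).height + 2 →
        (D b).top = .single s.other := by
      intro b h1 h2
      obtain ⟨⟨s', h3⟩, -⟩ := (hpos b h1).resolve_left (by omega)
      rw [h3, hu.side b a s' _ h3 ht (h1.trans hr.symm)]
    have hx : u a + 2 = 4 * ((D a).height + 1) := by omega
    have hP := hu.raise hn a (c := c) (x := u a + 2)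
      (by rw [hc, hx]; exact isPos_flat n _)
      (by simp [hc])
      (by omega)
      (by
        intro b h1 h2
        have hpb := (hu.pos b).bounds
        have e : (D b).height = (D a).height := by omega
        have e' : res n (D b).height = ρ := by rw [e, hr]
        have := hpos b e'
        have := hslot b e' (Or.inr (hside b e' (by omega)))
        omega)
      (by
        intro b h1
        by_contra h2
        have hpb := (hu.pos b).bounds
        have e : (D a).height = (D b).height + (2 * (n : ℤ) - 4) := by omega
        have e' := (hper b e).trans hr
        have := hpos b e'
        have := hslot b e' (Or.inr (hside b e' (by omega)))
        omega)
    have hcnt : ∀ r t, cnt n (Function.update D a c) r t = cnt n D r t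
        - (if r = ρ ∧ t = .single s.other then 1 else 0)
        + (if r = nextRes n ρ ∧ t = .flat then 1 else 0) := by
      intro r t
      rw [cnt_update, hc]
      simp only [res_add_one hn, hr, ht, @eq_comm _ r, @eq_comm _ t]
    refine ⟨⟨_, hP, ?_, ?_, ?_⟩, Or.inl ⟨cnt_pos_iff.2 ⟨a, hr, ht⟩, hcnt⟩⟩
    · rw [sum_update, hb.zero, hx, hua, balTerm_flat, balTerm_single]; ring
    · rw [sum_update, hb.last, hx, hua, balTerm_flat, balTerm_single]; ring
    · intro r h1 h2
      simp only [hcnt, reduceCtorEq, and_false, if_false]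
      linarith [hb.mid r h1 h2]

/-- The effect of `f̃_i` on the numbers of layers. -/
theorem FEnd.cnt {n : ℕ} (hn : 4 ≤ n) {pat : Pattern} {i : ℕ} (hi : i ≤ n)
    (hi' : i ≤ 1 ∨ n - 1 ≤ i) {l : ℕ} {C C' : Tuple l} (hC : IsPlaceable n C)
    (h : FEnd n pat i C C') :
    IsPlaceable n C' ∧ (cnt n C' (endRes n i) .flat = 0 ∨
      cnt n C' (nextRes n (endRes n i)) .flat = 0) ∧
    ∃ f g t p q : ℤ, (∀ r d, cnt n C' r d = cnt n C r d
      + (if r = endRes n i ∧ d = .flat then f else 0)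
      + (if r = nextRes n (endRes n i) ∧ d = .flat then g else 0)
      + (if r = endRes n i ∧ d = .broken then 2 * t else 0)
      + (if r = endRes n i ∧ d = .single (sideOf n pat i) then p else 0)
      + (if r = endRes n i ∧ d = .single (sideOf n pat i).other then q else 0)) ∧
      ((0 < cnt n C (endRes n i) (.single (sideOf n pat i).other) ∧
        f = - t ∧ g = 1 - t ∧ p = 0 ∧ q = -1) ∨
      (cnt n C (endRes n i) (.single (sideOf n pat i).other) = 0 ∧
        0 < 2 * cnt n C (endRes n i) .flat + cnt n C (endRes n i) .broken ∧
        f = - 1 - t ∧ g = - t ∧ p = 1 ∧ q = 0)) := by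
  obtain ⟨D, a, c, hD, ha, hc, hC'⟩ := h
  obtain ⟨pD, bD, m, hm⟩ := hD.spec hn hC
  obtain ⟨pE, hE⟩ := pD.addBlock hn hi hi' bD ha hc
  obtain ⟨pC', h0, m', hm'⟩ := hC'.spec hn pE
  have hne := nextRes_endRes_ne hn i
  refine ⟨pC', h0, ?_⟩
  rcases hE with ⟨hq, hE⟩ | ⟨hq, hf, hE⟩
  · refine ⟨m - m', 1 - (m' - m), m' - m, 0, -1, fun r d => ?_, Or.inl ⟨?_, by ring, rfl, rfl, rfl⟩⟩
    · rw [hm', hE, hm]; split_ifs <;> ring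
    · rw [hm]; simpa using hq
  · refine ⟨m - m' - 1, m - m', m' - m, 1, 0, fun r d => ?_,
      Or.inr ⟨?_, ?_, by ring, by ring, rfl, rfl⟩⟩
    · rw [hm', hE, hm]; split_ifs <;> ring
    · rw [hm]; simpa using hq
    · rw [hm, hm]
      simp [hne.symm, bD]
      linarith

/-- Twice the number of flat layers plus the number of halves at this residue is unchanged by
splitting. It therefore detects flat layers that become available only after unsplitting. -/
theorem exists_fEnd {n : ℕ} (hn : 4 ≤ n) {pat : Pattern} {i : ℕ} (hi : i ≤ n)
    (hi' : i ≤ 1 ∨ n - 1 ≤ i) {l : ℕ} {C : Tuple l} (hC : IsPlaceable n C)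
    (h : 0 < DCrystal.cnt n C (endRes n i) (.single (sideOf n pat i).other) ∨
      0 < 2 * DCrystal.cnt n C (endRes n i) .flat + DCrystal.cnt n C (endRes n i) .broken) :
    ∃ C', FEnd n pat i C C' := by
  obtain ⟨D, hD⟩ := exists_unsplitAll hn i C
  obtain ⟨pD, bD, m, hm⟩ := hD.spec hn hC
  have hne := nextRes_endRes_ne hn i
  have h1 : ∃ a, ∃ d, AddBlock n pat i (D a) d := by
    simp only [addBlock_iff hn pat hi hi']
    rw [hm, hm, hm] at h
    simp [hne.symm, bD] at h
    rcases h with h | h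
    · obtain ⟨a, h1, h2⟩ := cnt_pos_iff.1 h
      exact ⟨a, _, h1, Or.inr ⟨h2, rfl⟩⟩
    · have h' : 0 < DCrystal.cnt n D (endRes n i) .flat := by linarith
      obtain ⟨a, h1, h2⟩ := cnt_pos_iff.1 h'
      exact ⟨a, _, h1, Or.inl ⟨h2, rfl⟩⟩
  obtain ⟨a, ⟨c, hc⟩, ha⟩ := exists_rearLowest (fun a => (D a).height) h1
  obtain ⟨C', hC'⟩ := exists_splitAll hn i (Function.update D a c)
  exact ⟨C', D, a, c, hD, ⟨⟨c, hc⟩, ha⟩, hc, hC'⟩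

/-! ### Contents under the operators at the ends of the diagram -/

/-- The effect on the content of a change of the layers with residue `0`, and of the layers `s_2`. -/
theorem Cont.changeLow {n l : ℕ} (hn : 4 ≤ n) {pat : Pattern} {b b' : Coords n} {C C' : Tuple l}
    (hb : Cont n pat b C) {f g t p q : ℤ}
    (hcnt : ∀ r d, cnt n C' r d = cnt n C r d + (if r = 0 ∧ d = .flat then f else 0) +
      (if r = 1 ∧ d = .flat then g else 0) + (if r = 0 ∧ d = .broken then 2 * t else 0) +
      (if r = 0 ∧ d = .single (sideOf n pat 0) then p else 0) +
      (if r = 0 ∧ d = .single (sideOf n pat 1) then q else 0))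
    (ho : ∀ j, 3 ≤ j → j ≤ n → coord b'.1 j = coord b.1 j ∧ coord b'.2 j = coord b.2 j)
    (e1 : max 0 (coord b'.1 1 - coord b'.2 1) = max 0 (coord b.1 1 - coord b.2 1) + p)
    (e2 : max 0 (coord b'.2 1 - coord b'.1 1) = max 0 (coord b.2 1 - coord b.1 1) + q)
    (e3 : max 0 (coord b'.1 2 - coord b'.2 2) = max 0 (coord b.1 2 - coord b.2 2) + g)
    (e4 : max 0 (coord b'.2 2 - coord b'.1 2) = max 0 (coord b.2 2 - coord b.1 2) + f)
    (e5 : min (coord b'.1 1) (coord b'.2 1) = min (coord b.1 1) (coord b.2 1) + t)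
    (e6 : min (coord b'.1 2) (coord b'.2 2) = min (coord b.1 2) (coord b.2 2)) :
    Cont n pat b' C' := by
  obtain ⟨s, sbar, s_one, sbar_one, s_last, sbar_last, t_one, t_last, ht, tbar⟩ := hb
  have f1 : 3 ≤ n ∧ 3 ≤ n - 1 ∧ n - 1 ≤ n ∧ n - 2 ≤ n := by
    clear e1 e2 e3 e4 e5 e6 t_one t_last; omega
  obtain ⟨f1, f2, f3, f4⟩ := f1
  obtain ⟨o1, o2⟩ := ho n f1 le_rfl
  obtain ⟨o3, o4⟩ := ho (n - 1) f2 f3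
  have hc : ∀ j, 2 ≤ j → j ≤ n → j = 2 ∨ (3 ≤ j ∧
      coord b'.1 j = coord b.1 j ∧ coord b'.2 j = coord b.2 j) := by
    intro j g1 g2
    rcases g1.eq_or_lt with c | c
    · exact Or.inl c.symm
    · exact Or.inr ⟨c, ho j c g2⟩
  have hs : sideOf n pat 0 ≠ sideOf n pat 1 := by
    rw [sideOf_one hn]; exact (Side.other_ne _).symm
  refine ⟨fun j g1 g2 => ?_, fun j g1 g2 => ?_, ?_, ?_, ?_, ?_, ?_, ?_, fun j g1 g2 => ?_,
    fun j g1 g2 => ?_⟩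
  all_goals
    rw [hcnt]
    simp only [reduceCtorEq, and_false, if_false, and_true, add_zero, Top.single.injEq, hs,
      hs.symm, and_self, if_true]
  · rw [s j g1 g2]
    rcases hc j g1 (g2.trans f3) with c | ⟨c1, c3, c4⟩
    · subst c; rw [e3]; clear e1 e2 e3 e4 e5 e6 t_one t_last
      simp (disch := omega) only [if_pos, if_neg]; ring
    · rw [c3, c4]; clear e1 e2 e3 e4 e5 e6 t_one t_last
      simp (disch := omega) only [if_neg]; ring
  · rw [sbar j g1 g2]
    rcases hc j g1 (g2.trans f3) with c | ⟨c1, c3, c4⟩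
    · subst c; rw [e4]; clear e1 e2 e3 e4 e5 e6 t_one t_last
      simp (disch := omega) only [if_pos, if_neg]; ring
    · rw [c3, c4]; clear e1 e2 e3 e4 e5 e6 t_one t_last
      simp (disch := omega) only [if_neg]; ring
  · rw [s_one, e1]
  · rw [sbar_one, e2]
  · rw [s_last, o1]; clear e1 e2 e3 e4 e5 e6 t_one t_last
    simp (disch := omega) only [if_neg]; ring
  · rw [sbar_last, o2]; clear e1 e2 e3 e4 e5 e6 t_one t_last
    simp (disch := omega) only [if_neg]; ring
  · rw [t_one, e5]; ring
  · rw [t_last, o3, o4]; clear e1 e2 e3 e4 e5 e6 t_one t_last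
    simp (disch := omega) only [if_neg]; ring
  · rw [ht j g1 g2]
    rcases hc j g1 (g2.trans f4) with c | ⟨c1, c3, c4⟩
    · subst c; rw [e6]; clear e1 e2 e3 e4 e5 e6 t_one t_last
      simp (disch := omega) only [if_neg]; ring
    · rw [c3, c4]; clear e1 e2 e3 e4 e5 e6 t_one t_last
      simp (disch := omega) only [if_neg]; ring
  · rw [tbar j g1 g2]
    rcases hc j g1 (g2.trans f4) with c | ⟨c1, c3, c4⟩
    · subst c; rw [e6]; clear e1 e2 e3 e4 e5 e6 t_one t_last
      simp (disch := omega) only [if_neg]; ring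
    · rw [c3, c4]; clear e1 e2 e3 e4 e5 e6 t_one t_last
      simp (disch := omega) only [if_neg]; ring

/-- The effect on the content of a change of the layers with residue `n - 2`, and of the layers
`s̄_{n-1}`. -/
theorem Cont.changeHigh {n l : ℕ} (hn : 4 ≤ n) {pat : Pattern} {b b' : Coords n} {C C' : Tuple l}
    (hb : Cont n pat b C) {f g t p q : ℤ}
    (hcnt : ∀ r d, cnt n C' r d = cnt n C r d + (if r = n - 2 ∧ d = .flat then f else 0) +
      (if r = 3 - n ∧ d = .flat then g else 0) + (if r = n - 2 ∧ d = .broken then 2 * t else 0) +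
      (if r = n - 2 ∧ d = .single (sideOf n pat (n - 1)) then p else 0) +
      (if r = n - 2 ∧ d = .single (sideOf n pat n) then q else 0))
    (ho : ∀ j, 1 ≤ j → j ≤ n - 2 → coord b'.1 j = coord b.1 j ∧ coord b'.2 j = coord b.2 j)
    (e1 : max 0 (coord b'.1 (n - 1) - coord b'.2 (n - 1)) =
      max 0 (coord b.1 (n - 1) - coord b.2 (n - 1)) + f)
    (e2 : max 0 (coord b'.2 (n - 1) - coord b'.1 (n - 1)) =
      max 0 (coord b.2 (n - 1) - coord b.1 (n - 1)) + g)
    (e3 : min (coord b'.1 (n - 1)) (coord b'.2 (n - 1)) =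
      min (coord b.1 (n - 1)) (coord b.2 (n - 1)) + t)
    (e4 : coord b'.1 n = coord b.1 n + p) (e5 : coord b'.2 n = coord b.2 n + q) :
    Cont n pat b' C' := by
  obtain ⟨s, sbar, s_one, sbar_one, s_last, sbar_last, t_one, t_last, ht, tbar⟩ := hb
  have f1 : 1 ≤ n - 2 := by clear e1 e2 e3 t_one t_last; omega
  obtain ⟨o1, o2⟩ := ho 1 le_rfl f1
  have hc : ∀ j, 2 ≤ j → j ≤ n - 1 → j = n - 1 ∨ (j ≤ n - 2 ∧
      coord b'.1 j = coord b.1 j ∧ coord b'.2 j = coord b.2 j) := by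
    intro j g1 g2
    have : j = n - 1 ∨ (1 ≤ j ∧ j ≤ n - 2) := by clear e1 e2 e3 t_one t_last; omega
    exact this.imp id fun h => ⟨h.2, ho j h.1 h.2⟩
  have hj : ∀ j, 2 ≤ j → 1 ≤ j := by intro j _; clear e1 e2 e3 t_one t_last; omega
  have hs : sideOf n pat (n - 1) ≠ sideOf n pat n := by
    rw [sideOf_last hn]; exact (Side.other_ne _).symm
  refine ⟨fun j g1 g2 => ?_, fun j g1 g2 => ?_, ?_, ?_, ?_, ?_, ?_, ?_, fun j g1 g2 => ?_,
    fun j g1 g2 => ?_⟩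
  all_goals
    rw [hcnt]
    simp only [reduceCtorEq, and_false, if_false, and_true, add_zero, Top.single.injEq, hs,
      hs.symm, and_self, if_true]
  · rw [s j g1 g2]
    rcases hc j g1 g2 with c | ⟨c1, c3, c4⟩
    · rw [← c] at e1; rw [e1]; clear e1 e2 e3 t_one t_last
      simp (disch := omega) only [if_pos, if_neg]; ring
    · rw [c3, c4]; clear e1 e2 e3 t_one t_last
      simp (disch := omega) only [if_neg]; ring
  · rw [sbar j g1 g2]
    rcases hc j g1 g2 with c | ⟨c1, c3, c4⟩
    · rw [← c] at e2; rw [e2]; clear e1 e2 e3 t_one t_last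
      simp (disch := omega) only [if_pos, if_neg]; ring
    · rw [c3, c4]; clear e1 e2 e3 t_one t_last
      simp (disch := omega) only [if_neg]; ring
  · rw [s_one, o1, o2]; clear e1 e2 e3 t_one t_last
    simp (disch := omega) only [if_neg]; ring
  · rw [sbar_one, o1, o2]; clear e1 e2 e3 t_one t_last
    simp (disch := omega) only [if_neg]; ring
  · rw [s_last, e4]
  · rw [sbar_last, e5]
  · rw [t_one, o1, o2]; clear e1 e2 e3 t_one t_last
    simp (disch := omega) only [if_neg]; ring
  · rw [t_last, e3]; ring
  · rw [ht j g1 g2, (ho j (hj j g1) g2).1, (ho j (hj j g1) g2).2]; clear e1 e2 e3 t_one t_last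
    simp (disch := omega) only [if_neg]; ring
  · rw [tbar j g1 g2, (ho j (hj j g1) g2).1, (ho j (hj j g1) g2).2]; clear e1 e2 e3 t_one t_last
    simp (disch := omega) only [if_neg]; ring

/-- The new numbers of s_2 and s̄_2 are nonnegative, one of them is zero because splitting was
maximal, and in both cases of `FEnd.cnt` their difference x_2 - x̄_2 rises by one. This determines
them, hence also the gain `t` of halves, which is the change of min(x_1, x̄_1). -/
theorem FEnd.spec_low {n l i : ℕ} (hn : 4 ≤ n) (hi' : i ≤ 1) {pat : Pattern}
    {b : Coords n} (hbp : IsPerfectElt n l b) {C C' : Tuple l} (hC : IsPlaceable n C)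
    (hb : Cont n pat b C) (h : FEnd n pat i C C') :
    IsPlaceable n C' ∧ Cont n pat (fRaw n i b) C' ∧ 0 < phiPerfect n i b := by
  obtain ⟨hp', hz, f, g, t, p, q, hcnt, hcase⟩ := h.cnt hn (by omega) (Or.inl hi') hC
  refine ⟨hp', ?_⟩
  have hF := cnt_nonneg n C' (endRes n i) .flat
  have hG := cnt_nonneg n C' (nextRes n (endRes n i)) .flat
  have hne := nextRes_endRes_ne hn i
  rw [hcnt (endRes n i)] at hF hz
  rw [hcnt (nextRes n _)] at hG hz
  simp only [hne, hne.symm, false_and, if_false, and_self, if_true, reduceCtorEq, and_false,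
    add_zero] at hz hF hG
  have hE : endRes n i = 0 := by simp [endRes, hi']
  have n0 : nextRes n 0 = 1 := by rw [nextRes, if_neg (by omega)]; rfl
  have g1 := hb.s 2 le_rfl (by omega)
  have g2 := hb.sbar 2 le_rfl (by omega)
  norm_num at g1 g2
  rw [hE, n0, g1, g2] at hz
  rw [hE, g2] at hF
  rw [hE, n0, g1] at hG
  rw [hE] at hcase hcnt
  rw [n0] at hcnt
  have x1 := coord_nonneg hbp 1
  have x2 := coord_nonneg hbp 2
  have lowne : ∀ j, 3 ≤ j → coord (unit n 1) j = 0 ∧ coord (unit n 2) j = 0 := fun j hj =>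
    ⟨coord_unit_ne (by omega), coord_unit_ne (by omega)⟩
  have v1 := coord_unit_self (n := n) (i := 1) (by omega) (by omega)
  have v2 := coord_unit_self (n := n) (i := 2) (by omega) (by omega)
  have w1 := coord_unit_ne (n := n) (i := 1) (j := 2) (by omega)
  have w2 := coord_unit_ne (n := n) (i := 2) (j := 1) (by omega)
  clear hp' h hC hbp
  rcases Nat.le_one_iff_eq_zero_or_eq_one.1 hi' with rfl | rfl
  · rw [← sideOf_one hn, g2, hb.t_one, hb.sbar_one] at hcase
    rw [← sideOf_one hn] at hcnt
    have hfr : fRaw n 0 b = if coord b.2 2 ≤ coord b.1 2 then (b.1 + unit n 2, b.2 - unit n 1)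
      else (b.1 + unit n 1, b.2 - unit n 2) := by simp only [fRaw, if_true]
    have hph : phiPerfect n 0 b = coord b.2 1 + max 0 (coord b.2 2 - coord b.1 2) := by
      simp only [phiPerfect, if_true]
    rw [hph, hfr]
    refine ⟨?_, by clear hcnt g1 g2 hF hG hz; omega⟩
    split_ifs with hxy
    all_goals
      refine hb.changeLow hn hcnt (fun j j1 _ => by simp [lowne j j1]) ?_ ?_ ?_ ?_ ?_ ?_
      all_goals
        simp only [coord_add, coord_sub, v1, v2, w1, w2]
        clear hcnt g1 g2 hph
        omega
  · have hso : (sideOf n pat 1).other = sideOf n pat 0 := by rw [sideOf_one hn, Side.other_other]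
    rw [hso, g2, hb.t_one, hb.s_one] at hcase
    rw [hso] at hcnt
    -- For i = 1 the two sides have exchanged their roles, so `p` and `q` change places.
    have hcnt : ∀ r d, DCrystal.cnt n C' r d = DCrystal.cnt n C r d + (if r = 0 ∧ d = .flat then f else 0) +
      (if r = 1 ∧ d = .flat then g else 0) + (if r = 0 ∧ d = .broken then 2 * t else 0) +
      (if r = 0 ∧ d = .single (sideOf n pat 0) then q else 0) +
      (if r = 0 ∧ d = .single (sideOf n pat 1) then p else 0) := by
      intro r d; rw [hcnt]; ring
    have i1 : 1 ≤ n - 2 := by omega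
    have hfr : fRaw n 1 b = if coord b.2 2 ≤ coord b.1 2 then (b.1 - unit n 1 + unit n 2, b.2)
      else (b.1, b.2 - unit n 2 + unit n 1) := by
      simp only [fRaw, one_ne_zero, if_false, if_pos i1]
    have hph : phiPerfect n 1 b = coord b.1 1 + max 0 (coord b.2 2 - coord b.1 2) := by
      simp only [phiPerfect, one_ne_zero, if_false, if_pos i1]
    rw [hph, hfr]
    refine ⟨?_, by clear hcnt g1 g2 hF hG hz; omega⟩
    split_ifs with hxy
    all_goals
      refine hb.changeLow hn hcnt (fun j j1 _ => by simp [lowne j j1]) ?_ ?_ ?_ ?_ ?_ ?_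
      all_goals
        simp only [coord_add, coord_sub, v1, v2, w1, w2]
        clear hcnt g1 g2 hph
        omega

/-- As at the lower end, maximal splitting fixes the numbers of s_{n-1} and s̄_{n-1}. Half-depth
blocks now record x_n and x̄_n themselves instead of a difference, and the condition that one of
these vanishes decides the branch of f̃_i. -/
theorem FEnd.spec_high {n l i : ℕ} (hn : 4 ≤ n) (hi : i = n - 1 ∨ i = n) {pat : Pattern}
    {b : Coords n} (hbp : IsPerfectElt n l b) {C C' : Tuple l} (hC : IsPlaceable n C)
    (hb : Cont n pat b C) (h : FEnd n pat i C C') :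
    IsPlaceable n C' ∧ Cont n pat (fRaw n i b) C' ∧ 0 < phiPerfect n i b := by
  obtain ⟨hp', hz, f, g, t, p, q, hcnt, hcase⟩ := h.cnt hn (by omega) (Or.inr (by omega)) hC
  refine ⟨hp', ?_⟩
  have hF := cnt_nonneg n C' (endRes n i) .flat
  have hG := cnt_nonneg n C' (nextRes n (endRes n i)) .flat
  have hne := nextRes_endRes_ne hn i
  rw [hcnt (endRes n i)] at hF hz
  rw [hcnt (nextRes n _)] at hG hz
  simp only [hne, hne.symm, false_and, if_false, and_self, if_true, reduceCtorEq, and_false,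
    add_zero] at hz hF hG
  have hE : endRes n i = n - 2 := by rw [endRes, if_neg (by omega)]
  have n0 : nextRes n (n - 2) = 3 - n := by rw [nextRes, if_pos rfl]
  have g1 := hb.s (n - 1) (by omega) (by omega)
  have g2 := hb.sbar (n - 1) (by omega) (by omega)
  rw [show ((n - 1 : ℕ) : ℤ) - 1 = n - 2 by omega] at g1
  rw [show 2 - ((n - 1 : ℕ) : ℤ) = 3 - n by omega] at g2
  rw [hE, n0, g1, g2] at hz
  rw [hE, g1] at hF
  rw [hE, n0, g2] at hG
  rw [hE] at hcase hcnt
  rw [n0] at hcnt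
  have x1 := coord_nonneg hbp (n - 1)
  have x2 := coord_nonneg hbp n
  have hlast := hbp.2.2.1
  have highne : ∀ j, j ≤ n - 2 → coord (unit n (n - 1)) j = 0 ∧ coord (unit n n) j = 0 :=
    fun j hj => ⟨coord_unit_ne (by omega), coord_unit_ne (by omega)⟩
  have v1 := coord_unit_self (n := n) (i := n - 1) (by omega) (by omega)
  have v2 := coord_unit_self (n := n) (i := n) (by omega) (by omega)
  have w1 := coord_unit_ne (n := n) (i := n - 1) (j := n) (by omega)
  have w2 := coord_unit_ne (n := n) (i := n) (j := n - 1) (by omega)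
  have i0 : i ≠ 0 := by omega
  have i1 : ¬ i ≤ n - 2 := by omega
  clear hp' h hC hbp
  rcases hi with hi | hi
  · have hside : sideOf n pat i = sideOf n pat (n - 1) := by rw [hi]
    rw [hside, ← sideOf_last hn, g1, hb.t_last, hb.sbar_last] at hcase
    rw [hside, ← sideOf_last hn] at hcnt
    have hfr : fRaw n i b = if coord b.2 n = 0 then (b.1 - unit n (n - 1) + unit n n, b.2)
      else (b.1, b.2 - unit n n + unit n (n - 1)) := by
      simp only [fRaw, if_neg i0, if_neg i1, if_pos hi]
    have hph : phiPerfect n i b = coord b.1 (n - 1) + coord b.2 n := by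
      simp only [phiPerfect, if_neg i0, if_neg i1, if_pos hi]
    rw [hph, hfr]
    refine ⟨?_, by clear hcnt g1 g2 hF hG hz; omega⟩
    split_ifs with hxy
    all_goals
      refine hb.changeHigh hn hcnt (fun j _ j1 => by simp [highne j j1]) ?_ ?_ ?_ ?_ ?_
      all_goals
        simp only [coord_add, coord_sub, v1, v2, w1, w2]
        clear hcnt g1 g2 hph
        omega
  · have i2 : i ≠ n - 1 := by omega
    have hside : sideOf n pat i = (sideOf n pat (n - 1)).other := by rw [hi, sideOf_last hn]
    rw [hside, Side.other_other, g1, hb.t_last, hb.s_last] at hcase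
    rw [hside, Side.other_other, ← sideOf_last hn] at hcnt
    have hcnt : ∀ r d, DCrystal.cnt n C' r d = DCrystal.cnt n C r d + (if r = n - 2 ∧ d = .flat then f else 0) +
      (if r = 3 - n ∧ d = .flat then g else 0) + (if r = n - 2 ∧ d = .broken then 2 * t else 0) +
      (if r = n - 2 ∧ d = .single (sideOf n pat (n - 1)) then q else 0) +
      (if r = n - 2 ∧ d = .single (sideOf n pat n) then p else 0) := by
      intro r d; rw [hcnt]; ring
    have hfr : fRaw n i b = if 1 ≤ coord b.1 n then (b.1 - unit n n, b.2 + unit n (n - 1))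
      else (b.1 - unit n (n - 1), b.2 + unit n n) := by
      simp only [fRaw, if_neg i0, if_neg i1, if_neg i2]
    have hph : phiPerfect n i b = coord b.1 (n - 1) + coord b.1 n := by
      simp only [phiPerfect, if_neg i0, if_neg i1, if_neg i2]
    rw [hph, hfr]
    refine ⟨?_, by clear hcnt g1 g2 hF hG hz; omega⟩
    split_ifs with hxy
    all_goals
      refine hb.changeHigh hn hcnt (fun j _ j1 => by simp [highne j j1]) ?_ ?_ ?_ ?_ ?_
      all_goals
        simp only [coord_add, coord_sub, v1, v2, w1, w2]
        clear hcnt g1 g2 hph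
        omega

theorem FStep.spec {n l i : ℕ} (hn : 4 ≤ n) (hi : i ≤ n) {pat : Pattern} {b : Coords n}
    (hbp : IsPerfectElt n l b) {C C' : Tuple l} (hC : IsSlice n C) (hb : Cont n pat b C)
    (h : FStep n pat i C C') :
    IsSlice n C' ∧ Cont n pat (fRaw n i b) C' ∧ 0 < phiPerfect n i b := by
  unfold FStep at h
  split_ifs at h with hc
  · exact h.spec hn hc.1 hc.2 hC hb
  · have hp := ((isSlice_iff hn).1 hC).1
    have key : IsPlaceable n C' ∧ Cont n pat (fRaw n i b) C' ∧ 0 < phiPerfect n i b := by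
      by_cases h1 : i ≤ 1
      · exact h.spec_low hn h1 hbp hp hb
      · exact h.spec_high hn (by omega) hbp hp hb
    exact ⟨key.1.isSlice hn key.2.1, key.2⟩

theorem exists_fStep {n l i : ℕ} (hn : 4 ≤ n) (hi : i ≤ n) {pat : Pattern} {b : Coords n}
    (hbp : IsPerfectElt n l b) {C : Tuple l} (hC : IsSlice n C) (hb : Cont n pat b C)
    (h : 0 < phiPerfect n i b) : ∃ C', FStep n pat i C C' := by
  unfold FStep
  split_ifs with hc
  · exact exists_fMid hn hc.1 hc.2 hb h
  have hp := ((isSlice_iff hn).1 hC).1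
  refine exists_fEnd hn hi (by omega) hp ?_
  have x1 := coord_nonneg hbp 1
  have x2 := coord_nonneg hbp 2
  have y1 := coord_nonneg hbp (n - 1)
  have y2 := coord_nonneg hbp n
  have hcases : i = 0 ∨ i = 1 ∨ i = n - 1 ∨ i = n := by omega
  have g2 := hb.sbar 2 le_rfl (by omega)
  norm_num at g2
  have k1 := hb.s (n - 1) (by omega) (by omega)
  rw [show ((n - 1 : ℕ) : ℤ) - 1 = n - 2 by omega] at k1
  unfold phiPerfect at h
  rcases hcases with hi | hi | hi | hi
  · rw [if_pos hi] at h
    rw [hi, ← sideOf_one hn, endRes, if_pos (by omega), hb.sbar_one, hb.t_one, g2]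
    omega
  · rw [if_neg (by omega), if_pos (by omega), hi, one_add_one_eq_two] at h
    rw [hi, sideOf_one hn, Side.other_other, endRes, if_pos (by omega), hb.s_one, hb.t_one, g2]
    omega
  · rw [if_neg (by omega), if_neg (by omega), if_pos hi] at h
    rw [hi, ← sideOf_last hn, endRes, if_neg (by omega), hb.sbar_last, hb.t_last, k1]
    omega
  · rw [if_neg (by omega), if_neg (by omega), if_neg (by omega)] at h
    rw [hi, sideOf_last hn, Side.other_other, endRes, if_neg (by omega), hb.s_last, hb.t_last, k1]
    omega

/-! ### Turning a tuple upside down -/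

/-- The layer consisting of the blocks that are absent from `c`, turned upside down. -/
def Layer.refl (c : Layer) : Layer :=
  match c.top with
  | .flat => ⟨1 - c.height, .flat⟩
  | .single s => ⟨- c.height, .single s.other⟩
  | .broken => ⟨- c.height, .broken⟩

/-- All layers turned upside down, with fore and rear interchanged. -/
def reflT {l : ℕ} (C : Tuple l) : Tuple l := fun a => (C a.rev).refl

@[simp] theorem Layer.refl_refl (c : Layer) : c.refl.refl = c := by
  obtain ⟨h, _ | s | _⟩ := c <;> simp [Layer.refl]

@[simp] theorem reflT_reflT {l : ℕ} (C : Tuple l) : reflT (reflT C) = C := by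
  funext a; simp [reflT]

theorem Layer.refl_height (c : Layer) : c.refl.height = - c.blockHeight := by
  obtain ⟨h, _ | s | _⟩ := c <;> simp [Layer.refl, Layer.blockHeight]

theorem Layer.refl_blockHeight (c : Layer) : c.refl.blockHeight = - c.height := by
  obtain ⟨h, _ | s | _⟩ := c <;> simp [Layer.refl, Layer.blockHeight]

@[simp] theorem Kind.swap_swap (k : Kind) : k.swap.swap = k := by cases k <;> rfl

theorem rho_swap_iff {n : ℕ} (hn : 4 ≤ n) (k : Kind) {j : ℕ} (h1 : 1 ≤ j) (h2 : j ≤ n - 1)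
    (h : ℤ) : res n (-h) = rho n k j ↔ res n h = rho n k.swap j := by
  have := res_lower hn h
  have := res_upper hn h
  have e := res_neg hn h
  rcases rho_spec (n := n) k h1 h2 with e' | ⟨_, e' | e'⟩ <;> split_ifs at e <;> omega

/-- Passing to the complement turns blocks into slots, and reversing heights exchanges the ascending
and the descending part of the cycle, hence the kinds. -/
theorem hasWholeBlock_refl {n : ℕ} (hn : 4 ≤ n) (k : Kind) (j : ℕ) (c : Layer) :
    HasWholeBlock n k j c.refl ↔ HasWholeSlot n k.swap j c := by
  rw [hasWholeBlock_iff hn, hasWholeSlot_iff hn]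
  obtain ⟨h, _ | s | _⟩ := c <;> simp only [Layer.refl, reduceCtorEq, false_and, true_and]
  refine and_congr_right fun h1 => and_congr_right fun h2 => ?_
  rw [show 1 - h - 1 = -h by ring, rho_swap_iff hn k h1 h2]

theorem hasWholeSlot_refl {n : ℕ} (hn : 4 ≤ n) (k : Kind) (j : ℕ) (c : Layer) :
    HasWholeSlot n k j c.refl ↔ HasWholeBlock n k.swap j c := by
  have := hasWholeBlock_refl hn k.swap j c.refl
  rwa [Layer.refl_refl, Kind.swap_swap, iff_comm] at this

theorem hasHalf_refl {n : ℕ} (hn : 4 ≤ n) (k : Kind) (j : ℕ) (c : Layer) :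
    HasHalf n k j c.refl ↔ HasHalf n k.swap j c := by
  rw [hasHalf_iff hn, hasHalf_iff hn]
  obtain ⟨h, _ | s | _⟩ := c <;> simp only [Layer.refl, reduceCtorEq, false_and, true_and]
  refine and_congr_right fun h1 => and_congr_right fun h2 => ?_
  rw [rho_swap_iff hn k h1 h2]

/-- Heights change their sign and the order of the layers is reversed, so the two selection rules
are exchanged. -/
theorem ForeHighest.refl {l : ℕ} {P Q : Layer → Prop} (hPQ : ∀ c, Q c.refl ↔ P c) {C : Tuple l}
    {a : Fin l} (h : ForeHighest P C a) : RearLowest Q (reflT C) a.rev := by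
  refine ⟨by simpa [reflT, hPQ] using h.1, fun b hb => ?_⟩
  have := h.2 b.rev (by simpa [reflT, hPQ] using hb)
  simp only [reflT, Fin.rev_rev, Layer.refl_height]
  have e : b ≤ a.rev ↔ a ≤ b.rev := by simp only [Fin.le_def, Fin.val_rev]; omega
  rw [e]
  omega

theorem RearLowest.refl {l : ℕ} {P Q : Layer → Prop} (hPQ : ∀ c, Q c.refl ↔ P c) {C : Tuple l}
    {a : Fin l} (h : RearLowest P C a) : ForeHighest Q (reflT C) a.rev := by
  refine ⟨by simpa [reflT, hPQ] using h.1, fun b hb => ?_⟩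
  have := h.2 b.rev (by simpa [reflT, hPQ] using hb)
  simp only [reflT, Fin.rev_rev, Layer.refl_blockHeight]
  have e : a.rev ≤ b ↔ b.rev ≤ a := by simp only [Fin.le_def, Fin.val_rev]; omega
  rw [e]
  omega

theorem occurs_reflT {l : ℕ} {P Q : Layer → Prop} (hPQ : ∀ c, Q c.refl ↔ P c) {C : Tuple l} :
    Occurs Q (reflT C) ↔ Occurs P C := by
  constructor
  · rintro ⟨a, ha⟩; exact ⟨a.rev, (hPQ _).1 ha⟩
  · rintro ⟨a, ha⟩; exact ⟨a.rev, by simpa [reflT, hPQ] using ha⟩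

theorem reflT_update {l : ℕ} (C : Tuple l) (a : Fin l) (c : Layer) :
    reflT (Function.update C a c) = Function.update (reflT C) a.rev c.refl := by
  funext b
  rcases eq_or_ne b a.rev with rfl | hb
  · simp [reflT]
  · have : b.rev ≠ a := fun e => hb (by rw [← e, Fin.rev_rev])
    simp [reflT, hb, this]

/-- Reflection interchanges the covering and the supporting layer, so the two updates appear in the
opposite order. -/
theorem update_swap {α β : Type*} [DecidableEq α] (C f : α → β) (a b : α) :
    Function.update (Function.update C a (f a)) b (f b) =
      Function.update (Function.update C b (f b)) a (f a) := by
  rcases eq_or_ne a b with rfl | h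
  · rfl
  · exact Function.update_comm h _ _ _

theorem Layer.refl_removeUpperHalf {c : Layer} (h : c.top = .flat) :
    c.removeUpperHalf.refl = c.refl.addHalf := by
  simp [Layer.refl, Layer.removeUpperHalf, Layer.addHalf, h]

theorem Layer.refl_addHalf {c : Layer} (h : c.top = .flat) :
    c.addHalf.refl = c.refl.removeUpperHalf := by
  simp [Layer.refl, Layer.removeUpperHalf, Layer.addHalf, h]

theorem Layer.refl_removeHalf {c : Layer} (h : c.top = .broken) :
    c.removeHalf.refl = c.refl.completeHalf := by
  simp [Layer.refl, Layer.removeHalf, Layer.completeHalf, h]; ring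

theorem Layer.refl_completeHalf {c : Layer} (h : c.top = .broken) :
    c.completeHalf.refl = c.refl.removeHalf := by
  simp [Layer.refl, Layer.removeHalf, Layer.completeHalf, h]

theorem reflT_rev {l : ℕ} (C : Tuple l) (a : Fin l) : reflT C a.rev = (C a).refl := by
  simp [reflT]

theorem hasWholeBlock_swap_refl {n : ℕ} (hn : 4 ≤ n) (k : Kind) (j : ℕ) (c : Layer) :
    HasWholeBlock n k.swap j c.refl ↔ HasWholeSlot n k j c := by
  rw [hasWholeBlock_refl hn, Kind.swap_swap]

theorem hasWholeSlot_swap_refl {n : ℕ} (hn : 4 ≤ n) (k : Kind) (j : ℕ) (c : Layer) :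
    HasWholeSlot n k.swap j c.refl ↔ HasWholeBlock n k j c := by
  rw [hasWholeSlot_refl hn, Kind.swap_swap]

theorem hasHalf_swap_refl {n : ℕ} (hn : 4 ≤ n) (k : Kind) (j : ℕ) (c : Layer) :
    HasHalf n k.swap j c.refl ↔ HasHalf n k j c := by
  rw [hasHalf_refl hn, Kind.swap_swap]

/-- The broken block and the filled slot exchange roles. The kind `k` stays: the slot had the
opposite kind, and reflection changes kinds once more. -/
theorem SplitStep.refl {n : ℕ} (hn : 4 ≤ n) {j l : ℕ} {C C' : Tuple l} (h : SplitStep n j C C') :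
    SplitStep n j (reflT C) (reflT C') := by
  obtain ⟨k, a, b, ha, hb, rfl⟩ := h
  have hab : a ≠ b := fun e => wholeBlock_ne_wholeSlot hn ha.1 hb.1 (by rw [e])
  refine ⟨k, b.rev, a.rev, hb.refl fun c => hasWholeBlock_refl hn k j c,
    ha.refl fun c => hasWholeSlot_swap_refl hn k j c, ?_⟩
  rw [reflT_update, reflT_update, Layer.refl_removeUpperHalf ha.1.1, Layer.refl_addHalf hb.1.1,
    reflT_rev, reflT_rev, Function.update_comm (fun e => hab (Fin.rev_injective e))]

theorem EMid.refl {n i : ℕ} (hn : 4 ≤ n) {l : ℕ} {C C' : Tuple l} (h : EMid n i C C') :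
    FMid n i (reflT C) (reflT C') := by
  rcases h with ⟨a, b, ha, hb, rfl⟩ | ⟨k, a, b, C₁, hno, ha, rfl, hb, rfl⟩ |
    ⟨hno, a, b, ha, hb, rfl⟩
  · refine Or.inl ⟨b.rev, a.rev, hb.refl fun c => hasWholeSlot_refl hn .covering i c,
      ha.refl fun c => hasWholeSlot_refl hn .supporting i c, ?_⟩
    rw [update_swap C (fun a => (C a).removeUpperHalf), reflT_update, reflT_update,
      Layer.refl_removeUpperHalf ha.1.1, Layer.refl_removeUpperHalf hb.1.1, reflT_rev, reflT_rev]
  · refine Or.inr (Or.inl ⟨k.swap, a.rev, b.rev, _, ?_,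
      ha.refl fun c => hasWholeSlot_swap_refl hn k i c, rfl, ?_, ?_⟩)
    · rwa [occurs_reflT fun c => hasWholeSlot_swap_refl hn k.swap i c]
    · have := hb.refl fun c => hasHalf_swap_refl hn k i c
      rwa [reflT_update, Layer.refl_removeUpperHalf ha.1.1, ← reflT_rev C a] at this
    · rw [reflT_update, Layer.refl_removeHalf hb.1.1, ← reflT_rev _ b, reflT_update,
        Layer.refl_removeUpperHalf ha.1.1, ← reflT_rev C a]
  · refine Or.inr (Or.inr ⟨fun k => ?_, b.rev, a.rev, hb.refl fun c => hasHalf_refl hn .covering i c,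
      ha.refl fun c => hasHalf_refl hn .supporting i c, ?_⟩)
    · rw [occurs_reflT fun c => hasWholeSlot_refl hn k i c]
      exact hno k.swap
    · rw [update_swap C (fun a => (C a).removeHalf), reflT_update, reflT_update,
        Layer.refl_removeHalf ha.1.1, Layer.refl_removeHalf hb.1.1, reflT_rev, reflT_rev]

theorem FMid.refl {n i : ℕ} (hn : 4 ≤ n) {l : ℕ} {C C' : Tuple l} (h : FMid n i C C') :
    EMid n i (reflT C) (reflT C') := by
  rcases h with ⟨a, b, ha, hb, rfl⟩ | ⟨k, a, b, C₁, hno, ha, rfl, hb, rfl⟩ |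
    ⟨hno, a, b, ha, hb, rfl⟩
  · refine Or.inl ⟨b.rev, a.rev, hb.refl fun c => hasWholeBlock_refl hn .covering i c,
      ha.refl fun c => hasWholeBlock_refl hn .supporting i c, ?_⟩
    rw [update_swap C (fun a => (C a).addHalf), reflT_update, reflT_update,
      Layer.refl_addHalf ha.1.1, Layer.refl_addHalf hb.1.1, reflT_rev, reflT_rev]
  · refine Or.inr (Or.inl ⟨k.swap, a.rev, b.rev, _, ?_,
      ha.refl fun c => hasWholeBlock_swap_refl hn k i c, rfl, ?_, ?_⟩)
    · rwa [occurs_reflT fun c => hasWholeBlock_swap_refl hn k.swap i c]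
    · have := hb.refl fun c => hasHalf_swap_refl hn k i c
      rwa [reflT_update, Layer.refl_addHalf ha.1.1, ← reflT_rev C a] at this
    · rw [reflT_update, Layer.refl_completeHalf hb.1.1, ← reflT_rev _ b, reflT_update,
        Layer.refl_addHalf ha.1.1, ← reflT_rev C a]
  · refine Or.inr (Or.inr ⟨fun k => ?_, b.rev, a.rev, hb.refl fun c => hasHalf_refl hn .covering i c,
      ha.refl fun c => hasHalf_refl hn .supporting i c, ?_⟩)
    · rw [occurs_reflT fun c => hasWholeBlock_refl hn k i c]
      exact hno k.swap
    · rw [update_swap C (fun a => (C a).completeHalf), reflT_update, reflT_update,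
        Layer.refl_completeHalf ha.1.1, Layer.refl_completeHalf hb.1.1, reflT_rev, reflT_rev]

/-- The block missing from `c` and present in `d` becomes one that is present in the complement of
`c` and missing from that of `d`. Its cell has the opposite height, hence the same residue, as this
is one of the two fixed residues. -/
theorem addBlock_refl {n : ℕ} (hn : 4 ≤ n) (pat : Pattern) {i : ℕ} (hi : i ≤ n)
    (hi' : i ≤ 1 ∨ n - 1 ≤ i) {c d : Layer} (h : AddBlock n pat i c d) :
    AddBlock n pat i d.refl c.refl := by
  rw [addBlock_iff hn pat hi hi'] at h ⊢
  have e : res n (-c.height) = endRes n i := by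
    rw [res_neg hn, h.1]
    rcases endRes_cases n i with e | e <;> rw [e] <;> split_ifs <;> omega
  rcases h with ⟨h1, ⟨h2, rfl⟩ | ⟨h2, rfl⟩⟩
  · simp only [Layer.refl, h2]
    exact ⟨e, Or.inr ⟨trivial, by simp; ring⟩⟩
  · simp only [Layer.refl, h2]
    exact ⟨by rw [← e]; congr 1; ring, Or.inl ⟨trivial, by simp⟩⟩

theorem addBlock_refl_iff {n : ℕ} (hn : 4 ≤ n) (pat : Pattern) {i : ℕ} (hi : i ≤ n)
    (hi' : i ≤ 1 ∨ n - 1 ≤ i) (c : Layer) :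
    ((∃ d, AddBlock n pat i d c.refl) ↔ ∃ d, AddBlock n pat i c d) ∧
    ((∃ d, AddBlock n pat i c.refl d) ↔ ∃ d, AddBlock n pat i d c) := by
  refine ⟨⟨?_, ?_⟩, ⟨?_, ?_⟩⟩
  · rintro ⟨d, hd⟩; exact ⟨d.refl, by simpa using addBlock_refl hn pat hi hi' hd⟩
  · rintro ⟨d, hd⟩; exact ⟨d.refl, addBlock_refl hn pat hi hi' hd⟩
  · rintro ⟨d, hd⟩; exact ⟨d.refl, by simpa using addBlock_refl hn pat hi hi' hd⟩
  · rintro ⟨d, hd⟩; exact ⟨d.refl, addBlock_refl hn pat hi hi' hd⟩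

/-- A flat layer of height h goes to height 1 - h, which suggests v ↦ 4 - v. This also exchanges the
offsets 1 and 3, so halves that remained and halves that were added change roles. -/
theorem IsPos.refl {n : ℕ} (hn : 4 ≤ n) {c : Layer} {v : ℤ} (h : IsPos n c v) :
    IsPos n c.refl (4 - v) := by
  obtain ⟨h', t⟩ := c
  have e : (res n (-h') = 0 ∨ res n (-h') = (n : ℤ) - 2) ↔
      (res n h' = 0 ∨ res n h' = (n : ℤ) - 2) := by
    have := res_lower hn h'
    rw [res_neg hn]; split_ifs <;> omega
  rcases t with _ | s | _ <;> simp only [IsPos, Layer.refl, e, reduceCtorEq, false_and, true_and,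
    exists_false, or_false, false_or, Top.single.injEq, exists_eq'] at h ⊢
  · omega
  · exact ⟨h.1, by omega⟩
  · rcases h with h | h
    · exact Or.inl ⟨h.1, by omega⟩
    · exact Or.inr ⟨h.1, by omega⟩

theorem sum_rev {l : ℕ} (f : Fin l → ℤ) : ∑ a : Fin l, f a.rev = ∑ a, f a :=
  Equiv.sum_comp Fin.revPerm f

theorem balTerm_refl {n : ℕ} (hn : 4 ≤ n) {r : ℤ} (hr : r = 0 ∨ r = n - 2) (v : ℤ) :
    balTerm n r (4 - v) = - balTerm n r v := by
  unfold balTerm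
  have h1 : v % 4 = 1 ∨ v % 4 = 3 → (4 - v) / 4 = - (v / 4) := by omega
  have e : res n (-(v / 4)) = r ↔ res n (v / 4) = r := by
    have := res_lower hn (v / 4)
    rw [res_neg hn]; split_ifs <;> omega
  by_cases h2 : v % 4 = 1 ∨ v % 4 = 3
  · rw [h1 h2]; simp only [e]; split_ifs <;> omega
  · split_ifs <;> omega

theorem cnt_reflT {n l : ℕ} {C : Tuple l} {r r' : ℤ} {t t' : Top}
    (h : ∀ c : Layer, (res n c.refl.height = r ∧ c.refl.top = t) ↔
      (res n c.height = r' ∧ c.top = t')) : cnt n (reflT C) r t = cnt n C r' t' := by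
  unfold cnt reflT
  simp only [h]
  exact sum_rev fun a => if res n (C a).height = r' ∧ (C a).top = t' then 1 else 0

theorem cnt_reflT_flat {n l : ℕ} (hn : 4 ≤ n) (C : Tuple l) {r : ℤ} (h1 : 3 - (n : ℤ) ≤ r) :
    cnt n (reflT C) r .flat = cnt n C (1 - r) .flat := by
  refine cnt_reflT fun ⟨h, t⟩ => ?_
  rcases t with _ | s | _ <;> simp only [Layer.refl, reduceCtorEq, and_false, and_true]
  have e1 := res_neg hn (h - 1)
  rw [neg_sub] at e1
  have e2 := res_pred hn h
  have := res_lower hn h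
  have := res_upper hn h
  split_ifs at * <;> omega

theorem cnt_reflT_broken {n l : ℕ} (hn : 4 ≤ n) (C : Tuple l) {r : ℤ} (h1 : 3 - (n : ℤ) ≤ r)
    (h2 : r ≤ n - 3) : cnt n (reflT C) r .broken = cnt n C (-r) .broken := by
  refine cnt_reflT fun ⟨h, t⟩ => ?_
  rcases t with _ | s | _ <;> simp only [Layer.refl, reduceCtorEq, and_false, and_true]
  have e1 := res_neg hn h
  have := res_lower hn h
  have := res_upper hn h
  split_ifs at * <;> omega

theorem res_neg_end {n : ℕ} (hn : 4 ≤ n) {r : ℤ} (hr : r = 0 ∨ r = n - 2) (h : ℤ) :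
    res n (-h) = r ↔ res n h = r := by
  have := res_lower hn h
  rw [res_neg hn]; split_ifs <;> omega

theorem cnt_reflT_single {n l : ℕ} (hn : 4 ≤ n) (C : Tuple l) {r : ℤ} (hr : r = 0 ∨ r = n - 2)
    (s : Side) : cnt n (reflT C) r (.single s) = cnt n C r (.single s.other) := by
  refine cnt_reflT fun ⟨h, t⟩ => ?_
  rcases t with _ | s | _ <;> simp only [Layer.refl, reduceCtorEq, and_false, Top.single.injEq]
  rw [res_neg_end hn hr, Side.other_eq_iff]

theorem cnt_reflT_broken_end {n l : ℕ} (hn : 4 ≤ n) (C : Tuple l) {r : ℤ}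
    (hr : r = 0 ∨ r = n - 2) : cnt n (reflT C) r .broken = cnt n C r .broken := by
  refine cnt_reflT fun ⟨h, t⟩ => ?_
  rcases t with _ | s | _ <;> simp only [Layer.refl, reduceCtorEq, and_false, and_true]
  exact res_neg_end hn hr h

theorem Placed.refl {n l : ℕ} (hn : 4 ≤ n) {C : Tuple l} {u : Fin l → ℤ} (h : Placed n C u) :
    Placed n (reflT C) (fun a => 4 - u a.rev) where
  mono a b hab := by
    have := h.mono b.rev a.rev (Fin.rev_le_rev.2 hab)
    omega
  win a b := by
    have := h.win b.rev a.rev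
    omega
  pos a := (h.pos a.rev).refl hn
  side a b s s' h1 h2 h3 := by
    have key : ∀ {a s}, (reflT C a).top = .single s → (C a.rev).top = .single s.other ∧
        (reflT C a).height = - (C a.rev).height := by
      intro a s
      unfold reflT
      generalize C a.rev = c
      obtain ⟨h, _ | s | _⟩ := c <;> simp only [Layer.refl, reduceCtorEq, Top.single.injEq,
        false_implies]
      rintro rfl
      simp
    obtain ⟨k1, k2⟩ := key h1
    obtain ⟨k3, k4⟩ := key h2
    have := h.side a.rev b.rev _ _ k1 k3 (by
      have r1 := h.single_res k1
      have r2 := h.single_res k3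
      rw [k2, k4] at h3
      exact ((res_neg_end hn r2 _).1 (h3.trans ((res_neg_end hn r2 _).2 rfl))))
    rw [← Side.other_other s, this, Side.other_other]

theorem IsPlaceable.refl {n l : ℕ} (hn : 4 ≤ n) {C : Tuple l} (h : IsPlaceable n C) :
    IsPlaceable n (reflT C) := by
  obtain ⟨u, hu, hb⟩ := h
  refine ⟨_, hu.refl hn, ?_, ?_, ?_⟩
  · simp only [balTerm_refl hn (Or.inl rfl), Finset.sum_neg_distrib]
    rw [sum_rev fun a => balTerm n 0 (u a), hb.zero, neg_zero]
  · simp only [balTerm_refl hn (Or.inr rfl), Finset.sum_neg_distrib]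
    rw [sum_rev fun a => balTerm n (n - 2) (u a), hb.last, neg_zero]
  · intro r h1 h2
    rw [cnt_reflT_broken hn C (by omega) h2, cnt_reflT_broken hn C (by omega) (by omega), neg_neg,
      hb.mid r h1 h2]

/-- The reflection exchanges s_i with s̄_i and t_i with t̄_i, including the half-depth blocks, which
are replaced by the opposite ones. -/
theorem Cont.refl {n l : ℕ} (hn : 4 ≤ n) {pat : Pattern} {b : Coords n} {C : Tuple l}
    (h : Cont n pat b C) : Cont n pat (swapCoords b) (reflT C) := by
  have o1 := sideOf_one hn pat
  have o2 : (sideOf n pat 1).other = sideOf n pat 0 := by rw [o1, Side.other_other]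
  have o3 := sideOf_last hn pat
  have o4 : (sideOf n pat n).other = sideOf n pat (n - 1) := by rw [o3, Side.other_other]
  refine ⟨fun i g1 g2 => ?_, fun i g1 g2 => ?_, ?_, ?_, ?_, ?_, ?_, ?_, fun j g1 g2 => ?_,
    fun j g1 g2 => ?_⟩
  · rw [cnt_reflT_flat hn C (by omega), show (1 : ℤ) - (i - 1) = 2 - i by ring]
    exact h.sbar i g1 g2
  · rw [cnt_reflT_flat hn C (by omega), show (1 : ℤ) - (2 - i) = i - 1 by ring]
    exact h.s i g1 g2
  · rw [cnt_reflT_single hn C (Or.inl rfl), ← o1]; exact h.sbar_one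
  · rw [cnt_reflT_single hn C (Or.inl rfl), o2]; exact h.s_one
  · rw [cnt_reflT_single hn C (Or.inr rfl), ← o3]; exact h.sbar_last
  · rw [cnt_reflT_single hn C (Or.inr rfl), o4]; exact h.s_last
  · rw [cnt_reflT_broken_end hn C (Or.inl rfl), min_comm]; exact h.t_one
  · rw [cnt_reflT_broken_end hn C (Or.inr rfl), min_comm]; exact h.t_last
  · rw [cnt_reflT_broken hn C (by omega) (by omega), neg_sub, min_comm]; exact h.tbar j g1 g2
  · rw [cnt_reflT_broken hn C (by omega) (by omega), neg_sub, min_comm]; exact h.t j g1 g2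

theorem IsSlice.refl {n l : ℕ} (hn : 4 ≤ n) {C : Tuple l} (h : IsSlice n C) :
    IsSlice n (reflT C) := by
  obtain ⟨b, -, hb⟩ := exists_cont hn .first h
  exact (((isSlice_iff hn).1 h).1.refl hn).isSlice hn (hb.refl hn)

theorem SplitAll.refl {n : ℕ} (hn : 4 ≤ n) {j l : ℕ} {C D : Tuple l} (h : SplitAll n j C D) :
    SplitAll n j (reflT C) (reflT D) :=
  ⟨h.1.lift reflT fun _ _ h => h.refl hn, fun D' h' =>
    h.2 (reflT D') (by simpa using h'.refl hn)⟩

theorem UnsplitStep.refl {n : ℕ} (hn : 4 ≤ n) {j l : ℕ} {C D : Tuple l} (h : UnsplitStep n j C D) :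
    UnsplitStep n j (reflT C) (reflT D) :=
  ⟨(isSplitResult_iff hn).2 (((isSplitResult_iff hn).1 h.1).refl hn), h.2.refl hn⟩

theorem UnsplitAll.refl {n : ℕ} (hn : 4 ≤ n) {j l : ℕ} {C D : Tuple l} (h : UnsplitAll n j C D) :
    UnsplitAll n j (reflT C) (reflT D) :=
  ⟨h.1.lift reflT fun _ _ h => h.refl hn, fun D' h' =>
    h.2 (reflT D') (by simpa using h'.refl hn)⟩

theorem EStep.refl {n l i : ℕ} (hn : 4 ≤ n) (hi : i ≤ n) {pat : Pattern} {C C' : Tuple l}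
    (h : EStep n pat i C C') : FStep n pat i (reflT C) (reflT C') := by
  unfold EStep FStep at *
  split_ifs at * with hc
  · exact h.refl hn
  · obtain ⟨D, a, c, hD, ha, hc, hC'⟩ := h
    have hi' : i ≤ 1 ∨ n - 1 ≤ i := by omega
    refine ⟨reflT D, a.rev, c.refl, hD.refl hn,
      ha.refl fun c => (addBlock_refl_iff hn pat hi hi' c).2, ?_, ?_⟩
    · rw [reflT_rev]; exact addBlock_refl hn pat hi hi' hc
    · rw [← reflT_update]; exact hC'.refl hn

theorem FStep.refl {n l i : ℕ} (hn : 4 ≤ n) (hi : i ≤ n) {pat : Pattern} {C C' : Tuple l}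
    (h : FStep n pat i C C') : EStep n pat i (reflT C) (reflT C') := by
  unfold EStep FStep at *
  split_ifs at * with hc
  · exact h.refl hn
  · obtain ⟨D, a, c, hD, ha, hc, hC'⟩ := h
    have hi' : i ≤ 1 ∨ n - 1 ≤ i := by omega
    refine ⟨reflT D, a.rev, c.refl, hD.refl hn,
      ha.refl fun c => (addBlock_refl_iff hn pat hi hi' c).1, ?_, ?_⟩
    · rw [reflT_rev]; exact addBlock_refl hn pat hi hi' hc
    · rw [← reflT_update]; exact hC'.refl hn

/-- A step of ẽ_i is a reflected step of f̃_i, and on coordinates the reflection is `swapCoords`,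
which conjugates `eRaw` into `fRaw`. -/
theorem EStep.spec {n l i : ℕ} (hn : 4 ≤ n) (hi : i ≤ n) {pat : Pattern} {b : Coords n}
    (hbp : IsPerfectElt n l b) {C C' : Tuple l} (hC : IsSlice n C) (hb : Cont n pat b C)
    (h : EStep n pat i C C') :
    IsSlice n C' ∧ Cont n pat (eRaw n i b) C' ∧ 0 < epsPerfect n i b := by
  obtain ⟨h1, h2, h3⟩ := (h.refl hn hi).spec hn hi (swapCoords_isPerfectElt.2 hbp) (hC.refl hn)
    (hb.refl hn)
  have h1' := h1.refl hn
  have h2' := h2.refl hn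
  rw [reflT_reflT] at h1' h2'
  rw [← eRaw_eq i (coord_nonneg hbp n).1 (coord_nonneg hbp n).2] at h2'
  exact ⟨h1', h2', h3⟩

theorem exists_eStep {n l i : ℕ} (hn : 4 ≤ n) (hi : i ≤ n) {pat : Pattern} {b : Coords n}
    (hbp : IsPerfectElt n l b) {C : Tuple l} (hC : IsSlice n C) (hb : Cont n pat b C)
    (h : 0 < epsPerfect n i b) : ∃ C', EStep n pat i C C' := by
  obtain ⟨D, hD⟩ := exists_fStep hn hi (swapCoords_isPerfectElt.2 hbp) (hC.refl hn)
    (hb.refl hn) h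
  exact ⟨reflT D, by simpa using hD.refl hn hi⟩

/-! ### The canonical map -/

/-- The canonical map. -/
noncomputable def psi {n l : ℕ} (hn : 4 ≤ n) (pat : Pattern) (b : Perfect n l) : NewCrystal n l :=
  toClass _ (exists_slice hn pat b.2).choose_spec.1

theorem toClass_eq_iff {n l : ℕ} {C D : Tuple l} {hC : IsSlice n C} {hD : IsSlice n D} :
    toClass C hC = toClass D hD ↔ Related n C D :=
  Quotient.eq (r := sliceSetoid n l)

/-- Class and content determine each other: adding δ does not alter counts, and placeable tuples
with the same content have equal counts and are therefore related. -/
theorem toClass_eq_psi_iff {n l : ℕ} (hn : 4 ≤ n) {pat : Pattern} {b : Perfect n l} {C : Tuple l}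
    {hC : IsSlice n C} : toClass C hC = psi hn pat b ↔ Cont n pat b.1 C := by
  have h := (exists_slice hn pat b.2).choose_spec
  rw [psi, toClass_eq_iff]
  constructor
  · intro hr
    exact h.2.congr fun r t => (hr.cnt_eq r t).symm
  · intro hc
    have p1 := ((isSlice_iff hn).1 hC).1
    have p2 := ((isSlice_iff hn).1 h.1).1
    exact related_of_cnt_eq hn p1 p2 (hc.cnt_eq hn p1 p2 h.2)

theorem exists_toClass {n l : ℕ} (X : NewCrystal n l) : ∃ C, ∃ hC : IsSlice n C, toClass C hC = X :=
  Quotient.inductionOn (motive := fun X => ∃ C, ∃ hC : IsSlice n C, toClass C hC = X) X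
    fun C => ⟨C.1, C.2, rfl⟩

theorem exists_toClass_eq_psi {n l : ℕ} (hn : 4 ≤ n) (pat : Pattern) {C : Tuple l}
    (hC : IsSlice n C) : ∃ b : Perfect n l, toClass C hC = psi hn pat b := by
  obtain ⟨b, hb, h⟩ := exists_cont hn pat hC
  exact ⟨⟨b, hb⟩, (toClass_eq_psi_iff hn).2 h⟩

theorem psi_bijective {n l : ℕ} (hn : 4 ≤ n) (pat : Pattern) :
    Function.Bijective (psi (l := l) hn pat) := by
  constructor
  · intro b b' h
    obtain ⟨C, hC, hX⟩ := exists_toClass (psi hn pat b)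
    exact Subtype.ext (((toClass_eq_psi_iff hn).1 hX).unique hn
      ((toClass_eq_psi_iff hn).1 (hX.trans h)))
  · intro X
    obtain ⟨C, hC, rfl⟩ := exists_toClass X
    obtain ⟨b, hb⟩ := exists_toClass_eq_psi hn pat hC
    exact ⟨b, hb.symm⟩

theorem isCanonicalImage_iff {n l : ℕ} (hn : 4 ≤ n) (pat : Pattern) (b : Perfect n l)
    (X : NewCrystal n l) : IsCanonicalImage n l pat b X ↔ psi hn pat b = X := by
  unfold IsCanonicalImage
  simp only [hasContent_iff hn]
  constructor
  · rintro ⟨C, hC, h, rfl⟩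
    exact ((toClass_eq_psi_iff hn).2 h).symm
  · intro h
    obtain ⟨C, hC, rfl⟩ := exists_toClass X
    exact ⟨C, hC, (toClass_eq_psi_iff hn).1 h.symm, rfl⟩

/-! ### From relations between slices to operators on classes -/

/-- The relation `R` between slices corresponds to the partial operator on the perfect crystal that
is given by the formula `op` where `φ` is positive. -/
structure Implements (n l : ℕ) (pat : Pattern) (R : Tuple l → Tuple l → Prop)
    (op : Coords n → Coords n) (φ : Coords n → ℤ) : Prop where
  spec : ∀ b C C', IsPerfectElt n l b → IsSlice n C → Cont n pat b C → R C C' →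
    IsSlice n C' ∧ Cont n pat (op b) C' ∧ 0 < φ b
  exists_step : ∀ b C, IsPerfectElt n l b → IsSlice n C → Cont n pat b C → 0 < φ b → ∃ C', R C C'
  isPerfectElt : ∀ b, IsPerfectElt n l b → (IsPerfectElt n l (op b) ↔ 0 < φ b)

section Implements

variable {n l : ℕ} {pat : Pattern} {R : Tuple l → Tuple l → Prop} {op : Coords n → Coords n}
  {φ : Coords n → ℤ}

theorem Implements.toPerfect_none (h : Implements n l pat R op φ) (b : Perfect n l)
    (hb : ¬ 0 < φ b.1) : toPerfect n l (op b.1) = none :=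
  dif_neg fun h' => hb ((h.isPerfectElt b.1 b.2).1 h')

/-- The representative and the step chosen in `classOp` are irrelevant: every step from a slice of
content `b` ends in a slice of content `op b`, and a step exists exactly if φ is positive. -/
theorem Implements.classOp_psi (hn : 4 ≤ n) (h : Implements n l pat R op φ) (b : Perfect n l) :
    classOp R (psi hn pat b) = (toPerfect n l (op b.1)).map (psi hn pat) := by
  unfold classOp
  split_ifs with hY
  · obtain ⟨C, C', hC, hC', h1, h2, h3⟩ := hY.choose_spec
    have hc := (toClass_eq_psi_iff hn).1 h1
    obtain ⟨-, g2, g3⟩ := h.spec b.1 C C' b.2 hC hc h3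
    have hp := (h.isPerfectElt b.1 b.2).2 g3
    rw [toPerfect, dif_pos hp, ← h2]
    exact congrArg some ((toClass_eq_psi_iff hn (b := ⟨op b.1, hp⟩)).2 g2)
  · rw [h.toPerfect_none b, Option.map_none]
    intro hb
    obtain ⟨C, hC, hX⟩ := exists_toClass (psi hn pat b)
    have hc := (toClass_eq_psi_iff hn).1 hX
    obtain ⟨C', hR⟩ := h.exists_step b.1 C b.2 hC hc hb
    exact hY ⟨_, C, C', hC, (h.spec b.1 C C' b.2 hC hc hR).1, hX, rfl, hR⟩

theorem Implements.classOp_toClass (hn : 4 ≤ n) (h : Implements n l pat R op φ) {C : Tuple l}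
    (hC : IsSlice n C) :
    (∀ C', R C C' → ∃ hC' : IsSlice n C', classOp R (toClass C hC) = some (toClass C' hC')) ∧
    ((∀ C', ¬ R C C') → classOp R (toClass C hC) = none) := by
  obtain ⟨b, hb⟩ := exists_toClass_eq_psi hn pat hC
  have hc := (toClass_eq_psi_iff hn).1 hb
  rw [hb, h.classOp_psi hn]
  constructor
  · intro C' hR
    obtain ⟨g1, g2, g3⟩ := h.spec b.1 C C' b.2 hC hc hR
    have hp := (h.isPerfectElt b.1 b.2).2 g3
    refine ⟨g1, ?_⟩
    rw [toPerfect, dif_pos hp]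
    exact congrArg some ((toClass_eq_psi_iff hn (b := ⟨op b.1, hp⟩)).2 g2).symm
  · intro hR
    rw [h.toPerfect_none b, Option.map_none]
    intro hpos
    obtain ⟨C', hR'⟩ := h.exists_step b.1 C b.2 hC hc hpos
    exact hR C' hR'

end Implements

theorem implements_f {n l : ℕ} (hn : 4 ≤ n) (pat : Pattern) (i : Fin (n + 1)) :
    Implements n l pat (FStep n pat i) (fRaw n i) (phiPerfect n i) where
  spec b _ _ hb hC hc h := h.spec hn (by omega) hb hC hc
  exists_step b _ hb hC hc h := exists_fStep hn (by omega) hb hC hc h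
  isPerfectElt b hb := fRaw_isPerfectElt_iff hn (by omega) hb

theorem implements_e {n l : ℕ} (hn : 4 ≤ n) (pat : Pattern) (i : Fin (n + 1)) :
    Implements n l pat (EStep n pat i) (eRaw n i) (epsPerfect n i) where
  spec b _ _ hb hC hc h := h.spec hn (by omega) hb hC hc
  exists_step b _ hb hC hc h := exists_eStep hn (by omega) hb hC hc h
  isPerfectElt b hb := by
    rw [eRaw_eq i (coord_nonneg hb n).1 (coord_nonneg hb n).2, swapCoords_isPerfectElt,
      fRaw_isPerfectElt_iff hn (by omega) (swapCoords_isPerfectElt.2 hb), epsPerfect_eq]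

/-! ### Exponents -/

/-- Each application lowers φ by one and is possible exactly while φ is positive. -/
theorem exponents_eq {B : Type} {g : B → Option B} {φ : B → ℤ} (h0 : ∀ b, 0 ≤ φ b)
    (h1 : ∀ b, 0 < φ b → ∃ b', g b = some b' ∧ φ b' = φ b - 1) (h2 : ∀ b, ¬ 0 < φ b → g b = none)
    (b : B) : exponents g b = Set.Iic (φ b).toNat := by
  have hnone : ∀ m : ℕ, (fun o : Option B => o.bind g)^[m] none = none := fun m =>
    Function.iterate_fixed rfl m
  ext m
  simp only [exponents, Set.mem_ofPred_eq, Set.mem_Iic]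
  induction m generalizing b with
  | zero => simp
  | succ m ih =>
    rw [Function.iterate_succ_apply, Option.bind_some]
    have := h0 b
    by_cases hb : 0 < φ b
    · obtain ⟨b', e1, e2⟩ := h1 b hb
      rw [e1, ih b', e2]; omega
    · rw [h2 b hb, hnone]; simp; omega

theorem exponents_map {B B' : Type} {g : B → Option B} {g' : B' → Option B'} {ψ : B → B'}
    (h : ∀ b, g' (ψ b) = (g b).map ψ) (b : B) : exponents g' (ψ b) = exponents g b := by
  have key : Function.Semiconj (Option.map ψ) (fun o : Option B => o.bind g)
      (fun o : Option B' => o.bind g') := by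
    rintro (_ | b)
    · rfl
    · simp [h]
  ext m
  simp only [exponents, Set.mem_ofPred_eq]
  rw [← Option.map_some, ← (key.iterate_right m).eq]
  simp

theorem phiPerfect_nonneg {n l : ℕ} (i : ℕ) {b : Coords n} (hb : IsPerfectElt n l b) :
    0 ≤ phiPerfect n i b := by
  have h := coord_nonneg hb
  have := h 1
  have := h i
  have := h (n - 1)
  have := h n
  simp only [phiPerfect]
  split_ifs <;> omega

theorem exponents_perfect_f {n l : ℕ} (hn : 4 ≤ n) (i : Fin (n + 1)) (b : Perfect n l) :
    exponents ((perfectCrystal n l).f i) b = Set.Iic (phiPerfect n i b.1).toNat := by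
  refine exponents_eq (φ := fun b : Perfect n l => phiPerfect n i b.1)
    (fun b => phiPerfect_nonneg i b.2) (fun b hb => ?_) (fun b hb => ?_) b
  · have hp := (fRaw_isPerfectElt_iff hn (by omega) b.2).2 hb
    exact ⟨⟨_, hp⟩, dif_pos hp, (phi_eps_fRaw hn (by omega) b.2).1⟩
  · exact dif_neg fun hp => hb ((fRaw_isPerfectElt_iff hn (by omega) b.2).1 hp)

theorem exponents_perfect_e {n l : ℕ} (hn : 4 ≤ n) (i : Fin (n + 1)) (b : Perfect n l) :
    exponents ((perfectCrystal n l).e i) b = Set.Iic (epsPerfect n i b.1).toNat := by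
  have key : ∀ b : Perfect n l, eRaw n i b.1 = swapCoords (fRaw n i (swapCoords b.1)) := fun b =>
    eRaw_eq i (coord_nonneg b.2 n).1 (coord_nonneg b.2 n).2
  have hp : ∀ b : Perfect n l, IsPerfectElt n l (eRaw n i b.1) ↔ 0 < epsPerfect n i b.1 := fun b => by
    rw [key, swapCoords_isPerfectElt,
      fRaw_isPerfectElt_iff hn (by omega) (swapCoords_isPerfectElt.2 b.2), epsPerfect_eq]
  refine exponents_eq (φ := fun b : Perfect n l => epsPerfect n i b.1)
    (fun b => phiPerfect_nonneg i (swapCoords_isPerfectElt.2 b.2)) (fun b hb => ?_)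
    (fun b hb => dif_neg fun h => hb ((hp b).1 h)) b
  refine ⟨⟨_, (hp b).2 hb⟩, dif_pos ((hp b).2 hb), ?_⟩
  simp only [key]
  exact (phi_eps_fRaw hn (by omega) (swapCoords_isPerfectElt.2 b.2)).1

section Psi

variable {n l : ℕ} (hn : 4 ≤ n) (pat : Pattern) (i : Fin (n + 1)) (b : Perfect n l)

theorem newF_psi : newF n l pat i (psi hn pat b) =
    ((perfectCrystal n l).f i b).map (psi hn pat) :=
  (implements_f hn pat i).classOp_psi hn b

theorem newE_psi : newE n l pat i (psi hn pat b) =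
    ((perfectCrystal n l).e i b).map (psi hn pat) :=
  (implements_e hn pat i).classOp_psi hn b

theorem exponents_newF_psi : exponents (newF n l pat i) (psi hn pat b) =
    Set.Iic (phiPerfect n i b.1).toNat := by
  rw [exponents_map (newF_psi hn pat i), exponents_perfect_f hn]

theorem exponents_newE_psi : exponents (newE n l pat i) (psi hn pat b) =
    Set.Iic (epsPerfect n i b.1).toNat := by
  rw [exponents_map (newE_psi hn pat i), exponents_perfect_e hn]

theorem newPhi_psi : (newPhi n l pat i (psi hn pat b) : ℤ) = phiPerfect n i b.1 := by
  rw [newPhi, exponents_newF_psi, csSup_Iic, Int.toNat_of_nonneg (phiPerfect_nonneg i b.2)]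

theorem newEps_psi : (newEps n l pat i (psi hn pat b) : ℤ) = epsPerfect n i b.1 := by
  rw [newEps, exponents_newE_psi, csSup_Iic]
  exact Int.toNat_of_nonneg (phiPerfect_nonneg i (swapCoords_isPerfectElt.2 b.2))

theorem isCrystalIso_psi :
    IsCrystalIso (perfectCrystal n l) (sliceCrystal n l pat) (psi hn pat) where
  bijective := psi_bijective hn pat
  wt b := funext fun i => congrArg₂ (· - ·) (newPhi_psi hn pat i b) (newEps_psi hn pat i b)
  eps i b := congrArg WithBot.some (newEps_psi hn pat i b)
  phi i b := congrArg WithBot.some (newPhi_psi hn pat i b)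
  e i b := newE_psi hn pat i b
  f i b := newF_psi hn pat i b

end Psi

/-! ### Transport of the crystal axioms and conclusion -/

/-- By surjectivity every axiom is about images under ψ. Injectivity is needed only for the
equivalence between f̃_i and ẽ_i, to compare images. -/
theorem IsCrystalIso.isCrystal {n : ℕ} {B B' : Type} {D : CrystalData n B} {D' : CrystalData n B'}
    {ψ : B → B'} (h : IsCrystalIso D D' ψ) (hD : IsCrystal D) : IsCrystal D' := by
  have surj := h.bijective.2
  have inj := h.bijective.1
  have he : ∀ i b c, D'.e i (ψ b) = some c → ∃ b', D.e i b = some b' ∧ ψ b' = c := by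
    intro i b c hc
    rwa [h.e, Option.map_eq_some_iff] at hc
  have hf : ∀ i b c, D'.f i (ψ b) = some c → ∃ b', D.f i b = some b' ∧ ψ b' = c := by
    intro i b c hc
    rwa [h.f, Option.map_eq_some_iff] at hc
  constructor
  · intro i b
    obtain ⟨b, rfl⟩ := surj b
    rw [h.phi, h.eps, h.wt]; exact hD.phi_eq i b
  · intro i b c hc
    obtain ⟨b, rfl⟩ := surj b
    obtain ⟨b', hb, rfl⟩ := he i b c hc
    rw [h.wt, h.wt]; exact hD.wt_e i b b' hb
  · intro i b c hc
    obtain ⟨b, rfl⟩ := surj b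
    obtain ⟨b', hb, rfl⟩ := hf i b c hc
    rw [h.wt, h.wt]; exact hD.wt_f i b b' hb
  · intro i b c hc
    obtain ⟨b, rfl⟩ := surj b
    obtain ⟨b', hb, rfl⟩ := he i b c hc
    rw [h.eps, h.eps]; exact hD.eps_e i b b' hb
  · intro i b c hc
    obtain ⟨b, rfl⟩ := surj b
    obtain ⟨b', hb, rfl⟩ := he i b c hc
    rw [h.phi, h.phi]; exact hD.phi_e i b b' hb
  · intro i b c hc
    obtain ⟨b, rfl⟩ := surj b
    obtain ⟨b', hb, rfl⟩ := hf i b c hc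
    rw [h.eps, h.eps]; exact hD.eps_f i b b' hb
  · intro i b c hc
    obtain ⟨b, rfl⟩ := surj b
    obtain ⟨b', hb, rfl⟩ := hf i b c hc
    rw [h.phi, h.phi]; exact hD.phi_f i b b' hb
  · intro i b c
    obtain ⟨b, rfl⟩ := surj b
    obtain ⟨c, rfl⟩ := surj c
    rw [h.e, h.f, ← Option.map_some, ← Option.map_some, (Option.map_injective inj).eq_iff,
      (Option.map_injective inj).eq_iff]
    exact hD.f_iff_e i b c
  · intro i b hb
    obtain ⟨b, rfl⟩ := surj b
    rw [h.phi] at hb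
    rw [h.e, h.f, (hD.bot i b hb).1, (hD.bot i b hb).2]
    exact ⟨rfl, rfl⟩

end DCrystal

theorem mainTheorem2 (n l : ℕ) (hn : 4 ≤ n) (hl : 1 ≤ l) (pat : DCrystal.Pattern) :
    -- adding and removing a `δ` preserves slices
    (∀ C : DCrystal.Tuple l,
      DCrystal.IsSlice n C ↔ DCrystal.IsSlice n (DCrystal.addDelta n C)) ∧
    -- the Kashiwara operators send slices to slices or to `0` and are well defined on classes
    (∀ (i : Fin (n + 1)) (C : DCrystal.Tuple l) (hC : DCrystal.IsSlice n C),
      (∀ C' : DCrystal.Tuple l, DCrystal.FStep n pat i C C' →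
        ∃ hC' : DCrystal.IsSlice n C',
          DCrystal.newF n l pat i (DCrystal.toClass C hC) = some (DCrystal.toClass C' hC')) ∧
      ((∀ C' : DCrystal.Tuple l, ¬ DCrystal.FStep n pat i C C') →
        DCrystal.newF n l pat i (DCrystal.toClass C hC) = none) ∧
      (∀ C' : DCrystal.Tuple l, DCrystal.EStep n pat i C C' →
        ∃ hC' : DCrystal.IsSlice n C',
          DCrystal.newE n l pat i (DCrystal.toClass C hC) = some (DCrystal.toClass C' hC')) ∧
      ((∀ C' : DCrystal.Tuple l, ¬ DCrystal.EStep n pat i C C') →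
        DCrystal.newE n l pat i (DCrystal.toClass C hC) = none)) ∧
    -- the maxima defining `φ_i` and `ε_i` on classes exist
    (∀ (i : Fin (n + 1)) (X : DCrystal.NewCrystal n l),
      IsGreatest (DCrystal.exponents (DCrystal.newF n l pat i) X)
        (DCrystal.newPhi n l pat i X) ∧
      IsGreatest (DCrystal.exponents (DCrystal.newE n l pat i) X)
        (DCrystal.newEps n l pat i X)) ∧
    -- both sides are `U_q'(g)`-crystals
    DCrystal.IsCrystal (DCrystal.perfectCrystal n l) ∧
    DCrystal.IsCrystal (DCrystal.sliceCrystal n l pat) ∧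
    -- the canonical map is well defined and is an isomorphism of crystals
    ∃ ψ : DCrystal.Perfect n l → DCrystal.NewCrystal n l,
      (∀ b X, DCrystal.IsCanonicalImage n l pat b X ↔ ψ b = X) ∧
      DCrystal.IsCrystalIso (DCrystal.perfectCrystal n l) (DCrystal.sliceCrystal n l pat) ψ := by
  refine ⟨fun C => DCrystal.isSlice_addDelta_iff hn C, fun i C hC => ?_, fun i X => ?_,
    DCrystal.isCrystal_perfectCrystal hn,
    (DCrystal.isCrystalIso_psi hn pat).isCrystal (DCrystal.isCrystal_perfectCrystal hn),
    DCrystal.psi hn pat, fun b X => DCrystal.isCanonicalImage_iff hn pat b X,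
    DCrystal.isCrystalIso_psi hn pat⟩
  · obtain ⟨f1, f2⟩ := (DCrystal.implements_f hn pat i).classOp_toClass hn hC
    obtain ⟨e1, e2⟩ := (DCrystal.implements_e hn pat i).classOp_toClass hn hC
    exact ⟨f1, f2, e1, e2⟩
  · obtain ⟨b, rfl⟩ := (DCrystal.psi_bijective hn pat).2 X
    rw [DCrystal.newPhi, DCrystal.newEps, DCrystal.exponents_newF_psi,
      DCrystal.exponents_newE_psi, csSup_Iic, csSup_Iic]
    exact ⟨isGreatest_Iic, isGreatest_Iic⟩
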